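/- **Setting.** Let $0\le r<p$. The covariates $x_1,\dots,x_n$ are i.i.d. random vectors in $\mathbb R^p$ with law $\nu$, $\mathbb E[x_i]=0$, $\mathbb E[x_ix_i^T]=\Sigma=\sigma^2I+\sum_{i=1}^r\theta_iu_iu_i^T$ ($\sigma>0$, $\theta_i\ge 0$, $u_1,\dots,u_r$ orthonormal) and sub-gaussian norm at most $K$, i.e. $\mathbb E[|\langle x_i,v\rangle|^m]^{1/m}\le K\sqrt m$ for all unit vectors $v$ and all real $m\ge1$. The function $\phi:\mathbb R\to\mathbb R$ (the cumulant generating function) is $C^5$ with $|\phi^{(j)}|\le B_j$, $j=2,\dots,5$. Put $\mu_j(\beta)=\mathbb E[\phi^{(j)}(\langle x,\beta\rangle)]$, where $x\sim\nu$ (evaluated at a random $\hat\beta$ by substitution), $\hat\mu_j(\beta)=\frac1n\sum_i\phi^{(j)}(\langle x_i,\beta\rangle)$, and let $B_p(R)$ be the closed ball of radius $R>0$ about $0$. Assume $\mu_2(\beta)\ge m_0>0$ for all $\beta\in B_p(R)$. For real random variables $y_1,\dots,y_n$ let $\ell(\beta)=\frac1n\sum_i[\phi(\langle x_i,\beta\rangle)-y_i\langle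 x_i,\beta\rangle]$, and let $\beta_*$ be the (random) global minimizer of $\ell$; it is only required that $\beta_*$ is a random vector which almost surely minimizes $\ell$ whenever $\beta_*\in B_p(R)$. **Algorithm.** Let $S\subset[n]$ be uniformly distributed over the subsets of size $|S|$, independently of the covariates, $\widehat\Sigma_S=\frac1{|S|}\sum_{i\in S}x_ix_i^T$, and let $Z=\zeta_r(\widehat\Sigma_S)$ be obtained from $\widehat\Sigma_S$ by keeping its eigenvectors and its $r$ largest eigenvalues and replacing all other eigenvalues by the $(r+1)$-th largest one. From a random starting point $\hat\beta^0$, the Newton–Stein method (step size $1$) computes $$\hat\beta^{t+1}=\mathcal P_{B_p(R)}\big(\hat\beta^t-Q^t\nabla\ell(\hat\beta^t)\big),\qquad Q^t=\frac1{\hat\mu_2(\hat\beta^t)}\Big[Z^{-1}-\frac{\hat\mu_4(\hat\beta^t)\,\hat\beta^t[\hat\beta^t]^T}{\hat\mu_2(\hat\beta^t)+\hat\mu_4(\hat\beta^t)\langle Z\hat\beta^t,\hat\beta^t\rangle}\Big].$$ Consider a step $t\ge1$, or $t=0$ if $\hat\beta^0\in B_p(R)$. For $\xi>0$ let $$\mathcal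 E=\Big\{\big|\mu_2(\hat\beta^t)+\mu_4(\hat\beta^t)\langle\Sigma\hat\beta^t,\hat\beta^t\rangle\big|>\xi,\ \beta_*\in B_p(R)\Big\},$$ and assume $\mathbb P(\mathcal E)\ge q>0$. **Distance to the Gaussian.** With $z\sim N_p(0,\Sigma)$ and $d_{\mathcal H}(x,z)=\sup_{h\in\mathcal H}|\mathbb E h(x)-\mathbb E h(z)|$, let $\mathfrak D(x,z)=\|\Sigma\|_2\,d_{\mathcal H_1}(x,z)+\|\Sigma\|_2^2R^2\,d_{\mathcal H_2}(x,z)+d_{\mathcal H_3}(x,z)$, where $\mathcal H_1=\{\phi^{(2)}(\langle\cdot,\beta\rangle)\}$, $\mathcal H_2=\{\phi^{(4)}(\langle\cdot,\beta\rangle)\}$, $\mathcal H_3=\{\langle v,\cdot\rangle^2\phi^{(2)}(\langle\cdot,\beta\rangle)\}$, with $\beta\in B_p(R)$ and $\|v\|_2=1$. **Claim.** There are constants $c_1,c_2,c_3,c_4,\kappa>0$ depending only on $r,\sigma,\theta_1,\dots,\theta_r$ (the eigenvalues of $\Sigma$), $R,K,B_2,B_4,m_0,\xi,q$ such that the following holds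 for all sufficiently large $n,p$ and $|S|$ with $n^{0.2}/\log n\gtrsim p$. Precisely: for all $B_3,B_5$ and $a>0$ there are $C_0,p_0,n_0$, depending only on these and on the previous parameters, such that it holds whenever $p\ge p_0$, $n\ge n_0$, $C_0p\le|S|\le n$ and $n^{0.2}/\log n\ge a\,p$. Put $$\tau_1=\kappa\Big(\mathfrak D(x,z)+c_3\sqrt{\tfrac{p}{\min\{|S|,\,n^{0.2}/\log n\}}}\Big),\qquad \tau_2=\kappa\,c_4\,p^{1.5}.$$ (i) Conditionally on $\mathcal E$, with probability at least $1-c_1e^{-c_2p}$, $$\|\hat\beta^{t+1}-\beta_*\|_2\le\tau_1\|\hat\beta^t-\beta_*\|_2+\tau_2\|\hat\beta^t-\beta_*\|_2^2 .$$ (ii) For every $\delta\ge\mathbb P(\mathcal E^C)$ and every $\epsilon\ge20R\sqrt{c_1e^{-c_2p}+\delta}$, if $\mathbb E\|\hat\beta^t-\beta_*\|_2>\epsilon$, then $$\mathbb E\|\hat\beta^{t+1}-\beta_*\|_2\le(\tau_1+0.1)\,\mathbb E\|\hat\beta^t-\beta_*\|_2+\tau_2\,\mathbb E\|\hat\beta^t-\beta_*\|_2^2$$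 (expectations in $[0,\infty]$). -/

import Mathlib

open MeasureTheory ProbabilityTheory Matrix
open scoped RealInnerProductSpace ENNReal

noncomputable section

namespace NewtonStein

/-- `ℝ^p` with the Euclidean norm. -/
abbrev Vec (p : ℕ) : Type := EuclideanSpace ℝ (Fin p)

/-- The action of a matrix on Euclidean vectors. -/
def act {p : ℕ} (A : Matrix (Fin p) (Fin p) ℝ) (v : Vec p) : Vec p :=
  Matrix.toEuclideanCLM (𝕜 := ℝ) A v

/-- The spectral norm of a matrix. -/
def specNorm {p : ℕ} (A : Matrix (Fin p) (Fin p) ℝ) : ℝ :=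
  ‖Matrix.toEuclideanCLM (𝕜 := ℝ) A‖

/-- The rank-one matrix `v vᵀ`. -/
def outer {p : ℕ} (v : Vec p) : Matrix (Fin p) (Fin p) ℝ :=
  Matrix.of fun i j => v i * v j

lemma outer_isHermitian {p : ℕ} (v : Vec p) : (outer v).IsHermitian := by
  ext i j
  simp [outer, mul_comm]

/-! ### Sub-gaussian vectors and the spiked covariance -/

/-- The sub-gaussian norm of a real random variable: the smallest `K` with
`(E |X|^m)^(1/m) ≤ K √m` for all real `m ≥ 1` (it is `∞` if there is none). -/
def psi2Norm {α : Type*} [MeasurableSpace α] (X : α → ℝ) (μ : Measure α) : ℝ≥0∞ :=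
  sInf {K : ℝ≥0∞ | ∀ m : ℝ, 1 ≤ m →
    eLpNorm X (ENNReal.ofReal m) μ ≤ K * ENNReal.ofReal (Real.sqrt m)}

/-- The sub-gaussian norm of a random vector with law `ν`: the supremum of the sub-gaussian norms
of its one-dimensional marginals along unit vectors. -/
def psi2NormVec {p : ℕ} (ν : Measure (Vec p)) : ℝ≥0∞ :=
  ⨆ v : {v : Vec p // ‖v‖ = 1}, psi2Norm (fun x => ⟪x, v.1⟫) ν

/-- The `r`-spiked covariance matrix `σ² I + ∑ θᵢ uᵢ uᵢᵀ`. -/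
def spikedCov {p r : ℕ} (σ : ℝ) (θ : Fin r → ℝ) (u : Fin r → Vec p) :
    Matrix (Fin p) (Fin p) ℝ :=
  (σ ^ 2) • (1 : Matrix (Fin p) (Fin p) ℝ) + ∑ i, θ i • outer (u i)

/-! ### The probability metrics -/

/-- `d_H(x, z) = sup_{h ∈ H} |E h(x) - E h(z)|`, for `x ∼ ν` and `z ∼ γ`. -/
def classDist {p : ℕ} (H : Set (Vec p → ℝ)) (ν γ : Measure (Vec p)) : ℝ :=
  sSup ((fun h : Vec p → ℝ => |∫ x, h x ∂ν - ∫ x, h x ∂γ|) '' H)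

/-- `H₁ = {x ↦ φ⁽²⁾(⟨x, β⟩) : ‖β‖ ≤ R}`. -/
def classH1 (p : ℕ) (φ : ℝ → ℝ) (R : ℝ) : Set (Vec p → ℝ) :=
  {h | ∃ b : Vec p, ‖b‖ ≤ R ∧ h = fun x => iteratedDeriv 2 φ ⟪x, b⟫}

/-- `H₂ = {x ↦ φ⁽⁴⁾(⟨x, β⟩) : ‖β‖ ≤ R}`. -/
def classH2 (p : ℕ) (φ : ℝ → ℝ) (R : ℝ) : Set (Vec p → ℝ) :=
  {h | ∃ b : Vec p, ‖b‖ ≤ R ∧ h = fun x => iteratedDeriv 4 φ ⟪x, b⟫}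

/-- `H₃ = {x ↦ ⟨v, x⟩² φ⁽²⁾(⟨x, β⟩) : ‖β‖ ≤ R, ‖v‖ = 1}`. -/
def classH3 (p : ℕ) (φ : ℝ → ℝ) (R : ℝ) : Set (Vec p → ℝ) :=
  {h | ∃ b v : Vec p, ‖b‖ ≤ R ∧ ‖v‖ = 1 ∧
    h = fun x => ⟪v, x⟫ ^ 2 * iteratedDeriv 2 φ ⟪x, b⟫}

/-- `𝔇(x, z) = ‖Σ‖ d_{H₁}(x, z) + ‖Σ‖² R² d_{H₂}(x, z) + d_{H₃}(x, z)` for `x ∼ ν` and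
`z ∼ N(0, Σ)`. -/
def gaussDiscrepancy {p : ℕ} (φ : ℝ → ℝ) (R : ℝ) (ν : Measure (Vec p))
    (Sig : Matrix (Fin p) (Fin p) ℝ) : ℝ :=
  specNorm Sig * classDist (classH1 p φ R) ν (multivariateGaussian 0 Sig)
    + specNorm Sig ^ 2 * R ^ 2 * classDist (classH2 p φ R) ν (multivariateGaussian 0 Sig)
    + classDist (classH3 p φ R) ν (multivariateGaussian 0 Sig)

/-! ### The algorithm -/

/-- The normalized negative log-likelihood `ℓ(β)`. -/
def negLogLik {p n : ℕ} (φ : ℝ → ℝ) (x : Fin n → Vec p) (y : Fin n → ℝ) (b : Vec p) : ℝ :=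
  (n : ℝ)⁻¹ * ∑ i, (φ ⟪x i, b⟫ - y i * ⟪x i, b⟫)

/-- The population mean `μ_j(β) = E[φ⁽ʲ⁾(⟨x, β⟩)]`, for `x ∼ ν`. -/
def popMean {p : ℕ} (φ : ℝ → ℝ) (ν : Measure (Vec p)) (j : ℕ) (b : Vec p) : ℝ :=
  ∫ x, iteratedDeriv j φ ⟪x, b⟫ ∂ν

/-- The sample mean `μ̂_j(β) = (1/n) ∑ᵢ φ⁽ʲ⁾(⟨xᵢ, β⟩)`. -/
def sampleMean {p n : ℕ} (φ : ℝ → ℝ) (x : Fin n → Vec p) (j : ℕ) (b : Vec p) : ℝ :=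
  (n : ℝ)⁻¹ * ∑ i, iteratedDeriv j φ ⟪x i, b⟫

/-- The sub-sampled covariance `(1/|S|) ∑_{i ∈ S} xᵢ xᵢᵀ`. -/
def subCov {p n : ℕ} (x : Fin n → Vec p) (S : Finset (Fin n)) : Matrix (Fin p) (Fin p) ℝ :=
  (S.card : ℝ)⁻¹ • ∑ i ∈ S, outer (x i)

lemma subCov_isHermitian {p n : ℕ} (x : Fin n → Vec p) (S : Finset (Fin n)) :
    (subCov x S).IsHermitian := by
  ext i j
  simp [subCov, Matrix.sum_apply, outer, mul_comm]

/-- The `(r+1)`-th largest eigenvalue (with multiplicity) of a symmetric matrix. -/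
def eigSucc {p : ℕ} {A : Matrix (Fin p) (Fin p) ℝ} (hA : A.IsHermitian) (r : ℕ) (hr : r < p) : ℝ :=
  hA.eigenvalues₀ ⟨r, by simpa using hr⟩

/-- Eigenvalue thresholding `ζ_r(A)`: keep the eigenvectors and the `r` largest eigenvalues, and
replace every other eigenvalue by the `(r+1)`-th largest one. (Every eigenvalue `λ` becomes
`max λ λ_{r+1}`.) -/
def eigThreshold {p : ℕ} {A : Matrix (Fin p) (Fin p) ℝ} (hA : A.IsHermitian) (r : ℕ)
    (hr : r < p) : Matrix (Fin p) (Fin p) ℝ :=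
  ∑ i, max (hA.eigenvalues i) (eigSucc hA r hr) • outer (hA.eigenvectorBasis i)

/-- The scaling matrix of the algorithm,
`Q = μ̂₂⁻¹ (Z⁻¹ - β βᵀ / (μ̂₂ / μ̂₄ + ⟨Z β, β⟩))` at `β = b`, with `Z = ζ_r(Σ̂_S)`. The rank-one term
is written as `μ̂₄ β βᵀ / (μ̂₂ + μ̂₄ ⟨Z β, β⟩)`, which also has the right value `0` at `μ̂₄ = 0`. -/
def scaling {p n : ℕ} (φ : ℝ → ℝ) (x : Fin n → Vec p) (Z : Matrix (Fin p) (Fin p) ℝ)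
    (b : Vec p) : Matrix (Fin p) (Fin p) ℝ :=
  (sampleMean φ x 2 b)⁻¹ •
    (Z⁻¹ - (sampleMean φ x 4 b / (sampleMean φ x 2 b + sampleMean φ x 4 b * ⟪act Z b, b⟫)) •
      outer b)

/-- The Euclidean projection onto the closed ball of radius `R > 0` about `0`. -/
def projBall {p : ℕ} (R : ℝ) (v : Vec p) : Vec p :=
  if ‖v‖ ≤ R then v else (R / ‖v‖) • v

/-- The iterates `β̂^t` of the Newton-Stein method with step size `1`, on the data `x, y`, with
sub-sample `S`, rank threshold `r`, projection radius `R` and starting point `b₀`. -/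
def iterate {p n : ℕ} (φ : ℝ → ℝ) (r : ℕ) (hr : r < p) (R : ℝ) (x : Fin n → Vec p)
    (y : Fin n → ℝ) (S : Finset (Fin n)) (b₀ : Vec p) : ℕ → Vec p
  | 0 => b₀
  | t + 1 =>
    let b := iterate φ r hr R x y S b₀ t
    projBall R (b - act (scaling φ x (eigThreshold (subCov_isHermitian x S) r hr) b)
      (gradient (negLogLik φ x y) b))

/-- The event `{|μ₂(β̂) + μ₄(β̂) ⟨Σ β̂, β̂⟩| > ξ, β_* ∈ B_p(R)}` for random vectors `β̂`, `β_*`. -/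
def regularEvent {Ω : Type*} {p : ℕ} (φ : ℝ → ℝ) (ν : Measure (Vec p))
    (Sig : Matrix (Fin p) (Fin p) ℝ) (ξ R : ℝ) (bhat bstar : Ω → Vec p) : Set Ω :=
  {ω | ξ < |popMean φ ν 2 (bhat ω) + popMean φ ν 4 (bhat ω) * ⟪act Sig (bhat ω), bhat ω⟫| ∧
    ‖bstar ω‖ ≤ R}

/-- The linear coefficient `τ₁ = κ (𝔇(x, z) + c₃ √(p / min{|S|, n^0.2 / log n}))`. -/
def tau1 {p : ℕ} (φ : ℝ → ℝ) (R : ℝ) (ν : Measure (Vec p)) (Sig : Matrix (Fin p) (Fin p) ℝ)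
    (n s : ℕ) (κ c₃ : ℝ) : ℝ :=
  κ * (gaussDiscrepancy φ R ν Sig
    + c₃ * Real.sqrt ((p : ℝ) / min (s : ℝ) ((n : ℝ) ^ (0.2 : ℝ) / Real.log n)))

/-- The quadratic coefficient `τ₂ = κ c₄ p^1.5`. -/
def tau2 (p : ℕ) (κ c₄ : ℝ) : ℝ := κ * c₄ * (p : ℝ) ^ (1.5 : ℝ)

end NewtonStein

end

/-!
The minimizer `β_*` is a zero of `∇ℓ`, so a step of the method maps the error `d = β̂ - β_*` to
`d - Q ∇ℓ(β̂)`, up to a projection that does not increase the distance to `β_*`. By the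
Sherman–Morrison identity `Q` is the inverse of `M̂ = μ̂₂ Z + μ̂₄ Z β̂ β̂ᵀ Z`, so the new error is
`Q (M̂ d - ∇ℓ(β̂))`. The operator norm of `Q` is bounded by a constant `κ` on the event `E`, and
`M̂ d - ∇ℓ(β̂)` is a sum of four errors (`norm_newton_step_le`).

* `M̂` against `M = μ₂ Σ + μ₄ Σ β̂ β̂ᵀ Σ`. This is controlled by the sample means of `φ''`, `φ''''`
  and by `Z - Σ`. As `Σ` is a fixed point of eigenvalue thresholding, `Z` is about as close to `Σ`
  as the sub-sampled covariance (`norm_act_eigThreshold_sub_le`), which is within `O(√(p / |S|))` of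
  it (`exists_bad_set_subCov`).
* `M` against the population Hessian `E[φ''(⟨x, β̂⟩) x xᵀ]`. For a Gaussian vector the two are equal
  by Stein's identity (`integral_sq_inner_mul_multivariateGaussian`), hence they differ by at most
  `𝔇(x, z)` (`abs_integral_sub_le_gaussDiscrepancy`).
* The population Hessian against the empirical one, and the sample means against the population
  means, uniformly over the ball: with `n = L^10`, Chernoff bounds on a net give an error `O(1 / L)`
  (`exists_bad_set_weighted_rate`), and `1 / L` is at most `√(p / min{|S|, n^0.2 / log n})`.
* The second-order remainder of `∇ℓ` between `β̂` and `β_*`. It is at most `B₃ C ‖d‖²` because the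
  empirical third moments are bounded, and `p^1.5` exceeds `B₃ C` for large `p`.

All of this holds on an event of probability `1 - 10 e⁻ᵖ` that does not depend on the step
(`exists_good_event`). Conditioning on `E` divides the failure probability by at least `q`, which
gives the first bound with `c₁ = 10 / q` and `c₂ = 1`. The exceptional event of the second bound has
probability at most `η² = c₁ e⁻ᵖ + δ`, and the error increases there by at most `2R`. This increment
is absorbed into `0.1 E‖d‖` for small `η`, and into the quadratic term for large `η`
(`lintegral_le_of_step`). Measurability of the iterates is never used: lower integrals and outer
measures suffice.
-/

namespace NewtonStein

/-! ### Matrices acting on Euclidean vectors -/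

section LinearAlgebra

variable {p : ℕ}

lemma act_apply (A : Matrix (Fin p) (Fin p) ℝ) (v : Vec p) (i : Fin p) :
    act A v i = ∑ j, A i j * v j := by
  simp [act, Matrix.ofLp_toEuclideanCLM, Matrix.mulVec, dotProduct]

lemma act_add_left (A B : Matrix (Fin p) (Fin p) ℝ) (v : Vec p) :
    act (A + B) v = act A v + act B v := by
  simp [act]

lemma act_sub_left (A B : Matrix (Fin p) (Fin p) ℝ) (v : Vec p) :
    act (A - B) v = act A v - act B v := by
  simp [act]

lemma act_smul_left (c : ℝ) (A : Matrix (Fin p) (Fin p) ℝ) (v : Vec p) :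
    act (c • A) v = c • act A v := by
  simp [act]

lemma act_sum_left {ι : Type*} (s : Finset ι) (A : ι → Matrix (Fin p) (Fin p) ℝ) (v : Vec p) :
    act (∑ i ∈ s, A i) v = ∑ i ∈ s, act (A i) v := by
  simp [act, map_sum]

lemma act_one (v : Vec p) : act (1 : Matrix (Fin p) (Fin p) ℝ) v = v := by
  simp [act]

lemma act_mul (A B : Matrix (Fin p) (Fin p) ℝ) (v : Vec p) :
    act (A * B) v = act A (act B v) := by
  simp [act]

lemma act_add_right (A : Matrix (Fin p) (Fin p) ℝ) (v w : Vec p) :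
    act A (v + w) = act A v + act A w := by
  simp [act]

lemma act_sub_right (A : Matrix (Fin p) (Fin p) ℝ) (v w : Vec p) :
    act A (v - w) = act A v - act A w := by
  simp [act]

lemma act_smul_right (A : Matrix (Fin p) (Fin p) ℝ) (c : ℝ) (v : Vec p) :
    act A (c • v) = c • act A v := by
  simp [act]

lemma norm_act_le (A : Matrix (Fin p) (Fin p) ℝ) (v : Vec p) :
    ‖act A v‖ ≤ specNorm A * ‖v‖ :=
  ContinuousLinearMap.le_opNorm _ _

lemma inner_eq_sum (v w : Vec p) : ⟪v, w⟫ = ∑ i, v i * w i := by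
  simp [PiLp.inner_apply, mul_comm]

lemma act_outer (v w : Vec p) : act (outer v) w = ⟪v, w⟫ • v := by
  ext i
  rw [act_apply, inner_eq_sum]
  simp only [outer, Matrix.of_apply, PiLp.smul_apply, smul_eq_mul, Finset.sum_mul]
  exact Finset.sum_congr rfl fun j _ => by ring

lemma inner_act_eq_sum (A : Matrix (Fin p) (Fin p) ℝ) (v w : Vec p) :
    ⟪act A v, w⟫ = ∑ i, ∑ j, A i j * (v j * w i) := by
  rw [inner_eq_sum]
  refine Finset.sum_congr rfl fun i _ => ?_
  rw [act_apply, Finset.sum_mul]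
  exact Finset.sum_congr rfl fun j _ => by ring

lemma inner_act_comm {A : Matrix (Fin p) (Fin p) ℝ} (hA : A.IsHermitian) (v w : Vec p) :
    ⟪act A v, w⟫ = ⟪v, act A w⟫ := by
  rw [real_inner_comm (act A w) v, inner_act_eq_sum, inner_act_eq_sum, Finset.sum_comm]
  refine Finset.sum_congr rfl fun i _ => Finset.sum_congr rfl fun j _ => ?_
  have : A j i = A i j := by simpa using hA.apply i j
  rw [this]; ring

/-- The bilinear form of a symmetric operator is bounded by the bound of its quadratic form. -/
lemma abs_inner_le_of_quadratic_le (T : Vec p → Vec p)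
    (hadd : ∀ v w, T (v + w) = T v + T w) (hsub : ∀ v w, T (v - w) = T v - T w)
    (hsymm : ∀ v w, ⟪T v, w⟫ = ⟪v, T w⟫) {c : ℝ} (hq : ∀ v, |⟪T v, v⟫| ≤ c * ‖v‖ ^ 2)
    {v w : Vec p} (hv : ‖v‖ = 1) (hw : ‖w‖ = 1) : |⟪T v, w⟫| ≤ c := by
  have e1 : ⟪T (v + w), v + w⟫ - ⟪T (v - w), v - w⟫ = 4 * ⟪T v, w⟫ := by
    rw [hadd, hsub]
    simp only [inner_add_left, inner_add_right, inner_sub_left, inner_sub_right]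
    have : ⟪T w, v⟫ = ⟪T v, w⟫ := by rw [hsymm w v, real_inner_comm]
    rw [this]; ring
  have par := parallelogram_law_with_norm ℝ v w
  have h1 := abs_le.1 (hq (v + w))
  have h2 := abs_le.1 (hq (v - w))
  have h3 : c * ‖v + w‖ ^ 2 + c * ‖v - w‖ ^ 2 = 4 * c := by
    rw [← mul_add]
    have : ‖v + w‖ ^ 2 + ‖v - w‖ ^ 2 = 4 := by
      rw [hv, hw] at par; nlinarith [par]
    rw [this]; ring
  rw [abs_le]
  constructor <;> linarith [h1.1, h1.2, h2.1, h2.2]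

lemma norm_le_of_forall_inner_le {v : Vec p} {c : ℝ} (hc : 0 ≤ c)
    (h : ∀ w : Vec p, ‖w‖ = 1 → |⟪v, w⟫| ≤ c) : ‖v‖ ≤ c := by
  by_cases hv : v = 0
  · simpa [hv] using hc
  have hn : ‖v‖ ≠ 0 := norm_ne_zero_iff.2 hv
  have := h (‖v‖⁻¹ • v) (by rw [norm_smul, norm_inv, norm_norm, inv_mul_cancel₀ hn])
  rw [inner_smul_right, real_inner_self_eq_norm_sq] at this
  have e : ‖v‖⁻¹ * ‖v‖ ^ 2 = ‖v‖ := by field_simp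
  rw [e] at this
  exact (le_abs_self _).trans this

lemma norm_le_of_quadratic_le (T : Vec p → Vec p)
    (hadd : ∀ v w, T (v + w) = T v + T w) (hsub : ∀ v w, T (v - w) = T v - T w)
    (hsmul : ∀ (a : ℝ) v, T (a • v) = a • T v)
    (hsymm : ∀ v w, ⟪T v, w⟫ = ⟪v, T w⟫) {c : ℝ} (hc : 0 ≤ c)
    (hq : ∀ v, |⟪T v, v⟫| ≤ c * ‖v‖ ^ 2) (v : Vec p) : ‖T v‖ ≤ c * ‖v‖ := by
  by_cases hv : v = 0
  · have : T v = 0 := by rw [hv]; simpa using hsmul 0 0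
    rw [this]; simp [hv]
  have hn : ‖v‖ ≠ 0 := norm_ne_zero_iff.2 hv
  have h1 : ‖‖v‖⁻¹ • v‖ = 1 := by rw [norm_smul, norm_inv, norm_norm, inv_mul_cancel₀ hn]
  have h2 : ‖T (‖v‖⁻¹ • v)‖ ≤ c :=
    norm_le_of_forall_inner_le hc fun w hw => abs_inner_le_of_quadratic_le T hadd hsub hsymm hq h1 hw
  rw [hsmul, norm_smul, norm_inv, norm_norm, inv_mul_le_iff₀ (by positivity)] at h2
  linarith

/-! ### The spiked covariance -/

lemma act_spikedCov {r : ℕ} (σ : ℝ) (θ : Fin r → ℝ) (u : Fin r → Vec p) (v : Vec p) :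
    act (spikedCov σ θ u) v = (σ ^ 2) • v + ∑ i, (θ i * ⟪u i, v⟫) • u i := by
  simp only [spikedCov, act_add_left, act_smul_left, act_one, act_sum_left, act_outer, smul_smul]

lemma inner_act_spikedCov {r : ℕ} (σ : ℝ) (θ : Fin r → ℝ) (u : Fin r → Vec p) (v w : Vec p) :
    ⟪act (spikedCov σ θ u) v, w⟫ = σ ^ 2 * ⟪v, w⟫ + ∑ i, θ i * (⟪u i, v⟫ * ⟪u i, w⟫) := by
  rw [act_spikedCov, inner_add_left, real_inner_smul_left, sum_inner]
  congr 1
  exact Finset.sum_congr rfl fun i _ => by rw [real_inner_smul_left]; ring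

lemma spikedCov_isHermitian {r : ℕ} (σ : ℝ) (θ : Fin r → ℝ) (u : Fin r → Vec p) :
    (spikedCov σ θ u).IsHermitian := by
  ext i j
  simp [spikedCov, Matrix.sum_apply, outer, mul_comm, Matrix.one_apply, eq_comm]

lemma le_quadratic_spikedCov {r : ℕ} (σ : ℝ) {θ : Fin r → ℝ} (hθ : ∀ i, 0 ≤ θ i)
    (u : Fin r → Vec p) (v : Vec p) : σ ^ 2 * ‖v‖ ^ 2 ≤ ⟪act (spikedCov σ θ u) v, v⟫ := by
  rw [inner_act_spikedCov, real_inner_self_eq_norm_sq]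
  have : 0 ≤ ∑ i, θ i * (⟪u i, v⟫ * ⟪u i, v⟫) :=
    Finset.sum_nonneg fun i _ => mul_nonneg (hθ i) (mul_self_nonneg _)
  linarith

lemma spikedCov_posSemidef {r : ℕ} (σ : ℝ) {θ : Fin r → ℝ} (hθ : ∀ i, 0 ≤ θ i)
    (u : Fin r → Vec p) : (spikedCov σ θ u).PosSemidef := by
  refine Matrix.PosSemidef.of_dotProduct_mulVec_nonneg (spikedCov_isHermitian σ θ u) fun x => ?_
  have h := le_quadratic_spikedCov σ hθ u (WithLp.toLp 2 x)
  rw [inner_act_eq_sum] at h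
  have e : star x ⬝ᵥ (spikedCov σ θ u *ᵥ x)
      = ∑ i, ∑ j, spikedCov σ θ u i j * (x j * x i) := by
    simp only [dotProduct, Matrix.mulVec, Finset.mul_sum]
    refine Finset.sum_congr rfl fun i _ => Finset.sum_congr rfl fun j _ => ?_
    simp; ring
  rw [e]
  exact le_trans (by positivity) h

lemma norm_act_spikedCov_le {r : ℕ} (σ : ℝ) {θ : Fin r → ℝ} (hθ : ∀ i, 0 ≤ θ i)
    {u : Fin r → Vec p} (hu : Orthonormal ℝ u) (v : Vec p) :
    ‖act (spikedCov σ θ u) v‖ ≤ (σ ^ 2 + ∑ i, θ i) * ‖v‖ := by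
  rw [act_spikedCov, add_mul, Finset.sum_mul]
  refine (norm_add_le _ _).trans (add_le_add ?_ ((norm_sum_le _ _).trans
    (Finset.sum_le_sum fun i _ => ?_)))
  · rw [norm_smul, Real.norm_of_nonneg (sq_nonneg σ)]
  · rw [norm_smul, hu.1 i, mul_one, norm_mul, Real.norm_of_nonneg (hθ i)]
    refine mul_le_mul_of_nonneg_left ?_ (hθ i)
    simpa [hu.1 i] using norm_inner_le_norm (𝕜 := ℝ) (u i) v

/-! ### Eigenvalue thresholding -/

lemma act_eigenvectorBasis {A : Matrix (Fin p) (Fin p) ℝ} (hA : A.IsHermitian) (i : Fin p) :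
    act A (hA.eigenvectorBasis i) = hA.eigenvalues i • hA.eigenvectorBasis i := by
  have h := hA.mulVec_eigenvectorBasis i
  ext j
  have := congrFun h j
  rw [act_apply]
  simpa [Matrix.mulVec, dotProduct] using this

lemma act_eq_sum_eigenvectorBasis {A : Matrix (Fin p) (Fin p) ℝ} (hA : A.IsHermitian) (w : Vec p) :
    act A w = ∑ i, (hA.eigenvalues i * ⟪hA.eigenvectorBasis i, w⟫) • hA.eigenvectorBasis i := by
  conv_lhs => rw [← hA.eigenvectorBasis.sum_repr' w]
  have : act A (∑ i, ⟪hA.eigenvectorBasis i, w⟫ • hA.eigenvectorBasis i)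
      = ∑ i, ⟪hA.eigenvectorBasis i, w⟫ • act A (hA.eigenvectorBasis i) := by
    simp [act, map_sum]
  rw [this]
  refine Finset.sum_congr rfl fun i _ => ?_
  rw [act_eigenvectorBasis, smul_smul, mul_comm]

lemma act_eigThreshold {A : Matrix (Fin p) (Fin p) ℝ} (hA : A.IsHermitian) (r : ℕ) (hr : r < p)
    (w : Vec p) :
    act (eigThreshold hA r hr) w = ∑ i, (max (hA.eigenvalues i) (eigSucc hA r hr) *
      ⟪hA.eigenvectorBasis i, w⟫) • hA.eigenvectorBasis i := by
  simp only [eigThreshold, act_sum_left, act_smul_left, act_outer, smul_smul]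

lemma eigThreshold_isHermitian {A : Matrix (Fin p) (Fin p) ℝ} (hA : A.IsHermitian) (r : ℕ)
    (hr : r < p) : (eigThreshold hA r hr).IsHermitian := by
  ext i j
  simp [eigThreshold, Matrix.sum_apply, outer, mul_comm]

lemma norm_sum_smul_orthonormalBasis_le (e : OrthonormalBasis (Fin p) ℝ (Vec p)) {c : Fin p → ℝ}
    {C : ℝ} (hC : 0 ≤ C) (hc : ∀ i, |c i| ≤ C) (w : Vec p) :
    ‖∑ i, (c i * ⟪e i, w⟫) • e i‖ ≤ C * ‖w‖ := by
  have h1 : ‖∑ i, (c i * ⟪e i, w⟫) • e i‖ ^ 2 = ∑ i, (c i * ⟪e i, w⟫) ^ 2 := by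
    rw [← real_inner_self_eq_norm_sq, e.orthonormal.inner_sum]
    exact Finset.sum_congr rfl fun i _ => by simp [sq]
  have h2 : ‖w‖ ^ 2 = ∑ i, ⟪e i, w⟫ ^ 2 := by
    rw [← e.sum_sq_norm_inner_right w]; simp
  refine abs_le_of_sq_le_sq' (?_ : _ ≤ _) (by positivity) |>.2
  rw [h1, mul_pow, h2, Finset.mul_sum]
  refine Finset.sum_le_sum fun i _ => ?_
  rw [mul_pow]
  exact mul_le_mul_of_nonneg_right (sq_le_sq' (by linarith [(abs_le.1 (hc i)).1]) (abs_le.1 (hc i)).2)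
    (sq_nonneg _)

/-- One half of the min-max principle: if the quadratic form of `A` is at most `c ‖w‖²` on the
orthogonal complement of `r` vectors, then the `(r+1)`-th largest eigenvalue is at most `c`. -/
lemma eigSucc_le_of_quadratic_le {A : Matrix (Fin p) (Fin p) ℝ} (hA : A.IsHermitian) (r : ℕ)
    (hr : r < p) (u : Fin r → Vec p) {c : ℝ}
    (h : ∀ w : Vec p, (∀ j, ⟪u j, w⟫ = 0) → ⟪act A w, w⟫ ≤ c * ‖w‖ ^ 2) :
    eigSucc hA r hr ≤ c := by
  classical
  set e := hA.eigenvectorBasis with he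
  let eq : Fin (Fintype.card (Fin p)) ≃ Fin p := Fintype.equivOfCardEq (Fintype.card_fin _)
  have hle : r + 1 ≤ Fintype.card (Fin p) := by simpa using hr
  let top : Fin (r + 1) → Fin p := fun k => eq (Fin.castLE hle k)
  have htop : Function.Injective top := eq.injective.comp (Fin.castLE_injective hle)
  have hval : ∀ k, eigSucc hA r hr ≤ hA.eigenvalues (top k) := by
    intro k
    simp only [eigSucc, Matrix.IsHermitian.eigenvalues]
    apply hA.eigenvalues₀_antitone
    have : (Fintype.equivOfCardEq (Fintype.card_fin _)).symm (top k) = Fin.castLE hle k :=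
      eq.symm_apply_apply _
    rw [this]
    exact Nat.lt_succ_iff.1 k.2
  -- `r` linear conditions on `r + 1` coefficients have a nonzero solution
  let f : (Fin (r + 1) → ℝ) →ₗ[ℝ] (Fin r → ℝ) :=
    LinearMap.pi fun j => ∑ k, (⟪u j, e (top k)⟫ : ℝ) • LinearMap.proj k
  have hker : LinearMap.ker f ≠ ⊥ := LinearMap.ker_ne_bot_of_finrank_lt (by simp)
  obtain ⟨a, ha, ha0⟩ := (Submodule.ne_bot_iff _).1 hker
  have hfa : ∀ j, ∑ k, ⟪u j, e (top k)⟫ * a k = 0 := by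
    intro j
    have := congrFun (LinearMap.mem_ker.1 ha) j
    simpa [f] using this
  set w : Vec p := ∑ k, a k • e (top k) with hw
  have horth : Orthonormal ℝ (fun k => e (top k)) := e.orthonormal.comp top htop
  have hnorm : ‖w‖ ^ 2 = ∑ k, a k ^ 2 := by
    rw [← real_inner_self_eq_norm_sq, hw, horth.inner_sum]
    exact Finset.sum_congr rfl fun i _ => by simp [sq]
  have hpos : 0 < ‖w‖ ^ 2 := by
    rw [hnorm]
    obtain ⟨k, hk⟩ := Function.ne_iff.1 ha0
    exact Finset.sum_pos' (fun i _ => sq_nonneg _) ⟨k, Finset.mem_univ _, by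
      have : a k ≠ 0 := hk
      positivity⟩
  have hquad : ⟪act A w, w⟫ = ∑ k, hA.eigenvalues (top k) * a k ^ 2 := by
    have : act A w = ∑ k, (a k * hA.eigenvalues (top k)) • e (top k) := by
      have h1 : act A w = ∑ k, a k • act A (e (top k)) := by
        rw [hw]; simp [act, map_sum]
      rw [h1]
      refine Finset.sum_congr rfl fun k _ => ?_
      rw [he, act_eigenvectorBasis, smul_smul]
    rw [this, hw, horth.inner_sum]
    exact Finset.sum_congr rfl fun i _ => by simp; ring
  have hup := h w fun j => by
    rw [hw, inner_sum, ← hfa j]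
    exact Finset.sum_congr rfl fun k _ => by rw [inner_smul_right]; ring
  have hlow : eigSucc hA r hr * ‖w‖ ^ 2 ≤ ⟪act A w, w⟫ := by
    rw [hquad, hnorm, Finset.mul_sum]
    exact Finset.sum_le_sum fun k _ => mul_le_mul_of_nonneg_right (hval k) (sq_nonneg _)
  exact le_of_mul_le_mul_right (hlow.trans hup) hpos

/-- Thresholding a perturbation of the spiked covariance changes it by at most twice the size of
the perturbation, because the spiked covariance itself is a fixed point of the thresholding. -/
lemma norm_act_eigThreshold_sub_le {A : Matrix (Fin p) (Fin p) ℝ} (hA : A.IsHermitian) {r : ℕ}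
    (hr : r < p) (σ : ℝ) {θ : Fin r → ℝ} (hθ : ∀ i, 0 ≤ θ i) (u : Fin r → Vec p)
    {η : ℝ} (hη : 0 ≤ η)
    (h : ∀ w : Vec p, |⟪act A w - act (spikedCov σ θ u) w, w⟫| ≤ η * ‖w‖ ^ 2) (w : Vec p) :
    ‖act (eigThreshold hA r hr) w - act A w‖ ≤ 2 * η * ‖w‖ := by
  -- the discarded eigenvalues all lie in `[σ² - η, σ² + η]`
  have hlow : ∀ i, σ ^ 2 - η ≤ hA.eigenvalues i := by
    intro i
    have h1 := (abs_le.1 (h (hA.eigenvectorBasis i))).1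
    have h2 := le_quadratic_spikedCov σ hθ u (hA.eigenvectorBasis i)
    rw [inner_sub_left, act_eigenvectorBasis, real_inner_smul_left, real_inner_self_eq_norm_sq,
      hA.eigenvectorBasis.orthonormal.1 i] at h1
    rw [hA.eigenvectorBasis.orthonormal.1 i] at h2
    linarith
  have hup : eigSucc hA r hr ≤ σ ^ 2 + η := by
    refine eigSucc_le_of_quadratic_le hA r hr u fun w hw => ?_
    have h1 := (abs_le.1 (h w)).2
    rw [inner_sub_left, inner_act_spikedCov] at h1
    simp only [hw, mul_zero, Finset.sum_const_zero, real_inner_self_eq_norm_sq] at h1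
    linarith
  rw [act_eigThreshold, act_eq_sum_eigenvectorBasis hA, ← Finset.sum_sub_distrib]
  simp only [← sub_smul, ← sub_mul]
  refine norm_sum_smul_orthonormalBasis_le _ (by positivity) (fun i => ?_) w
  rw [abs_of_nonneg (sub_nonneg.2 (le_max_left _ _)), sub_le_iff_le_add, max_le_iff]
  constructor <;> linarith [hlow i]

/-- A lower bound for the quadratic form makes the matrix invertible and bounds its inverse. -/
lemma norm_act_inv_le {Z : Matrix (Fin p) (Fin p) ℝ} {c : ℝ} (hc : 0 < c)
    (h : ∀ w : Vec p, c * ‖w‖ ^ 2 ≤ ⟪act Z w, w⟫) :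
    (∀ w, act Z⁻¹ (act Z w) = w) ∧ ∀ w, ‖act Z⁻¹ w‖ ≤ c⁻¹ * ‖w‖ := by
  have hlow : ∀ w : Vec p, c * ‖w‖ ≤ ‖act Z w‖ := by
    intro w
    by_cases hw : ‖w‖ = 0
    · simp [hw]
    · have h1 := (h w).trans (real_inner_le_norm _ _)
      have hp : 0 < ‖w‖ := lt_of_le_of_ne (norm_nonneg _) (Ne.symm hw)
      nlinarith
  have hdet : IsUnit Z.det := by
    rw [isUnit_iff_ne_zero]
    intro h0
    obtain ⟨v, hv, hZ⟩ := Matrix.exists_mulVec_eq_zero_iff.2 h0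
    have h1 : act Z (WithLp.toLp 2 v) = 0 := by
      ext i
      rw [act_apply]
      simpa [Matrix.mulVec, dotProduct] using congrFun hZ i
    have h2 := hlow (WithLp.toLp 2 v)
    rw [h1, norm_zero] at h2
    have h3 : ‖(WithLp.toLp 2 v : Vec p)‖ = 0 :=
      le_antisymm (nonpos_of_mul_nonpos_right h2 hc) (norm_nonneg _)
    apply hv
    have h4 := norm_eq_zero.1 h3
    ext i
    simpa using congrArg (fun z : Vec p => z i) h4
  constructor
  · intro w
    rw [← act_mul, Matrix.nonsing_inv_mul _ hdet, act_one]
  · intro w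
    have := hlow (act Z⁻¹ w)
    rw [← act_mul, Matrix.mul_nonsing_inv _ hdet, act_one] at this
    rw [inv_mul_eq_div, le_div_iff₀ hc]
    linarith

end LinearAlgebra

/-! ### Gaussian integration by parts -/

section Stein

open scoped NNReal

lemma hasDerivAt_gaussianPDFReal {v : ℝ≥0} (hv : v ≠ 0) (x : ℝ) :
    HasDerivAt (gaussianPDFReal 0 v) (-(x / v) * gaussianPDFReal 0 v x) x := by
  have hv' : (v : ℝ) ≠ 0 := by exact_mod_cast hv
  have h0 : HasDerivAt (fun y : ℝ => (y - 0) ^ 2) (2 * x) x := by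
    simpa using ((hasDerivAt_id' x).sub_const 0).fun_pow 2
  have h1 : HasDerivAt (fun y : ℝ => -(y - 0) ^ 2 / (2 * (v : ℝ))) (-(x / v)) x :=
    (h0.fun_neg.div_const (2 * (v : ℝ))).congr_deriv (by field_simp)
  have h2 := (h1.exp).const_mul (√(2 * Real.pi * v))⁻¹
  rw [gaussianPDFReal_def]
  exact h2.congr_deriv (by ring)

lemma integrable_gaussianReal_iff {v : ℝ≥0} (hv : v ≠ 0) {f : ℝ → ℝ} :
    Integrable f (gaussianReal 0 v) ↔ Integrable (fun x => f x * gaussianPDFReal 0 v x) := by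
  rw [gaussianReal_of_var_ne_zero _ hv,
    integrable_withDensity_iff_integrable_smul' (measurable_gaussianPDF _ _)
      (ae_of_all _ fun _ => gaussianPDF_lt_top)]
  simp only [toReal_gaussianPDF, smul_eq_mul, mul_comm]

/-- Stein's identity `E[x f(x)] = v E[f'(x)]` for the centred Gaussian law of variance `v`. -/
lemma integral_id_mul_gaussianReal {v : ℝ≥0} (hv : v ≠ 0) {f f' : ℝ → ℝ}
    (hf : ∀ x, HasDerivAt f (f' x) x) (h0 : Integrable f (gaussianReal 0 v))
    (h1 : Integrable (fun x => x * f x) (gaussianReal 0 v))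
    (h2 : Integrable f' (gaussianReal 0 v)) :
    ∫ x, x * f x ∂(gaussianReal 0 v) = v * ∫ x, f' x ∂(gaussianReal 0 v) := by
  have hv' : (v : ℝ) ≠ 0 := by exact_mod_cast hv
  rw [integrable_gaussianReal_iff hv] at h0 h1 h2
  have key := integral_mul_deriv_eq_deriv_mul_of_integrable (u := f) (u' := f')
    (v := gaussianPDFReal 0 v) (v' := fun x => -(x / v) * gaussianPDFReal 0 v x)
    (fun x _ => hf x) (fun x _ => hasDerivAt_gaussianPDFReal hv x)
    (by
      refine (h1.const_mul (-(v : ℝ)⁻¹)).congr (ae_of_all _ fun x => ?_)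
      simp only [Pi.mul_apply]; field_simp) h2 h0
  rw [integral_gaussianReal_eq_integral_smul hv, integral_gaussianReal_eq_integral_smul hv]
  simp only [smul_eq_mul]
  have e1 : ∫ x, gaussianPDFReal 0 v x * (x * f x)
      = (-(v : ℝ)) * ∫ x, f x * (-(x / v) * gaussianPDFReal 0 v x) := by
    rw [← integral_const_mul]
    refine integral_congr_ae (ae_of_all _ fun x => ?_)
    simp only
    field_simp
  rw [e1, key]
  simp only [mul_comm (gaussianPDFReal 0 v _)]
  ring

lemma integrable_mul_of_bounded {α : Type*} [MeasurableSpace α] {μ : Measure α} {g h : α → ℝ}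
    (hg : Integrable g μ) (hh : AEStronglyMeasurable h μ) {B : ℝ} (hB : ∀ x, |h x| ≤ B) :
    Integrable (fun x => g x * h x) μ :=
  hg.mul_bdd (c := B) hh (ae_of_all _ fun x => by simpa using hB x)

/-- Applying Stein's identity twice. -/
lemma integral_sq_mul_gaussianReal {v : ℝ≥0} (hv : v ≠ 0) {f f' f'' : ℝ → ℝ}
    (hf : ∀ x, HasDerivAt f (f' x) x) (hf' : ∀ x, HasDerivAt f' (f'' x) x)
    (hm : Measurable f'') {B₀ B₁ B₂ : ℝ}
    (hB₀ : ∀ x, |f x| ≤ B₀) (hB₁ : ∀ x, |f' x| ≤ B₁) (hB₂ : ∀ x, |f'' x| ≤ B₂) :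
    ∫ x, x ^ 2 * f x ∂(gaussianReal 0 v)
      = v * ∫ x, f x ∂(gaussianReal 0 v) + v ^ 2 * ∫ x, f'' x ∂(gaussianReal 0 v) := by
  have c0 : Continuous f := continuous_iff_continuousAt.2 fun x => (hf x).continuousAt
  have c1 : Continuous f' := continuous_iff_continuousAt.2 fun x => (hf' x).continuousAt
  have i1 : Integrable (fun x : ℝ => x) (gaussianReal 0 v) :=
    (memLp_id_gaussianReal (μ := 0) (v := v) 1).integrable (by simp)
  have i2 : Integrable (fun x : ℝ => x ^ 2) (gaussianReal 0 v) :=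
    (memLp_id_gaussianReal (μ := 0) (v := v) 2).integrable_sq
  have j0 : Integrable f (gaussianReal 0 v) :=
    Integrable.of_bound c0.aestronglyMeasurable B₀ (ae_of_all _ fun x => by simpa using hB₀ x)
  have j1 : Integrable f' (gaussianReal 0 v) :=
    Integrable.of_bound c1.aestronglyMeasurable B₁ (ae_of_all _ fun x => by simpa using hB₁ x)
  have j2 : Integrable f'' (gaussianReal 0 v) :=
    Integrable.of_bound hm.aestronglyMeasurable B₂ (ae_of_all _ fun x => by simpa using hB₂ x)
  have k0 := integrable_mul_of_bounded i1 c0.aestronglyMeasurable hB₀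
  have k1 := integrable_mul_of_bounded i1 c1.aestronglyMeasurable hB₁
  have k2 := integrable_mul_of_bounded i2 c0.aestronglyMeasurable hB₀
  have s1 := integral_id_mul_gaussianReal hv hf' j1 k1 j2
  have s2 := integral_id_mul_gaussianReal hv (f := fun x => x * f x)
    (f' := fun x => f x + x * f' x)
    (fun x => by simpa using (hasDerivAt_id' x).fun_mul (hf x)) k0
    (k2.congr (ae_of_all _ fun x => by simp only; ring)) (j0.add k1)
  have e : ∀ x : ℝ, x ^ 2 * f x = x * (x * f x) := fun x => by ring
  simp only [e]
  rw [s2, integral_add j0 k1, s1]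
  ring

variable {p : ℕ}

lemma dotProduct_mulVec_eq_inner_act (S : Matrix (Fin p) (Fin p) ℝ) (v w : Vec p) :
    v.ofLp ⬝ᵥ S *ᵥ w.ofLp = ⟪v, act S w⟫ := by
  rw [real_inner_comm, inner_act_eq_sum]
  simp only [dotProduct, Matrix.mulVec, Finset.mul_sum]
  exact Finset.sum_congr rfl fun i _ => Finset.sum_congr rfl fun j _ => by ring

lemma covariance_inner_multivariateGaussian {S : Matrix (Fin p) (Fin p) ℝ} (hS : S.PosSemidef)
    (v w : Vec p) :
    cov[fun z => ⟪v, z⟫, fun z => ⟪w, z⟫; multivariateGaussian 0 S] = ⟪v, act S w⟫ := by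
  rw [← covarianceBilin_apply_eq_cov IsGaussian.memLp_two_id,
    covarianceBilin_multivariateGaussian hS, dotProduct_mulVec_eq_inner_act]

lemma integral_inner_multivariateGaussian (S : Matrix (Fin p) (Fin p) ℝ) (v : Vec p) :
    ∫ z, ⟪v, z⟫ ∂(multivariateGaussian 0 S) = 0 := by
  have h := ContinuousLinearMap.integral_comp_comm (μ := multivariateGaussian 0 S)
    (φ := fun z : Vec p => z) (innerSL ℝ v) IsGaussian.integrable_fun_id
  simpa using h

lemma memLp_inner_multivariateGaussian (S : Matrix (Fin p) (Fin p) ℝ) (v : Vec p) :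
    MemLp (fun z => ⟪v, z⟫) 2 (multivariateGaussian 0 S) :=
  IsGaussian.memLp_dual (multivariateGaussian 0 S) (innerSL ℝ v) 2 (by simp)

lemma integral_inner_mul_inner_multivariateGaussian {S : Matrix (Fin p) (Fin p) ℝ}
    (hS : S.PosSemidef) (v w : Vec p) :
    ∫ z, ⟪v, z⟫ * ⟪w, z⟫ ∂(multivariateGaussian 0 S) = ⟪v, act S w⟫ := by
  have h := covariance_eq_sub (memLp_inner_multivariateGaussian S v)
    (memLp_inner_multivariateGaussian S w)
  rw [covariance_inner_multivariateGaussian hS, integral_inner_multivariateGaussian] at h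
  simpa using h.symm

lemma map_inner_multivariateGaussian {S : Matrix (Fin p) (Fin p) ℝ} (hS : S.PosSemidef)
    (b : Vec p) : (multivariateGaussian 0 S).map (fun z => ⟪b, z⟫)
      = gaussianReal 0 ⟪b, act S b⟫.toNNReal := by
  have h := IsGaussian.map_eq_gaussianReal (μ := multivariateGaussian 0 S) (innerSL ℝ b)
  have h1 : (⇑(innerSL ℝ b) : Vec p → ℝ) = fun z => ⟪b, z⟫ := by ext; simp
  rw [h1, integral_inner_multivariateGaussian, ← covariance_self (by fun_prop),
    covariance_inner_multivariateGaussian hS] at h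
  exact h

/-- Gaussian integration by parts for `z ∼ N(0, S)`:
`E[⟨v, z⟩² f(⟨z, b⟩)] = ⟨S v, v⟩ E[f(⟨z, b⟩)] + ⟨S v, b⟩² E[f''(⟨z, b⟩)]`. The variable `⟨v, z⟩`
is split into its regression on `⟨b, z⟩` and an independent remainder. -/
lemma integral_sq_inner_mul_multivariateGaussian {S : Matrix (Fin p) (Fin p) ℝ}
    (hS : S.PosSemidef) {f f' f'' : ℝ → ℝ}
    (hf : ∀ x, HasDerivAt f (f' x) x) (hf' : ∀ x, HasDerivAt f' (f'' x) x)
    (hm : Measurable f'') {B₀ B₁ B₂ : ℝ}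
    (hB₀ : ∀ x, |f x| ≤ B₀) (hB₁ : ∀ x, |f' x| ≤ B₁) (hB₂ : ∀ x, |f'' x| ≤ B₂)
    (v b : Vec p) (hb : b = 0 ∨ 0 < ⟪b, act S b⟫) :
    ∫ z, ⟪v, z⟫ ^ 2 * f ⟪z, b⟫ ∂(multivariateGaussian 0 S)
      = ⟪v, act S v⟫ * ∫ z, f ⟪z, b⟫ ∂(multivariateGaussian 0 S)
        + ⟪v, act S b⟫ ^ 2 * ∫ z, f'' ⟪z, b⟫ ∂(multivariateGaussian 0 S) := by
  have hsq : ∫ z, ⟪v, z⟫ ^ 2 ∂(multivariateGaussian 0 S) = ⟪v, act S v⟫ := by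
    rw [← integral_inner_mul_inner_multivariateGaussian hS]
    simp only [sq]
  rcases hb with rfl | hb
  · have h0 : act S (0 : Vec p) = 0 := by simp [act]
    simp only [inner_zero_right, h0, integral_const, probReal_univ, one_smul]
    rw [integral_mul_const, hsq]; simp
  set γ := multivariateGaussian 0 S with hγ
  set s2 : ℝ := ⟪b, act S b⟫ with hs2
  -- the regression coefficient of `⟨v, z⟩` on `⟨b, z⟩`
  set α : ℝ := ⟪v, act S b⟫ / s2 with hα
  have c0 : Continuous f := continuous_iff_continuousAt.2 fun x => (hf x).continuousAt
  set w : Vec p := v - α • b with hw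
  have hcov : ⟪w, act S b⟫ = 0 := by
    rw [hw, inner_sub_left, real_inner_smul_left, hα, div_mul_cancel₀ _ hb.ne', sub_self]
  have hind : IndepFun (fun z : Vec p => ⟪w, z⟫) (fun z => ⟪b, z⟫) γ := by
    have hl : HasGaussianLaw (fun z : Vec p => (⟪w, z⟫, ⟪b, z⟫)) γ := by
      have := (IsGaussian.hasGaussianLaw_id (μ := γ)).map_fun
        ((innerSL ℝ w).prod (innerSL ℝ b))
      simpa using this
    refine hl.indepFun_of_covariance_eq_zero ?_
    rw [covariance_inner_multivariateGaussian hS, hcov]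
  have hvv : ∀ z : Vec p, ⟪v, z⟫ = α * ⟪b, z⟫ + ⟪w, z⟫ := fun z => by
    rw [hw, inner_sub_left, real_inner_smul_left]; ring
  have hww : ⟪w, act S w⟫ = ⟪v, act S v⟫ - α ^ 2 * s2 := by
    have h1 : ⟪w, act S w⟫ = ⟪w, act S v⟫ := by
      have : act S w = act S v - α • act S b := by rw [hw, act_sub_right, act_smul_right]
      rw [this, inner_sub_right, inner_smul_right, hcov, mul_zero, sub_zero]
    have h2 : ⟪b, act S v⟫ = ⟪v, act S b⟫ := by
      rw [← inner_act_comm hS.1, real_inner_comm]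
    rw [h1, hw, inner_sub_left, real_inner_smul_left, h2, hα]
    field_simp
  have iw1 : Integrable (fun z : Vec p => ⟪w, z⟫) γ :=
    (memLp_inner_multivariateGaussian S w).integrable (by simp)
  have iw2 : Integrable (fun z : Vec p => ⟪w, z⟫ ^ 2) γ :=
    (memLp_inner_multivariateGaussian S w).integrable_sq
  have ib1 : Integrable (fun z : Vec p => ⟪b, z⟫) γ :=
    (memLp_inner_multivariateGaussian S b).integrable (by simp)
  have ib2 : Integrable (fun z : Vec p => ⟪b, z⟫ ^ 2) γ :=
    (memLp_inner_multivariateGaussian S b).integrable_sq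
  have mf : AEStronglyMeasurable (fun z : Vec p => f ⟪b, z⟫) γ :=
    (c0.comp (by fun_prop)).aestronglyMeasurable
  have e1 : ∫ z, ⟪w, z⟫ ^ 2 * f ⟪b, z⟫ ∂γ = ⟪w, act S w⟫ * ∫ z, f ⟪b, z⟫ ∂γ := by
    have := (hind.comp (φ := fun t => t ^ 2) (ψ := f) (by fun_prop)
      c0.measurable).integral_fun_mul_eq_mul_integral (by fun_prop)
      (c0.comp (by fun_prop)).aestronglyMeasurable
    simp only [Function.comp_apply] at this
    rw [this]
    congr 1
    rw [← integral_inner_mul_inner_multivariateGaussian hS]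
    simp only [sq, hγ]
  have e2 : ∫ z, ⟪w, z⟫ * (⟪b, z⟫ * f ⟪b, z⟫) ∂γ = 0 := by
    have := (hind.comp (φ := fun t => t) (ψ := fun t => t * f t) (by fun_prop)
      (by fun_prop)).integral_fun_mul_eq_mul_integral (by fun_prop) 
      (Continuous.aestronglyMeasurable (by fun_prop))
    simp only [Function.comp_apply] at this
    rw [this, hγ, integral_inner_multivariateGaussian, zero_mul]
  have hmap := map_inner_multivariateGaussian hS b
  have hvar : ⟪b, act S b⟫.toNNReal ≠ 0 := by
    rw [Ne, Real.toNNReal_eq_zero]; exact not_le.2 hb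
  have push : ∀ g : ℝ → ℝ, Measurable g →
      ∫ z, g ⟪b, z⟫ ∂γ = ∫ x, g x ∂(gaussianReal 0 ⟪b, act S b⟫.toNNReal) := fun g hg => by
    rw [← hmap, integral_map (by fun_prop) hg.aestronglyMeasurable]
  have e3 : ∫ z, ⟪b, z⟫ ^ 2 * f ⟪b, z⟫ ∂γ
      = s2 * ∫ z, f ⟪b, z⟫ ∂γ + s2 ^ 2 * ∫ z, f'' ⟪b, z⟫ ∂γ := by
    rw [push (fun x => x ^ 2 * f x) (by fun_prop), push f c0.measurable, push f'' hm,
      integral_sq_mul_gaussianReal hvar hf hf' hm hB₀ hB₁ hB₂, Real.coe_toNNReal _ hb.le]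
  have key : ∀ z : Vec p, ⟪v, z⟫ ^ 2 * f ⟪z, b⟫ = ⟪w, z⟫ ^ 2 * f ⟪b, z⟫
      + 2 * α * (⟪w, z⟫ * (⟪b, z⟫ * f ⟪b, z⟫)) + α ^ 2 * (⟪b, z⟫ ^ 2 * f ⟪b, z⟫) := fun z => by
    rw [hvv z, real_inner_comm b z]; ring
  have i1 := integrable_mul_of_bounded iw2 mf fun z => hB₀ _
  have i3 := integrable_mul_of_bounded ib2 mf fun z => hB₀ _
  have i2 : Integrable (fun z : Vec p => ⟪w, z⟫ * (⟪b, z⟫ * f ⟪b, z⟫)) γ := by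
    have := integrable_mul_of_bounded ((memLp_inner_multivariateGaussian S w).integrable_mul
      (memLp_inner_multivariateGaussian S b)) mf fun z => hB₀ _
    refine this.congr (ae_of_all _ fun z => ?_)
    simp only [Pi.mul_apply]; ring
  simp only [key]
  have i12 : Integrable (fun z : Vec p => ⟪w, z⟫ ^ 2 * f ⟪b, z⟫
      + 2 * α * (⟪w, z⟫ * (⟪b, z⟫ * f ⟪b, z⟫))) γ := i1.add (i2.const_mul _)
  rw [integral_add i12 (i3.const_mul _), integral_add i1 (i2.const_mul _),
    integral_const_mul, integral_const_mul, e1, e2, e3, hww]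
  simp only [real_inner_comm b, hα]
  field_simp
  ring

end Stein

/-! ### Sub-gaussian vectors and exponential moments -/

section Moments

variable {p : ℕ}

/-- The squared one-dimensional marginals of `ν` along vectors of the unit ball have exponential
moments: `E exp(c ⟨x, v⟩²) ≤ 2`. -/
structure HasExpSquareMoment (ν : Measure (Vec p)) (c : ℝ) : Prop where
  integrable : ∀ v : Vec p, ‖v‖ ≤ 1 → Integrable (fun x => Real.exp (c * ⟪x, v⟫ ^ 2)) ν
  integral_le : ∀ v : Vec p, ‖v‖ ≤ 1 → ∫ x, Real.exp (c * ⟪x, v⟫ ^ 2) ∂ν ≤ 2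

/-- Sub-gaussian growth of the moments gives an exponential moment of the square: by `kᵏ ≤ k! eᵏ`
the `k`-th term of the exponential series has expectation at most `(2k K² c)ᵏ / k! ≤ 2⁻ᵏ`. -/
lemma lintegral_exp_sq_le {α : Type*} [MeasurableSpace α] {μ : Measure α} [IsProbabilityMeasure μ]
    {X : α → ℝ} (hX : Measurable X) {K : ℝ} (hK : 0 < K)
    (h : ∀ m : ℝ, 1 ≤ m →
      eLpNorm X (ENNReal.ofReal m) μ ≤ ENNReal.ofReal K * ENNReal.ofReal (Real.sqrt m)) :
    ∫⁻ a, ENNReal.ofReal (Real.exp (1 / (12 * K ^ 2) * X a ^ 2)) ∂μ ≤ 2 := by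
  set c : ℝ := 1 / (12 * K ^ 2) with hc
  have hc0 : 0 < c := by positivity
  have hexp : ∀ a, ENNReal.ofReal (Real.exp (c * X a ^ 2))
      = ∑' k : ℕ, ENNReal.ofReal ((c * X a ^ 2) ^ k / (k.factorial : ℝ)) := by
    intro a
    have hs := NormedSpace.expSeries_div_hasSum_exp (c * X a ^ 2)
    rw [← Real.exp_eq_exp_ℝ] at hs
    rw [← hs.tsum_eq, ENNReal.ofReal_tsum_of_nonneg (fun k => by positivity) hs.summable]
  have hterm : ∀ k : ℕ, ∫⁻ a, ENNReal.ofReal ((c * X a ^ 2) ^ k / (k.factorial : ℝ)) ∂μ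
      ≤ (2⁻¹ : ℝ≥0∞) ^ k := by
    intro k
    rcases Nat.eq_zero_or_pos k with rfl | hk
    · simp
    have hk1 : (1 : ℝ) ≤ k := by exact_mod_cast hk
    have h2 := h (2 * k) (by linarith)
    have hne : ENNReal.ofReal (2 * (k : ℝ)) ≠ 0 := by
      rw [Ne, ENNReal.ofReal_eq_zero]; linarith
    rw [eLpNorm_eq_lintegral_rpow_enorm_toReal hne ENNReal.ofReal_ne_top,
      ENNReal.toReal_ofReal (by positivity), ← ENNReal.ofReal_mul hK.le] at h2
    have h3 : ∫⁻ a, ‖X a‖ₑ ^ (2 * (k : ℝ)) ∂μ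
        ≤ ENNReal.ofReal (K * Real.sqrt (2 * k)) ^ (2 * (k : ℝ)) := by
      have := ENNReal.rpow_le_rpow h2 (z := 2 * (k : ℝ)) (by positivity)
      rwa [← ENNReal.rpow_mul, one_div, inv_mul_cancel₀ (by positivity), ENNReal.rpow_one] at this
    have h4 : ∀ a, ENNReal.ofReal ((c * X a ^ 2) ^ k / (k.factorial : ℝ))
        = ENNReal.ofReal (c ^ k / (k.factorial : ℝ)) * ‖X a‖ₑ ^ (2 * (k : ℝ)) := by
      intro a
      rw [← ofReal_norm, ENNReal.ofReal_rpow_of_nonneg (norm_nonneg _) (by positivity),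
        ← ENNReal.ofReal_mul (by positivity)]
      congr 1
      have : ‖X a‖ ^ (2 * (k : ℝ)) = (X a ^ 2) ^ k := by
        rw [show (2 * (k : ℝ)) = ((2 * k : ℕ) : ℝ) by push_cast; ring, Real.rpow_natCast, pow_mul,
          Real.norm_eq_abs, sq_abs]
      rw [this, mul_pow]; ring
    simp only [h4]
    rw [lintegral_const_mul _ (by fun_prop)]
    refine (mul_le_mul_right h3 _).trans ?_
    rw [ENNReal.ofReal_rpow_of_nonneg (by positivity) (by positivity),
      ← ENNReal.ofReal_mul (by positivity)]
    have h5 : (2⁻¹ : ℝ≥0∞) ^ k = ENNReal.ofReal ((1 / 2 : ℝ) ^ k) := by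
      rw [ENNReal.ofReal_pow (by norm_num), one_div, ENNReal.ofReal_inv_of_pos (by norm_num)]
      simp
    rw [h5]
    apply ENNReal.ofReal_le_ofReal
    have h6 : (K * Real.sqrt (2 * k)) ^ (2 * (k : ℝ)) = (K ^ 2 * (2 * k)) ^ k := by
      rw [show (2 * (k : ℝ)) = ((2 * k : ℕ) : ℝ) by push_cast; ring, Real.rpow_natCast, pow_mul,
        mul_pow, Real.sq_sqrt (by positivity)]
    have h7 : c ^ k / (k.factorial : ℝ) * (K ^ 2 * (2 * k)) ^ k
        = (1 / 6) ^ k * ((k : ℝ) ^ k / (k.factorial : ℝ)) := by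
      rw [div_mul_eq_mul_div, ← mul_pow, mul_div_assoc', ← mul_pow]
      congr 2
      rw [hc]; field_simp; norm_num
    rw [h6, h7]
    have h8 := Real.pow_div_factorial_le_exp (k : ℝ) (by positivity) k
    have h9 : Real.exp (k : ℝ) ≤ 3 ^ k := by
      rw [← Real.exp_one_pow]
      exact pow_le_pow_left₀ (Real.exp_pos 1).le (by linarith [Real.exp_one_lt_d9]) k
    calc (1 / 6 : ℝ) ^ k * ((k : ℝ) ^ k / (k.factorial : ℝ)) ≤ (1 / 6) ^ k * 3 ^ k :=
          mul_le_mul_of_nonneg_left (h8.trans h9) (by positivity)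
      _ = (1 / 2) ^ k := by rw [← mul_pow]; norm_num
  simp only [hexp]
  rw [lintegral_tsum fun k => by fun_prop]
  refine (ENNReal.tsum_le_tsum hterm).trans ?_
  rw [ENNReal.tsum_geometric]
  norm_num

/-- The bound `|K| + 1` in place of `K` is positive and strictly above the infimum that defines the
sub-gaussian norm. -/
lemma hasExpSquareMoment_of_psi2NormVec_le {ν : Measure (Vec p)} [IsProbabilityMeasure ν] {K : ℝ}
    (h : psi2NormVec ν ≤ ENNReal.ofReal K) :
    HasExpSquareMoment ν (1 / (12 * (|K| + 1) ^ 2)) := by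
  set K1 := |K| + 1 with hK1
  have hK1pos : 0 < K1 := by positivity
  have key : ∀ v : Vec p, ‖v‖ ≤ 1 →
      ∫⁻ x, ENNReal.ofReal (Real.exp (1 / (12 * K1 ^ 2) * ⟪x, v⟫ ^ 2)) ∂ν ≤ 2 := by
    intro v hv
    by_cases hv0 : v = 0
    · simp [hv0]
    have hn : ‖v‖ ≠ 0 := norm_ne_zero_iff.2 hv0
    have hunit : ‖‖v‖⁻¹ • v‖ = 1 := by rw [norm_smul, norm_inv, norm_norm, inv_mul_cancel₀ hn]
    have h1 : psi2Norm (fun x : Vec p => ⟪x, ‖v‖⁻¹ • v⟫) ν < ENNReal.ofReal K1 := by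
      refine lt_of_le_of_lt ((le_iSup (fun w : {w : Vec p // ‖w‖ = 1} =>
        psi2Norm (fun x : Vec p => ⟪x, w.1⟫) ν) ⟨_, hunit⟩).trans h) ?_
      exact (ENNReal.ofReal_lt_ofReal_iff hK1pos).2 (by linarith [le_abs_self K])
    obtain ⟨K', hK', hlt⟩ := sInf_lt_iff.1 h1
    have h2 := lintegral_exp_sq_le (μ := ν) (X := fun x : Vec p => ⟪x, ‖v‖⁻¹ • v⟫)
      (by fun_prop) hK1pos fun m hm => (hK' m hm).trans (mul_le_mul_left hlt.le _)
    refine (lintegral_mono fun x => ?_).trans h2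
    apply ENNReal.ofReal_le_ofReal
    apply Real.exp_le_exp.2
    refine mul_le_mul_of_nonneg_left ?_ (by positivity)
    have h3 : ⟪x, v⟫ = ‖v‖ * ⟪x, ‖v‖⁻¹ • v⟫ := by
      rw [inner_smul_right, ← mul_assoc, mul_inv_cancel₀ hn, one_mul]
    rw [h3, mul_pow]
    exact mul_le_of_le_one_left (sq_nonneg _) (pow_le_one₀ (norm_nonneg _) hv)
  have hint : ∀ v : Vec p, ‖v‖ ≤ 1 →
      Integrable (fun x => Real.exp (1 / (12 * K1 ^ 2) * ⟪x, v⟫ ^ 2)) ν := fun v hv =>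
    ⟨Continuous.aestronglyMeasurable (by fun_prop),
      (hasFiniteIntegral_iff_ofReal (ae_of_all _ fun x => (Real.exp_pos _).le)).2
        (lt_of_le_of_lt (key v hv) (by simp))⟩
  refine ⟨hint, fun v hv => ?_⟩
  have h1 := ofReal_integral_eq_lintegral_ofReal (hint v hv)
    (ae_of_all _ fun x => (Real.exp_pos _).le)
  have h2 := (h1.le.trans (key v hv))
  exact (ENNReal.ofReal_le_ofReal_iff (by norm_num)).1 (h2.trans_eq (by simp))

variable {ν : Measure (Vec p)} {c : ℝ}

lemma HasExpSquareMoment.integrable_of_abs_le (h : HasExpSquareMoment ν c) {v : Vec p}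
    (hv : ‖v‖ ≤ 1) {g : Vec p → ℝ} (hg : Measurable g) {C : ℝ}
    (hC : ∀ x, |g x| ≤ C * Real.exp (c * ⟪x, v⟫ ^ 2)) : Integrable g ν :=
  ((h.integrable v hv).const_mul C).mono' hg.aestronglyMeasurable (ae_of_all _ hC)

lemma HasExpSquareMoment.integral_le_of_abs_le (h : HasExpSquareMoment ν c) {v : Vec p}
    (hv : ‖v‖ ≤ 1) {g : Vec p → ℝ} (hg : Measurable g) {C : ℝ} (hC0 : 0 ≤ C)
    (hC : ∀ x, |g x| ≤ C * Real.exp (c * ⟪x, v⟫ ^ 2)) : ∫ x, g x ∂ν ≤ 2 * C :=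
  calc ∫ x, g x ∂ν ≤ ∫ x, C * Real.exp (c * ⟪x, v⟫ ^ 2) ∂ν :=
        integral_mono (h.integrable_of_abs_le hv hg hC) ((h.integrable v hv).const_mul C)
          fun x => (le_abs_self _).trans (hC x)
    _ = C * ∫ x, Real.exp (c * ⟪x, v⟫ ^ 2) ∂ν := integral_const_mul _ _
    _ ≤ C * 2 := mul_le_mul_of_nonneg_left (h.integral_le v hv) hC0
    _ = 2 * C := by ring

lemma sq_le_exp_sq (hc : 0 < c) (t : ℝ) : |t ^ 2| ≤ c⁻¹ * Real.exp (c * t ^ 2) := by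
  rw [abs_of_nonneg (sq_nonneg t), inv_mul_eq_div, le_div_iff₀ hc]
  linarith [Real.add_one_le_exp (c * t ^ 2)]

lemma pow_four_le_exp_sq (hc : 0 < c) (t : ℝ) :
    |t ^ 4| ≤ 2 * (c ^ 2)⁻¹ * Real.exp (c * t ^ 2) := by
  have h := Real.quadratic_le_exp_of_nonneg (x := c * t ^ 2) (by positivity)
  rw [abs_of_nonneg (by positivity), mul_assoc, inv_mul_eq_div, mul_div_assoc', le_div_iff₀ (by positivity)]
  nlinarith [mul_nonneg hc.le (sq_nonneg t)]

lemma HasExpSquareMoment.integrable_sq (h : HasExpSquareMoment ν c) (hc : 0 < c) {v : Vec p}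
    (hv : ‖v‖ ≤ 1) : Integrable (fun x => ⟪x, v⟫ ^ 2) ν :=
  h.integrable_of_abs_le hv (by fun_prop) fun x => sq_le_exp_sq hc _

lemma HasExpSquareMoment.integral_sq_le (h : HasExpSquareMoment ν c) (hc : 0 < c) {v : Vec p}
    (hv : ‖v‖ ≤ 1) : ∫ x, ⟪x, v⟫ ^ 2 ∂ν ≤ 2 * c⁻¹ :=
  h.integral_le_of_abs_le hv (by fun_prop) (by positivity) fun x => sq_le_exp_sq hc _

lemma HasExpSquareMoment.integrable_pow_four (h : HasExpSquareMoment ν c) (hc : 0 < c) {v : Vec p}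
    (hv : ‖v‖ ≤ 1) : Integrable (fun x => ⟪x, v⟫ ^ 4) ν :=
  h.integrable_of_abs_le hv (by fun_prop) fun x => pow_four_le_exp_sq hc _

lemma HasExpSquareMoment.integral_pow_four_le (h : HasExpSquareMoment ν c) (hc : 0 < c) {v : Vec p}
    (hv : ‖v‖ ≤ 1) : ∫ x, ⟪x, v⟫ ^ 4 ∂ν ≤ 2 * (2 * (c ^ 2)⁻¹) :=
  h.integral_le_of_abs_le hv (by fun_prop) (by positivity) fun x => pow_four_le_exp_sq hc _

lemma norm_single_one (i : Fin p) : ‖(EuclideanSpace.single i (1 : ℝ) : Vec p)‖ ≤ 1 := by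
  simp

lemma inner_single_one (x : Vec p) (i : Fin p) : ⟪x, EuclideanSpace.single i (1 : ℝ)⟫ = x i := by
  simp [EuclideanSpace.inner_single_right]

lemma norm_pow_four_le (x : Vec p) : ‖x‖ ^ 4 ≤ p * ∑ i, x i ^ 4 := by
  have h : ‖x‖ ^ 2 = ∑ i, x i ^ 2 := by
    rw [← real_inner_self_eq_norm_sq, inner_eq_sum]; simp only [sq]
  have h2 := sq_sum_le_card_mul_sum_sq (s := (Finset.univ : Finset (Fin p)))
    (f := fun i => x i ^ 2)
  rw [← h] at h2
  simp only [Finset.card_univ, Fintype.card_fin, ← pow_mul] at h2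
  exact_mod_cast h2

lemma HasExpSquareMoment.integrable_norm_pow_four (h : HasExpSquareMoment ν c) (hc : 0 < c) :
    Integrable (fun x : Vec p => ‖x‖ ^ 4) ν := by
  have h1 : Integrable (fun x : Vec p => (p : ℝ) * ∑ i, x i ^ 4) ν := by
    refine (integrable_finsetSum _ fun i _ => ?_).const_mul _
    have := h.integrable_pow_four hc (norm_single_one i)
    simpa only [inner_single_one] using this
  refine h1.mono' (Continuous.aestronglyMeasurable (by fun_prop)) (ae_of_all _ fun x => ?_)
  rw [Real.norm_of_nonneg (by positivity)]
  exact norm_pow_four_le x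

lemma HasExpSquareMoment.integral_norm_pow_four_le (h : HasExpSquareMoment ν c) (hc : 0 < c) :
    ∫ x : Vec p, ‖x‖ ^ 4 ∂ν ≤ 4 * (c ^ 2)⁻¹ * p ^ 2 := by
  have h0 : ∀ i : Fin p, Integrable (fun x : Vec p => x i ^ 4) ν := fun i => by
    have := h.integrable_pow_four hc (norm_single_one i)
    simpa only [inner_single_one] using this
  calc ∫ x : Vec p, ‖x‖ ^ 4 ∂ν ≤ ∫ x : Vec p, (p : ℝ) * ∑ i, x i ^ 4 ∂ν :=
        integral_mono (h.integrable_norm_pow_four hc)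
          ((integrable_finsetSum _ fun i _ => h0 i).const_mul _) norm_pow_four_le
    _ = p * ∑ i : Fin p, ∫ x : Vec p, x i ^ 4 ∂ν := by
        rw [integral_const_mul, integral_finsetSum _ fun i _ => h0 i]
    _ ≤ p * ∑ i : Fin p, 2 * (2 * (c ^ 2)⁻¹) := by
        gcongr with i
        have := h.integral_pow_four_le hc (norm_single_one i)
        simpa only [inner_single_one] using this
    _ = 4 * (c ^ 2)⁻¹ * p ^ 2 := by
        simp; ring

/-- The second moments of `ν` along any two directions, from those of the coordinates. -/
lemma HasExpSquareMoment.integral_inner_mul_inner (h : HasExpSquareMoment ν c) (hc : 0 < c)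
    {Sig : Matrix (Fin p) (Fin p) ℝ} (hS : ∀ i j, ∫ x : Vec p, x i * x j ∂ν = Sig i j)
    (v w : Vec p) : ∫ x, ⟪x, v⟫ * ⟪x, w⟫ ∂ν = ⟪act Sig v, w⟫ := by
  have h0 : ∀ i j : Fin p, Integrable (fun x : Vec p => x i * x j) ν := fun i j => by
    have hi : MemLp (fun x : Vec p => x i) 2 ν := by
      rw [memLp_two_iff_integrable_sq (Continuous.aestronglyMeasurable (by fun_prop))]
      simpa only [inner_single_one] using h.integrable_sq hc (norm_single_one i)
    have hj : MemLp (fun x : Vec p => x j) 2 ν := by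
      rw [memLp_two_iff_integrable_sq (Continuous.aestronglyMeasurable (by fun_prop))]
      simpa only [inner_single_one] using h.integrable_sq hc (norm_single_one j)
    exact hi.integrable_mul hj
  have e : ∀ x : Vec p, ⟪x, v⟫ * ⟪x, w⟫ = ∑ i, ∑ j, (x i * x j) * (v j * w i) := fun x => by
    rw [mul_comm, inner_eq_sum, inner_eq_sum, Finset.sum_mul_sum]
    exact Finset.sum_congr rfl fun i _ => Finset.sum_congr rfl fun j _ => by ring
  simp only [e]
  rw [integral_finsetSum _ fun i _ => integrable_finsetSum _ fun j _ => (h0 i j).mul_const _,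
    inner_act_eq_sum]
  refine Finset.sum_congr rfl fun i _ => ?_
  rw [integral_finsetSum _ fun j _ => (h0 i j).mul_const _]
  refine Finset.sum_congr rfl fun j _ => ?_
  rw [integral_mul_const, hS]

end Moments

/-! ### Exponential concentration of sums of independent variables -/

section Chernoff

lemma exp_le_one_add_add_sq_mul_exp_abs (u : ℝ) :
    Real.exp u ≤ 1 + u + u ^ 2 * Real.exp |u| := by
  have h1 : 1 ≤ Real.exp |u| := Real.one_le_exp (abs_nonneg u)
  rcases le_or_gt |u| 1 with hu | hu
  · have := (abs_le.1 (Real.norm_exp_sub_one_sub_id_le (x := u) hu)).2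
    have h2 : ‖u‖ ^ 2 = u ^ 2 := by simp
    rw [h2] at this
    nlinarith [sq_nonneg u]
  · rcases le_or_gt 0 u with h0 | h0
    · rw [abs_of_nonneg h0] at hu ⊢
      have h2 : Real.exp u ≤ u ^ 2 * Real.exp u :=
        le_mul_of_one_le_left (Real.exp_pos u).le (by nlinarith)
      linarith
    · rw [abs_of_neg h0] at hu h1 ⊢
      have : Real.exp u ≤ 1 := Real.exp_le_one_iff.2 h0.le
      nlinarith [sq_nonneg u]

lemma sq_mul_exp_le {y l : ℝ} (hl : |l| ≤ 1 / 2) :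
    (l * y) ^ 2 * Real.exp |l * y| ≤ 8 * l ^ 2 * Real.exp |y| := by
  have h1 : y ^ 2 ≤ 8 * Real.exp (|y| / 2) := by
    have := Real.quadratic_le_exp_of_nonneg (x := |y| / 2) (by positivity)
    have h2 : |y| ^ 2 = y ^ 2 := sq_abs y
    nlinarith [abs_nonneg y]
  have h2 : Real.exp |l * y| ≤ Real.exp (|y| / 2) := by
    apply Real.exp_le_exp.2
    rw [abs_mul]
    nlinarith [abs_nonneg y]
  have h3 : Real.exp |y| = Real.exp (|y| / 2) * Real.exp (|y| / 2) := by
    rw [← Real.exp_add]; ring_nf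
  calc (l * y) ^ 2 * Real.exp |l * y| = l ^ 2 * (y ^ 2 * Real.exp |l * y|) := by ring
    _ ≤ l ^ 2 * ((8 * Real.exp (|y| / 2)) * Real.exp (|y| / 2)) := by gcongr
    _ = 8 * l ^ 2 * Real.exp |y| := by rw [h3]; ring

variable {α : Type*} [MeasurableSpace α] {ν : Measure α}

lemma integrable_of_integrable_exp_abs {Y : α → ℝ} (hY : Measurable Y)
    (hint : Integrable (fun a => Real.exp |Y a|) ν) : Integrable Y ν :=
  hint.mono' hY.aestronglyMeasurable (ae_of_all _ fun a => by
    rw [Real.norm_eq_abs]; linarith [Real.add_one_le_exp |Y a|])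

lemma integrable_exp_mul_of_integrable_exp_abs {Y : α → ℝ} (hY : Measurable Y)
    (hint : Integrable (fun a => Real.exp |Y a|) ν) {l : ℝ} (hl : |l| ≤ 1 / 2) :
    Integrable (fun a => Real.exp (l * Y a)) ν :=
  hint.mono' (by fun_prop) (ae_of_all _ fun a => by
    rw [Real.norm_of_nonneg (Real.exp_pos _).le]
    apply Real.exp_le_exp.2
    refine (le_abs_self _).trans ?_
    rw [abs_mul]
    nlinarith [abs_nonneg (Y a)])

variable [IsProbabilityMeasure ν]

/-- A sub-gaussian bound for the moment generating function near `0` (without centring). -/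
lemma integral_exp_mul_le {Y : α → ℝ} (hY : Measurable Y)
    (hint : Integrable (fun a => Real.exp |Y a|) ν) {D : ℝ}
    (hD : ∫ a, Real.exp |Y a| ∂ν ≤ D) {l : ℝ} (hl : |l| ≤ 1 / 2) :
    ∫ a, Real.exp (l * Y a) ∂ν ≤ Real.exp (l * ∫ a, Y a ∂ν + 8 * D * l ^ 2) := by
  have iY := integrable_of_integrable_exp_abs hY hint
  have i0 : Integrable (fun _ : α => (1 : ℝ)) ν := integrable_const 1
  have i1 : Integrable (fun a => 1 + l * Y a) ν := i0.add (iY.const_mul l)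
  calc ∫ a, Real.exp (l * Y a) ∂ν
      ≤ ∫ a, ((1 + l * Y a) + 8 * l ^ 2 * Real.exp |Y a|) ∂ν :=
        integral_mono (integrable_exp_mul_of_integrable_exp_abs hY hint hl)
          (i1.add (hint.const_mul _)) fun a =>
          (exp_le_one_add_add_sq_mul_exp_abs _).trans (by
            have := sq_mul_exp_le (y := Y a) hl
            linarith)
    _ = 1 + l * ∫ a, Y a ∂ν + 8 * l ^ 2 * ∫ a, Real.exp |Y a| ∂ν := by
        rw [integral_add i1 (hint.const_mul _), integral_add i0 (iY.const_mul l),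
          integral_const_mul, integral_const_mul]
        simp
    _ ≤ (l * ∫ a, Y a ∂ν + 8 * D * l ^ 2) + 1 := by
        nlinarith [sq_nonneg l]
    _ ≤ _ := Real.add_one_le_exp _

variable {Ω ι : Type*} [MeasurableSpace Ω] {P : Measure Ω} [IsProbabilityMeasure P]

lemma measureReal_le_sum_sub_le {x : ι → Ω → α} (hx : ∀ i, Measurable (x i)) (hind : iIndepFun x P)
    (hlaw : ∀ i, P.map (x i) = ν) {Y : α → ℝ} (hY : Measurable Y)
    (hint : Integrable (fun a => Real.exp |Y a|) ν) {D : ℝ}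
    (hD : ∫ a, Real.exp |Y a| ∂ν ≤ D) {l : ℝ} (hl0 : 0 ≤ l) (hl : l ≤ 1 / 2) (T : Finset ι)
    (t : ℝ) :
    P.real {ω | T.card * t ≤ ∑ i ∈ T, (Y (x i ω) - ∫ a, Y a ∂ν)}
      ≤ Real.exp (T.card * (8 * D * l ^ 2 - l * t)) := by
  have hl' : |l| ≤ 1 / 2 := by rwa [abs_of_nonneg hl0]
  set X : ι → Ω → ℝ := fun i ω => Y (x i ω) with hX
  have hXm : ∀ i, Measurable (X i) := fun i => hY.comp (hx i)
  have hXind : iIndepFun X P := hind.comp (fun _ => Y) fun _ => hY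
  have hXint : ∀ i, Integrable (fun ω => Real.exp (l * X i ω)) P := fun i => by
    have := integrable_exp_mul_of_integrable_exp_abs hY hint hl'
    rw [← hlaw i] at this
    exact this.comp_measurable (hx i)
  have hmgf : ∀ i, mgf (X i) P l ≤ Real.exp (l * ∫ a, Y a ∂ν + 8 * D * l ^ 2) := fun i => by
    refine le_trans (le_of_eq ?_) (integral_exp_mul_le hY hint hD hl')
    rw [mgf, ← hlaw i, integral_map (hx i).aemeasurable (by fun_prop)]
  have hset : {ω | T.card * t ≤ ∑ i ∈ T, (Y (x i ω) - ∫ a, Y a ∂ν)}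
      = {ω | T.card * (t + ∫ a, Y a ∂ν) ≤ (∑ i ∈ T, X i) ω} := by
    ext ω
    simp only [Set.mem_ofPred_eq, Finset.sum_sub_distrib, Finset.sum_const, nsmul_eq_mul,
      Finset.sum_apply, hX]
    constructor <;> intro h <;> linarith
  rw [hset]
  refine (measure_ge_le_exp_mul_mgf _ hl0
    (hXind.integrable_exp_mul_sum hXm fun i _ => hXint i)).trans ?_
  rw [hXind.mgf_sum hXm]
  calc Real.exp (-l * (T.card * (t + ∫ a, Y a ∂ν))) * ∏ i ∈ T, mgf (X i) P l
      ≤ Real.exp (-l * (T.card * (t + ∫ a, Y a ∂ν)))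
          * ∏ _i ∈ T, Real.exp (l * ∫ a, Y a ∂ν + 8 * D * l ^ 2) := by
        gcongr with i _
        · exact fun i _ => mgf_nonneg
        · exact hmgf i
    _ = _ := by
        rw [Finset.prod_const, ← Real.exp_nat_mul, ← Real.exp_add]
        congr 1; ring

/-- A two-sided Chernoff bound for variables with an exponential moment. -/
lemma measureReal_le_abs_sum_sub_le {x : ι → Ω → α} (hx : ∀ i, Measurable (x i))
    (hind : iIndepFun x P)
    (hlaw : ∀ i, P.map (x i) = ν) {Y : α → ℝ} (hY : Measurable Y)
    (hint : Integrable (fun a => Real.exp |Y a|) ν) {D : ℝ}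
    (hD : ∫ a, Real.exp |Y a| ∂ν ≤ D) {l : ℝ} (hl0 : 0 ≤ l) (hl : l ≤ 1 / 2) (T : Finset ι)
    (t : ℝ) :
    P.real {ω | T.card * t ≤ |∑ i ∈ T, (Y (x i ω) - ∫ a, Y a ∂ν)|}
      ≤ 2 * Real.exp (T.card * (8 * D * l ^ 2 - l * t)) := by
  have h1 := measureReal_le_sum_sub_le hx hind hlaw hY hint hD hl0 hl T t
  have h2 := measureReal_le_sum_sub_le hx hind hlaw hY.neg (ν := ν)
    (by simpa using hint) (D := D) (by simpa using hD) hl0 hl T t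
  have hsub : {ω | T.card * t ≤ |∑ i ∈ T, (Y (x i ω) - ∫ a, Y a ∂ν)|}
      ⊆ {ω | T.card * t ≤ ∑ i ∈ T, (Y (x i ω) - ∫ a, Y a ∂ν)}
        ∪ {ω | T.card * t ≤ ∑ i ∈ T, ((-Y) (x i ω) - ∫ a, (-Y) a ∂ν)} := by
    intro ω hω
    simp only [Set.mem_ofPred_eq] at hω
    rcases le_abs.1 hω with h | h
    · exact Or.inl h
    · refine Or.inr ?_
      simp only [Set.mem_ofPred_eq, Pi.neg_apply, integral_neg]
      refine h.trans (le_of_eq ?_)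
      rw [← Finset.sum_neg_distrib]
      exact Finset.sum_congr rfl fun i _ => by ring
  calc _ ≤ _ := measureReal_mono hsub
    _ ≤ _ := measureReal_union_le _ _
    _ ≤ _ := by linarith

end Chernoff

/-! ### Projection onto a ball and nets -/

section Nets

variable {p : ℕ}

lemma norm_projBall_le {R : ℝ} (hR : 0 ≤ R) (v : Vec p) : ‖projBall R v‖ ≤ R := by
  unfold projBall
  split_ifs with h
  · exact h
  · have hv : 0 < ‖v‖ := hR.trans_lt (not_le.1 h)
    rw [norm_smul, Real.norm_of_nonneg (by positivity), div_mul_cancel₀ _ hv.ne']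

lemma norm_projBall_sub_le {R : ℝ} (hR : 0 ≤ R) (v : Vec p) {w : Vec p} (hw : ‖w‖ ≤ R) :
    ‖projBall R v - w‖ ≤ ‖v - w‖ := by
  unfold projBall
  split_ifs with h
  · exact le_rfl
  · have hlt := not_le.1 h
    have hv : 0 < ‖v‖ := hR.trans_lt hlt
    set s := R / ‖v‖ with hs
    have hs0 : 0 ≤ s := by positivity
    have hs1 : s ≤ 1 := (div_le_one hv).2 hlt.le
    have hRs : R = s * ‖v‖ := (div_mul_cancel₀ _ hv.ne').symm
    refine le_of_sq_le_sq ?_ (norm_nonneg _)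
    rw [norm_sub_sq_real, norm_sub_sq_real, norm_smul, Real.norm_of_nonneg hs0,
      real_inner_smul_left]
    have h1 : ⟪v, w⟫ ≤ ‖v‖ * (s * ‖v‖) :=
      (real_inner_le_norm v w).trans (by gcongr; linarith)
    nlinarith [mul_le_mul_of_nonneg_left h1 (sub_nonneg.2 hs1),
      mul_nonneg (sq_nonneg (1 - s)) (sq_nonneg ‖v‖)]

/-- The unit ball has a `1/2`-net with `5^p` points: a maximal `1/2`-separated subset. -/
lemma exists_half_net (p : ℕ) : ∃ N : Finset (Vec p), N.card ≤ 5 ^ p ∧ (∀ w ∈ N, ‖w‖ ≤ 1) ∧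
    ∀ v : Vec p, ‖v‖ ≤ 1 → ∃ w ∈ N, ‖v - w‖ ≤ 1 / 2 := by
  classical
  let sep : Finset (Vec p) → Prop := fun N =>
    (∀ w ∈ N, ‖w‖ ≤ 1) ∧ ∀ v ∈ N, ∀ w ∈ N, v ≠ w → 1 / 2 ≤ ‖v - w‖
  have hcard : ∀ N, sep N → N.card ≤ 5 ^ p := by
    intro N hN
    have hinj : Function.Injective (fun v : Vec p => (2 : ℝ) • v) :=
      smul_right_injective _ two_ne_zero
    have h := Besicovitch.card_le_of_separated (N.image fun v => (2 : ℝ) • v)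
      (by
        intro c hc
        obtain ⟨w, hw, rfl⟩ := Finset.mem_image.1 hc
        rw [norm_smul, Real.norm_of_nonneg (by norm_num)]
        linarith [hN.1 w hw])
      (by
        intro c hc d hd hcd
        obtain ⟨v, hv, rfl⟩ := Finset.mem_image.1 hc
        obtain ⟨w, hw, rfl⟩ := Finset.mem_image.1 hd
        have hvw : v ≠ w := fun e => hcd (by rw [e])
        rw [← smul_sub, norm_smul, Real.norm_of_nonneg (by norm_num)]
        linarith [hN.2 v hv w hw hvw])
    rwa [Finset.card_image_of_injective _ hinj, finrank_euclideanSpace, Fintype.card_fin] at h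
  -- a separated set of the largest possible size is a net
  let A : Set ℕ := {k | ∃ N, sep N ∧ N.card = k}
  have hA : A.Nonempty := ⟨0, ∅, ⟨by simp, by simp⟩, by simp⟩
  have hAb : BddAbove A := ⟨5 ^ p, by rintro k ⟨N, hN, rfl⟩; exact hcard N hN⟩
  obtain ⟨N, hN, hNc⟩ := Nat.sSup_mem hA hAb
  refine ⟨N, hcard N hN, hN.1, fun v hv => ?_⟩
  by_contra hcon
  push Not at hcon
  have hvN : v ∉ N := fun h => by
    have := hcon v h
    simp at this; linarith
  have hins : sep (insert v N) := by
    refine ⟨fun w hw => ?_, fun u hu w hw huw => ?_⟩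
    · rcases Finset.mem_insert.1 hw with rfl | hw
      · exact hv
      · exact hN.1 w hw
    · rcases Finset.mem_insert.1 hu with rfl | hu' <;>
        rcases Finset.mem_insert.1 hw with rfl | hw'
      · exact absurd rfl huw
      · exact (hcon w hw').le
      · rw [norm_sub_rev]; exact (hcon u hu').le
      · exact hN.2 u hu' w hw' huw
  have h1 : (insert v N).card ≤ sSup A := le_csSup hAb ⟨_, hins, rfl⟩
  rw [Finset.card_insert_of_notMem hvN, hNc] at h1
  omega

/-- A `2⁻ᵏ`-net of the unit ball with `5^(pk)` points, obtained by refining a `1/2`-net `k`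
times. -/
lemma exists_net (p k : ℕ) : ∃ N : Finset (Vec p), N.card ≤ (5 ^ p) ^ k ∧ (∀ w ∈ N, ‖w‖ ≤ 1) ∧
    ∀ v : Vec p, ‖v‖ ≤ 1 → ∃ w ∈ N, ‖v - w‖ ≤ (1 / 2) ^ k := by
  classical
  induction k with
  | zero => exact ⟨{0}, by simp, by simp, fun v hv => ⟨0, by simp, by simpa using hv⟩⟩
  | succ k ih =>
    obtain ⟨N, hN, hN1, hNet⟩ := ih
    obtain ⟨N', hN', hN1', hNet'⟩ := exists_half_net p
    refine ⟨(N' ×ˢ N).image fun z => projBall 1 (z.1 + (1 / 2 : ℝ) • z.2), ?_, ?_, ?_⟩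
    · refine Finset.card_image_le.trans ?_
      rw [Finset.card_product, pow_succ, mul_comm]
      exact Nat.mul_le_mul hN hN'
    · intro w hw
      obtain ⟨z, -, rfl⟩ := Finset.mem_image.1 hw
      exact norm_projBall_le zero_le_one _
    · intro v hv
      obtain ⟨w', hw', hd'⟩ := hNet' v hv
      obtain ⟨w, hw, hd⟩ := hNet ((2 : ℝ) • (v - w')) (by
        rw [norm_smul, Real.norm_of_nonneg (by norm_num)]; linarith)
      refine ⟨_, Finset.mem_image.2 ⟨(w', w), Finset.mk_mem_product hw' hw, rfl⟩, ?_⟩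
      rw [norm_sub_rev]
      refine (norm_projBall_sub_le zero_le_one _ hv).trans ?_
      have e : w' + (1 / 2 : ℝ) • w - v = (-(1 / 2) : ℝ) • ((2 : ℝ) • (v - w') - w) := by
        rw [smul_sub, smul_smul, neg_smul]
        norm_num
        abel
      rw [e, norm_smul, pow_succ]
      norm_num
      norm_num at hd
      linarith

lemma norm_le_of_net {N : Finset (Vec p)}
    (hN : ∀ v : Vec p, ‖v‖ ≤ 1 → ∃ w ∈ N, ‖v - w‖ ≤ 1 / 2) {y : Vec p} {t : ℝ}
    (h : ∀ u ∈ N, |⟪y, u⟫| ≤ t) : ‖y‖ ≤ 2 * t := by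
  by_cases hy : y = 0
  · obtain ⟨w, hw, -⟩ := hN 0 (by simp)
    have := (abs_nonneg _).trans (h w hw)
    rw [hy, norm_zero]; linarith
  have hn : ‖y‖ ≠ 0 := norm_ne_zero_iff.2 hy
  obtain ⟨w, hw, hd⟩ := hN (‖y‖⁻¹ • y) (by rw [norm_smul, norm_inv, norm_norm, inv_mul_cancel₀ hn])
  have h1 : ⟪y, ‖y‖⁻¹ • y⟫ = ‖y‖ := by
    rw [inner_smul_right, real_inner_self_eq_norm_sq]; field_simp
  have h2 : ⟪y, ‖y‖⁻¹ • y⟫ = ⟪y, w⟫ + ⟪y, ‖y‖⁻¹ • y - w⟫ := by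
    rw [inner_sub_right]; ring
  have h3 := real_inner_le_norm y (‖y‖⁻¹ • y - w)
  have h4 := mul_le_mul_of_nonneg_left hd (norm_nonneg y)
  have h5 := (le_abs_self _).trans (h w hw)
  linarith

lemma norm_act_le_of_net {N : Finset (Vec p)}
    (hN : ∀ v : Vec p, ‖v‖ ≤ 1 → ∃ w ∈ N, ‖v - w‖ ≤ 1 / 2) {A : Matrix (Fin p) (Fin p) ℝ} {t : ℝ}
    (h : ∀ w ∈ N, ∀ u ∈ N, |⟪act A w, u⟫| ≤ t) (v : Vec p) : ‖act A v‖ ≤ 4 * t * ‖v‖ := by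
  have ht : 0 ≤ t := by
    obtain ⟨w, hw, -⟩ := hN 0 (by simp)
    exact (abs_nonneg _).trans (h w hw w hw)
  have h1 : ∀ v : Vec p, ‖v‖ = 1 → ‖act A v‖ ≤ 2 * t + specNorm A / 2 := by
    intro v hv
    obtain ⟨w, hw, hd⟩ := hN v hv.le
    have e : act A v = act A w + act A (v - w) := by rw [act_sub_right]; abel
    rw [e]
    refine (norm_add_le _ _).trans (add_le_add (norm_le_of_net hN (h w hw)) ?_)
    refine (norm_act_le A _).trans ?_
    have : 0 ≤ specNorm A := norm_nonneg _
    nlinarith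
  have h0 : 0 ≤ specNorm A := norm_nonneg _
  have h2 : specNorm A ≤ 2 * t + specNorm A / 2 :=
    ContinuousLinearMap.opNorm_le_of_unit_norm (by positivity) fun v hv => h1 v hv
  refine (norm_act_le A v).trans (mul_le_mul_of_nonneg_right (by linarith) (norm_nonneg _))

end Nets

/-! ### The sub-sampled covariance -/

section Covariance

variable {p n : ℕ}

lemma twenty_five_le_exp_four : (25 : ℝ) ≤ Real.exp 4 := by
  have h : Real.exp 4 = Real.exp 1 ^ 4 := by rw [← Real.exp_nat_mul]; norm_num
  rw [h]
  have h2 : (2.7 : ℝ) ≤ Real.exp 1 := by linarith [Real.exp_one_gt_d9]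
  calc (25 : ℝ) ≤ 2.7 ^ 4 := by norm_num
    _ ≤ _ := pow_le_pow_left₀ (by norm_num) h2 4

lemma measureReal_biUnion_prod_le {Ω α β : Type*} [MeasurableSpace Ω] (P : Measure Ω)
    [IsFiniteMeasure P] (N : Finset α) (N' : Finset β) (A : α → β → Set Ω) {ε : ℝ} (hε : 0 ≤ ε)
    {k k' : ℕ} (hk : N.card ≤ k) (hk' : N'.card ≤ k')
    (h : ∀ a ∈ N, ∀ b ∈ N', P.real (A a b) ≤ ε) :
    P.real (⋃ a ∈ N, ⋃ b ∈ N', A a b) ≤ k * (k' * ε) := by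
  refine (measureReal_biUnion_finset_le _ _).trans ?_
  calc ∑ a ∈ N, P.real (⋃ b ∈ N', A a b) ≤ ∑ a ∈ N, k' * ε := by
        refine Finset.sum_le_sum fun a ha => (measureReal_biUnion_finset_le _ _).trans ?_
        calc ∑ b ∈ N', P.real (A a b) ≤ ∑ b ∈ N', ε := Finset.sum_le_sum fun b hb => h a ha b hb
          _ = N'.card * ε := by simp
          _ ≤ k' * ε := by gcongr
    _ = N.card * (k' * ε) := by simp
    _ ≤ k * (k' * ε) := by gcongr

lemma inner_act_subCov (z : Fin n → Vec p) (T : Finset (Fin n)) (v w : Vec p) :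
    ⟪act (subCov z T) v, w⟫ = (T.card : ℝ)⁻¹ * ∑ i ∈ T, ⟪z i, v⟫ * ⟪z i, w⟫ := by
  simp only [subCov, act_smul_left, act_sum_left, act_outer, real_inner_smul_left, sum_inner]

lemma exp_abs_mul_le (c s t : ℝ) (hc : 0 ≤ c) :
    Real.exp |c * (s * t)| ≤ (1 / 2) * (Real.exp (c * s ^ 2) + Real.exp (c * t ^ 2)) := by
  have h1 : |c * (s * t)| ≤ (c * s ^ 2 + c * t ^ 2) / 2 := by
    rw [abs_mul, abs_of_nonneg hc, abs_mul]
    nlinarith [sq_nonneg (|s| - |t|), sq_abs s, sq_abs t]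
  have h2 : Real.exp ((c * s ^ 2 + c * t ^ 2) / 2)
      = Real.exp (c * s ^ 2 / 2) * Real.exp (c * t ^ 2 / 2) := by
    rw [← Real.exp_add]; ring_nf
  have h3 : ∀ y : ℝ, Real.exp y = Real.exp (y / 2) ^ 2 := fun y => by
    rw [← Real.exp_nat_mul]; congr 1; push_cast; ring
  refine (Real.exp_le_exp.2 h1).trans ?_
  rw [h2, h3 (c * s ^ 2), h3 (c * t ^ 2)]
  nlinarith [sq_nonneg (Real.exp (c * s ^ 2 / 2) - Real.exp (c * t ^ 2 / 2))]

/-- With probability `1 - 2 e⁻ᵖ` the sample covariance of the covariates with index in `T` is within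
`O(√(p / |T|))` of the covariance: Chernoff bounds for the bilinear form at the `25ᵖ` pairs of
points of a `1/2`-net. -/
lemma exists_bad_set_subCov {ν : Measure (Vec p)} [IsProbabilityMeasure ν] {c : ℝ} (hc : 0 < c)
    (hν : HasExpSquareMoment ν c) {Sig : Matrix (Fin p) (Fin p) ℝ}
    (hS : ∀ i j, ∫ x : Vec p, x i * x j ∂ν = Sig i j)
    {Ω : Type*} [MeasurableSpace Ω] {P : Measure Ω} [IsProbabilityMeasure P]
    {x : Fin n → Ω → Vec p} (hx : ∀ i, Measurable (x i)) (hind : iIndepFun x P)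
    (hlaw : ∀ i, P.map (x i) = ν) (T : Finset (Fin n)) (hT : 0 < T.card) (hpT : 4 * p ≤ T.card) :
    ∃ B : Set (Fin n → Vec p), MeasurableSet B ∧
      P.real {ω | (fun i => x i ω) ∈ B} ≤ 2 * Real.exp (-p) ∧
      ∀ z ∉ B, ∀ w, ‖act (subCov z T) w - act Sig w‖
        ≤ 84 * c⁻¹ * Real.sqrt (p / T.card) * ‖w‖ := by
  obtain ⟨N, hNc, hN1, hNet⟩ := exists_half_net p
  set s : ℝ := (T.card : ℝ) with hs
  have hs0 : 0 < s := by simpa [hs] using hT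
  set ρ := Real.sqrt (p / s) with hρ
  have hρ2 : ρ ^ 2 = p / s := Real.sq_sqrt (by positivity)
  have hρ0 : 0 ≤ ρ := Real.sqrt_nonneg _
  have hρ1 : ρ ≤ 1 / 2 := by
    rw [hρ, Real.sqrt_le_left (by norm_num), div_le_iff₀ hs0]
    have : (4 : ℝ) * p ≤ s := by rw [hs]; exact_mod_cast hpT
    linarith
  -- the scaling by `c` gives `|Y|` an exponential moment
  let Y : Vec p → Vec p → Vec p → ℝ := fun w u a => c * (⟪a, w⟫ * ⟪a, u⟫)
  have hYm : ∀ w u, Measurable (Y w u) := fun w u => by fun_prop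
  have hYi : ∀ w ∈ N, ∀ u ∈ N, Integrable (fun a => Real.exp |Y w u a|) ν := fun w hw u hu =>
    (((hν.integrable w (hN1 w hw)).add (hν.integrable u (hN1 u hu))).const_mul (1 / 2)).mono'
      (by fun_prop) (ae_of_all _ fun a => by
        rw [Real.norm_of_nonneg (Real.exp_pos _).le]
        exact exp_abs_mul_le c _ _ hc.le)
  have hYD : ∀ w ∈ N, ∀ u ∈ N, ∫ a, Real.exp |Y w u a| ∂ν ≤ 2 := fun w hw u hu => by
    have i1 := hν.integrable w (hN1 w hw)
    have i2 := hν.integrable u (hN1 u hu)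
    calc ∫ a, Real.exp |Y w u a| ∂ν
        ≤ ∫ a, (1 / 2) * (Real.exp (c * ⟪a, w⟫ ^ 2) + Real.exp (c * ⟪a, u⟫ ^ 2)) ∂ν :=
          integral_mono (hYi w hw u hu) ((i1.add i2).const_mul _)
            fun a => exp_abs_mul_le c _ _ hc.le
      _ = (1 / 2) * (∫ a, Real.exp (c * ⟪a, w⟫ ^ 2) ∂ν + ∫ a, Real.exp (c * ⟪a, u⟫ ^ 2) ∂ν) := by
          rw [integral_const_mul, integral_add i1 i2]
      _ ≤ 2 := by linarith [hν.integral_le w (hN1 w hw), hν.integral_le u (hN1 u hu)]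
  let A : Vec p → Vec p → Set (Fin n → Vec p) := fun w u =>
    {z | s * (21 * ρ) ≤ |∑ i ∈ T, (Y w u (z i) - ∫ a, Y w u a ∂ν)|}
  have hAm : ∀ w u, MeasurableSet (A w u) := fun w u =>
    measurableSet_le measurable_const (by
      have := hYm w u
      fun_prop)
  refine ⟨⋃ w ∈ N, ⋃ u ∈ N, A w u, ?_, ?_, ?_⟩
  · exact Finset.measurableSet_biUnion _ fun w _ => Finset.measurableSet_biUnion _ fun u _ => hAm w u
  · have hb : ∀ w ∈ N, ∀ u ∈ N, P.real {ω | (fun i => x i ω) ∈ A w u} ≤ 2 * Real.exp (-(5 * p)) := by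
      intro w hw u hu
      refine (measureReal_le_abs_sum_sub_le hx hind hlaw (hYm w u) (hYi w hw u hu)
        (hYD w hw u hu) hρ0 hρ1 T (21 * ρ)).trans (le_of_eq ?_)
      congr 2
      have : s * (8 * 2 * ρ ^ 2 - ρ * (21 * ρ)) = -(5 * (s * ρ ^ 2)) := by ring
      rw [this, hρ2, mul_div_cancel₀ _ hs0.ne']
    have hset : {ω | (fun i => x i ω) ∈ ⋃ w ∈ N, ⋃ u ∈ N, A w u}
        = ⋃ w ∈ N, ⋃ u ∈ N, {ω | (fun i => x i ω) ∈ A w u} := by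
      ext ω; simp
    rw [hset]
    refine (measureReal_biUnion_prod_le P N N _ (by positivity) hNc hNc hb).trans ?_
    have h25 : ((5 : ℝ) ^ p * 5 ^ p) ≤ Real.exp (4 * p) := by
      rw [← mul_pow, mul_comm (4 : ℝ), Real.exp_nat_mul]
      exact pow_le_pow_left₀ (by norm_num) (by linarith [twenty_five_le_exp_four]) p
    push_cast
    calc (5 : ℝ) ^ p * (5 ^ p * (2 * Real.exp (-(5 * p))))
        = 2 * ((5 ^ p * 5 ^ p) * Real.exp (-(5 * p))) := by ring
      _ ≤ 2 * (Real.exp (4 * p) * Real.exp (-(5 * p))) := by gcongr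
      _ = 2 * Real.exp (-p) := by rw [← Real.exp_add]; ring_nf
  · intro z hz w
    rw [← act_sub_left]
    have hlt : ∀ w ∈ N, ∀ u ∈ N, |⟪act (subCov z T - Sig) w, u⟫| ≤ 21 * c⁻¹ * ρ := by
      intro w hw u hu
      have hzA : z ∉ A w u := fun h => hz (by
        simp only [Set.mem_iUnion]; exact ⟨w, hw, u, hu, h⟩)
      have h1 : |∑ i ∈ T, (Y w u (z i) - ∫ a, Y w u a ∂ν)| < s * (21 * ρ) := not_le.1 hzA
      have h2 : ∑ i ∈ T, (Y w u (z i) - ∫ a, Y w u a ∂ν)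
          = c * s * ⟪act (subCov z T - Sig) w, u⟫ := by
        simp only [Y]
        rw [act_sub_left, inner_sub_left, inner_act_subCov, ← hν.integral_inner_mul_inner hc hS,
          integral_const_mul, Finset.sum_sub_distrib, ← Finset.mul_sum, Finset.sum_const,
          nsmul_eq_mul, ← hs]
        field_simp
      rw [h2, abs_mul, abs_of_pos (by positivity)] at h1
      have h3 : s * (c * |⟪act (subCov z T - Sig) w, u⟫|) < s * (21 * ρ) := by linarith
      have h4 := lt_of_mul_lt_mul_left h3 hs0.le
      rw [show 21 * c⁻¹ * ρ = (21 * ρ) / c by field_simp, le_div_iff₀ hc]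
      linarith
    refine (norm_act_le_of_net hNet hlt w).trans (le_of_eq ?_)
    ring

/-- A random index set that is uniform over the sets of size `s` and independent of `x` meets a
bad event with no larger probability than a fixed index set. -/
lemma measure_mem_random_set_le {E : Type*} [MeasurableSpace E] {Ω : Type*} [MeasurableSpace Ω]
    {P : Measure Ω} [IsProbabilityMeasure P] {x : Fin n → Ω → E} {S : Ω → Finset (Fin n)} {s : ℕ}
    (hs : s ≤ n) (hSm : ∀ T, MeasurableSet {ω | S ω = T})
    (hS : ∀ T : Finset (Fin n), T.card = s → P {ω | S ω = T} = ((n.choose s : ℕ) : ℝ≥0∞)⁻¹)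
    (hind : Indep (MeasurableSpace.comap S ⊤)
      (MeasurableSpace.comap (fun ω i => x i ω) inferInstance) P)
    (B : Finset (Fin n) → Set (Fin n → E)) (hB : ∀ T, T.card = s → MeasurableSet (B T)) {ε : ℝ≥0∞}
    (hε : ∀ T, T.card = s → P {ω | (fun i => x i ω) ∈ B T} ≤ ε) :
    P {ω | (S ω).card ≠ s ∨ (fun i => x i ω) ∈ B (S ω)} ≤ ε := by
  classical
  set F := (Finset.univ : Finset (Fin n)).powersetCard s with hF
  have hmem : ∀ T, T ∈ F ↔ T.card = s := fun T => by simp [hF, Finset.mem_powersetCard]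
  have hFc : F.card = n.choose s := by simp [hF]
  have hpos : ((n.choose s : ℕ) : ℝ≥0∞) ≠ 0 := by
    exact_mod_cast (Nat.choose_pos hs).ne'
  have hone : ∑ _T ∈ F, ((n.choose s : ℕ) : ℝ≥0∞)⁻¹ = 1 := by
    rw [Finset.sum_const, hFc, nsmul_eq_mul, ENNReal.mul_inv_cancel hpos (by simp)]
  have hcard : P {ω | (S ω).card ≠ s} = 0 := by
    have hU : P (⋃ T ∈ F, {ω | S ω = T}) = 1 := by
      rw [measure_biUnion_finset _ fun T _ => hSm T]
      · rw [← hone]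
        exact Finset.sum_congr rfl fun T hT => hS T ((hmem T).1 hT)
      · intro T _ T' _ hne
        exact Set.disjoint_left.2 fun ω h h' => hne (by
          simp only [Set.mem_ofPred_eq] at h h'; rw [← h, h'])
    have hc : {ω | (S ω).card ≠ s} = (⋃ T ∈ F, {ω | S ω = T})ᶜ := by
      ext ω
      simp only [Set.mem_ofPred_eq, Set.mem_compl_iff, Set.mem_iUnion, hmem, exists_prop, not_exists,
        not_and]
      exact ⟨fun h T hT h' => h (h' ▸ hT), fun h h' => h _ h' rfl⟩
    rw [hc, prob_compl_eq_zero_iff (Finset.measurableSet_biUnion _ fun T _ => hSm T), hU]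
  have hsub : {ω | (S ω).card ≠ s ∨ (fun i => x i ω) ∈ B (S ω)} ⊆ {ω | (S ω).card ≠ s} ∪
      ⋃ T ∈ F, ({ω | S ω = T} ∩ {ω | (fun i => x i ω) ∈ B T}) := by
    intro ω hω
    by_cases h : (S ω).card = s
    · refine Or.inr ?_
      simp only [Set.mem_iUnion]
      exact ⟨S ω, (hmem _).2 h, rfl, hω.resolve_left (not_not.2 h)⟩
    · exact Or.inl h
  calc _ ≤ _ := measure_mono hsub
    _ ≤ P {ω | (S ω).card ≠ s}
        + P (⋃ T ∈ F, ({ω | S ω = T} ∩ {ω | (fun i => x i ω) ∈ B T})) := measure_union_le _ _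
    _ ≤ ∑ T ∈ F, P ({ω | S ω = T} ∩ {ω | (fun i => x i ω) ∈ B T}) := by
        rw [hcard, zero_add]; exact measure_biUnion_finset_le _ _
    _ ≤ ∑ T ∈ F, ((n.choose s : ℕ) : ℝ≥0∞)⁻¹ * ε := by
        refine Finset.sum_le_sum fun T hT => ?_
        have hT' := (hmem T).1 hT
        have h := (Indep_iff _ _ P).1 hind {ω | S ω = T} {ω | (fun i => x i ω) ∈ B T}
          ⟨{T}, trivial, rfl⟩ ⟨B T, hB T hT', rfl⟩
        rw [h, hS T hT']
        gcongr
        exact hε T hT'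
    _ = ε := by rw [← Finset.sum_mul, hone, one_mul]

end Covariance

/-! ### Uniform concentration of weighted empirical means -/

section Uniform

variable {p n : ℕ}

/-- The function `x ↦ f(⟨x, b⟩) (1 + ⟨x, v⟩²)`. It is `f(⟨x, b⟩)` at `v = 0`, so that its empirical
means control those of `f(⟨x, b⟩)` and of `f(⟨x, b⟩) ⟨x, v⟩²` at the same time. -/
noncomputable def weighted (f : ℝ → ℝ) (b v x : Vec p) : ℝ := f ⟪x, b⟫ * (1 + ⟪x, v⟫ ^ 2)

lemma abs_weighted_le {f : ℝ → ℝ} {M : ℝ} (hf : ∀ s, |f s| ≤ M) (b v x : Vec p) :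
    |weighted f b v x| ≤ M * (1 + ⟪x, v⟫ ^ 2) := by
  have h : 0 ≤ 1 + ⟪x, v⟫ ^ 2 := by positivity
  rw [weighted, abs_mul, abs_of_nonneg h]
  exact mul_le_mul_of_nonneg_right (hf _) h

lemma continuous_weighted {f : ℝ → ℝ} (hf : Continuous f) (b v : Vec p) :
    Continuous (weighted f b v) := by
  unfold weighted; fun_prop

lemma continuous_of_abs_sub_le {f : ℝ → ℝ} {M : ℝ}
    (hL : ∀ s t, |f s - f t| ≤ M * |s - t|) : Continuous f :=
  (LipschitzWith.of_dist_le' (K := M) fun s t => by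
    simpa [Real.dist_eq] using hL s t).continuous

lemma abs_weighted_sub_le {f : ℝ → ℝ} {M : ℝ} (hf : ∀ s, |f s| ≤ M)
    (hL : ∀ s t, |f s - f t| ≤ M * |s - t|) {R δ : ℝ} (hR : 1 ≤ R) {b b' v v' : Vec p}
    (hb : ‖b - b'‖ ≤ R * δ) (hv : ‖v‖ ≤ 1) (hv' : ‖v'‖ ≤ 1) (hd : ‖v - v'‖ ≤ δ) (x : Vec p) :
    |weighted f b v x - weighted f b' v' x| ≤ 4 * R * M * δ * (1 + ‖x‖ ^ 4) := by
  have hM : 0 ≤ M := (abs_nonneg _).trans (hf 0)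
  have hδ : 0 ≤ δ := (norm_nonneg _).trans hd
  set ρ := ‖x‖ with hρ
  have hρ0 : 0 ≤ ρ := norm_nonneg _
  have e : weighted f b v x - weighted f b' v' x
      = (f ⟪x, b⟫ - f ⟪x, b'⟫) * (1 + ⟪x, v⟫ ^ 2)
        + f ⟪x, b'⟫ * (⟪x, v - v'⟫ * (⟪x, v⟫ + ⟪x, v'⟫)) := by
    simp only [weighted, inner_sub_right]; ring
  have a1 : |⟪x, v⟫| ≤ ρ := (abs_real_inner_le_norm x v).trans (by nlinarith)
  have a2 : |⟪x, v'⟫| ≤ ρ := (abs_real_inner_le_norm x v').trans (by nlinarith)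
  have a3 : |⟪x, v - v'⟫| ≤ ρ * δ := (abs_real_inner_le_norm x _).trans (by gcongr)
  have a4 : |f ⟪x, b⟫ - f ⟪x, b'⟫| ≤ M * (ρ * (R * δ)) := by
    refine (hL _ _).trans (mul_le_mul_of_nonneg_left ?_ hM)
    rw [← inner_sub_right]
    exact (abs_real_inner_le_norm x _).trans (by gcongr)
  have a5 : ⟪x, v⟫ ^ 2 ≤ ρ ^ 2 := sq_le_sq' (by linarith [(abs_le.1 a1).1]) (abs_le.1 a1).2
  rw [e]
  calc _ ≤ |(f ⟪x, b⟫ - f ⟪x, b'⟫) * (1 + ⟪x, v⟫ ^ 2)|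
        + |f ⟪x, b'⟫ * (⟪x, v - v'⟫ * (⟪x, v⟫ + ⟪x, v'⟫))| := abs_add_le _ _
    _ ≤ M * (ρ * (R * δ)) * (1 + ρ ^ 2) + M * ((ρ * δ) * (ρ + ρ)) := by
        rw [abs_mul, abs_mul, abs_mul, abs_of_nonneg (by positivity : (0:ℝ) ≤ 1 + ⟪x, v⟫ ^ 2)]
        gcongr
        · exact hf _
        · exact (abs_add_le _ _).trans (add_le_add a1 a2)
    _ ≤ M * (ρ * (R * δ)) * (1 + ρ ^ 2) + M * R * ((ρ * δ) * (ρ + ρ)) := by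
        gcongr
        exact le_mul_of_one_le_right hM hR
    _ = M * R * δ * (ρ * (1 + ρ ^ 2) + 2 * ρ ^ 2) := by ring
    _ ≤ M * R * δ * (4 * (1 + ρ ^ 4)) := by
        refine mul_le_mul_of_nonneg_left ?_ (by positivity)
        nlinarith [sq_nonneg (ρ - 1), sq_nonneg (ρ ^ 2 - 1), sq_nonneg (ρ ^ 2 - ρ)]
    _ = _ := by ring

variable {ν : Measure (Vec p)} [IsProbabilityMeasure ν] {c : ℝ}

lemma HasExpSquareMoment.integrable_weighted (hν : HasExpSquareMoment ν c) (hc : 0 < c)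
    {f : ℝ → ℝ} (hfc : Continuous f) {M : ℝ} (hf : ∀ s, |f s| ≤ M) (b : Vec p) {v : Vec p}
    (hv : ‖v‖ ≤ 1) : Integrable (weighted f b v) ν :=
  (((integrable_const (1 : ℝ)).add (hν.integrable_sq hc hv)).const_mul M).mono'
    (continuous_weighted hfc b v).aestronglyMeasurable (ae_of_all _ fun x => abs_weighted_le hf b v x)

/-- Outside an event of small probability the empirical means of `weighted f b v` are close to
their expectations, uniformly in `b` and `v`: Chernoff bounds on a `2⁻ᵏ`-net and the Lipschitz
dependence on `b` and `v`. -/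
lemma exists_bad_set_weighted (hn : 0 < n) (hc : 0 < c) (hc1 : c ≤ 1)
    (hν : HasExpSquareMoment ν c) {Ω : Type*} [MeasurableSpace Ω] {P : Measure Ω}
    [IsProbabilityMeasure P]
    {x : Fin n → Ω → Vec p} (hx : ∀ i, Measurable (x i)) (hind : iIndepFun x P)
    (hlaw : ∀ i, P.map (x i) = ν) {f : ℝ → ℝ} {M : ℝ} (hM : 1 ≤ M) (hf : ∀ s, |f s| ≤ M)
    (hL : ∀ s t, |f s - f t| ≤ M * |s - t|) {R : ℝ} (hR : 1 ≤ R) (k : ℕ) {l : ℝ} (hl0 : 0 ≤ l)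
    (hl : l ≤ 1 / 2) (t : ℝ) :
    ∃ B : Set (Fin n → Vec p),
      P.real {ω | (fun i => x i ω) ∈ B}
        ≤ ((5 : ℝ) ^ p) ^ k * (((5 : ℝ) ^ p) ^ k * (2 * Real.exp (n * (48 * l ^ 2 - l * (c * t / M))))) ∧
      ∀ z ∉ B, (∀ i, ‖z i‖ ≤ M) → ∀ b v : Vec p, ‖b‖ ≤ R → ‖v‖ ≤ 1 →
        |(n : ℝ)⁻¹ * ∑ i, weighted f b v (z i) - ∫ a, weighted f b v a ∂ν|
          ≤ t + 4 * R * M * (1 / 2) ^ k * (1 + M ^ 4)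
            + 4 * R * M * (1 / 2) ^ k * (1 + 4 * (c ^ 2)⁻¹ * p ^ 2) := by
  have hM0 : 0 < M := by linarith
  have hR0 : 0 < R := by linarith
  have hn0 : (0 : ℝ) < n := by exact_mod_cast hn
  have hfc := continuous_of_abs_sub_le hL
  obtain ⟨N, hNc, hN1, hNet⟩ := exists_net p k
  -- the scaling by `c / M` gives `|Y|` an exponential moment
  let Y : Vec p → Vec p → Vec p → ℝ := fun w v a => c / M * weighted f (R • w) v a
  have hYm : ∀ w v, Measurable (Y w v) := fun w v =>
    ((continuous_weighted hfc _ _).measurable).const_mul _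
  have hYle : ∀ w v a, Real.exp |Y w v a| ≤ 3 * Real.exp (c * ⟪a, v⟫ ^ 2) := by
    intro w v a
    have h1 : |Y w v a| ≤ c + c * ⟪a, v⟫ ^ 2 := by
      simp only [Y]
      rw [abs_mul, abs_of_pos (by positivity : 0 < c / M)]
      calc c / M * |weighted f (R • w) v a| ≤ c / M * (M * (1 + ⟪a, v⟫ ^ 2)) := by
            gcongr; exact abs_weighted_le hf _ _ _
        _ = _ := by field_simp
    refine (Real.exp_le_exp.2 h1).trans ?_
    rw [Real.exp_add]
    refine mul_le_mul_of_nonneg_right ?_ (Real.exp_pos _).le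
    exact (Real.exp_le_exp.2 hc1).trans (by linarith [Real.exp_one_lt_d9])
  have hYi : ∀ w, ∀ v ∈ N, Integrable (fun a => Real.exp |Y w v a|) ν := fun w v hv =>
    ((hν.integrable v (hN1 v hv)).const_mul 3).mono'
      (by have := hYm w v; fun_prop) (ae_of_all _ fun a => by
        rw [Real.norm_of_nonneg (Real.exp_pos _).le]
        exact hYle w v a)
  have hYD : ∀ w, ∀ v ∈ N, ∫ a, Real.exp |Y w v a| ∂ν ≤ 6 := fun w v hv => by
    have i1 := hν.integrable v (hN1 v hv)
    calc ∫ a, Real.exp |Y w v a| ∂ν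
        ≤ ∫ a, 3 * Real.exp (c * ⟪a, v⟫ ^ 2) ∂ν :=
          integral_mono (hYi w v hv) (i1.const_mul _) fun a => hYle w v a
      _ = 3 * ∫ a, Real.exp (c * ⟪a, v⟫ ^ 2) ∂ν := integral_const_mul _ _
      _ ≤ 6 := by linarith [hν.integral_le v (hN1 v hv)]
  let A : Vec p → Vec p → Set (Fin n → Vec p) := fun w v =>
    {z | n * (c * t / M) ≤ |∑ i, (Y w v (z i) - ∫ a, Y w v a ∂ν)|}
  refine ⟨⋃ w ∈ N, ⋃ v ∈ N, A w v, ?_, ?_⟩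
  · have hb : ∀ w ∈ N, ∀ v ∈ N, P.real {ω | (fun i => x i ω) ∈ A w v}
        ≤ 2 * Real.exp (n * (48 * l ^ 2 - l * (c * t / M))) := by
      intro w _ v hv
      have h := measureReal_le_abs_sum_sub_le hx hind hlaw (hYm w v) (hYi w v hv)
        (hYD w v hv) hl0 hl Finset.univ (c * t / M)
      rw [Finset.card_univ, Fintype.card_fin] at h
      refine h.trans (le_of_eq ?_)
      norm_num
    have hset : {ω | (fun i => x i ω) ∈ ⋃ w ∈ N, ⋃ v ∈ N, A w v}
        = ⋃ w ∈ N, ⋃ v ∈ N, {ω | (fun i => x i ω) ∈ A w v} := by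
      ext ω; simp
    rw [hset]
    refine (measureReal_biUnion_prod_le P N N _ (by positivity) hNc hNc hb).trans (le_of_eq ?_)
    push_cast; ring
  · intro z hz hzM b v hb hv
    obtain ⟨v', hv'N, hv'⟩ := hNet v hv
    obtain ⟨w, hwN, hw⟩ := hNet (R⁻¹ • b) (by
      rw [norm_smul, norm_inv, Real.norm_of_nonneg hR0.le, inv_mul_le_iff₀ hR0]; linarith)
    set δ : ℝ := (1 / 2) ^ k with hδ
    have hbw : ‖b - R • w‖ ≤ R * δ := by
      have : b - R • w = R • (R⁻¹ • b - w) := by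
        rw [smul_sub, smul_smul, mul_inv_cancel₀ hR0.ne', one_smul]
      rw [this, norm_smul, Real.norm_of_nonneg hR0.le]
      gcongr
    have hpt := abs_weighted_sub_le hf hL hR hbw hv (hN1 v' hv'N) hv'
    have hδ0 : 0 ≤ δ := by positivity
    have i1 := hν.integrable_weighted hc hfc hf b hv
    have i2 := hν.integrable_weighted hc hfc hf (R • w) (hN1 v' hv'N)
    have d1 : |(n : ℝ)⁻¹ * ∑ i, weighted f b v (z i)
        - (n : ℝ)⁻¹ * ∑ i, weighted f (R • w) v' (z i)| ≤ 4 * R * M * δ * (1 + M ^ 4) := by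
      rw [← mul_sub, ← Finset.sum_sub_distrib, abs_mul, abs_of_pos (by positivity : (0:ℝ) < (n : ℝ)⁻¹),
        inv_mul_le_iff₀ hn0]
      refine (Finset.abs_sum_le_sum_abs _ _).trans ?_
      calc ∑ i, |weighted f b v (z i) - weighted f (R • w) v' (z i)|
          ≤ ∑ _i : Fin n, 4 * R * M * δ * (1 + M ^ 4) := by
            refine Finset.sum_le_sum fun i _ => (hpt (z i)).trans ?_
            have := hzM i
            gcongr
        _ = _ := by simp
    have d2 : |∫ a, weighted f b v a ∂ν - ∫ a, weighted f (R • w) v' a ∂ν|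
        ≤ 4 * R * M * δ * (1 + 4 * (c ^ 2)⁻¹ * p ^ 2) := by
      rw [← integral_sub i1 i2]
      refine abs_integral_le_integral_abs.trans ?_
      have i4 := hν.integrable_norm_pow_four hc
      calc ∫ a, |weighted f b v a - weighted f (R • w) v' a| ∂ν
          ≤ ∫ a, 4 * R * M * δ * (1 + ‖a‖ ^ 4) ∂ν :=
            integral_mono (i1.sub i2).abs (((integrable_const 1).add i4).const_mul _) hpt
        _ = 4 * R * M * δ * (1 + ∫ a, ‖a‖ ^ 4 ∂ν) := by
            rw [integral_const_mul, integral_add (integrable_const 1) i4]; simp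
        _ ≤ _ := by
            gcongr
            exact hν.integral_norm_pow_four_le hc
    have hzA : z ∉ A w v' := fun h => hz (by
      simp only [Set.mem_iUnion]; exact ⟨w, hwN, v', hv'N, h⟩)
    have h1 : |∑ i, (Y w v' (z i) - ∫ a, Y w v' a ∂ν)| < n * (c * t / M) := not_le.1 hzA
    have h2 : ∑ i, (Y w v' (z i) - ∫ a, Y w v' a ∂ν) = c / M * n *
        ((n : ℝ)⁻¹ * ∑ i, weighted f (R • w) v' (z i) - ∫ a, weighted f (R • w) v' a ∂ν) := by
      simp only [Y]
      rw [Finset.sum_sub_distrib, ← Finset.mul_sum, integral_const_mul, Finset.sum_const,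
        Finset.card_univ, Fintype.card_fin, nsmul_eq_mul]
      field_simp
    have d3 : |(n : ℝ)⁻¹ * ∑ i, weighted f (R • w) v' (z i)
        - ∫ a, weighted f (R • w) v' a ∂ν| ≤ t := by
      rw [h2, abs_mul, abs_of_pos (by positivity : 0 < c / M * n),
        show n * (c * t / M) = c / M * n * t by ring] at h1
      exact (lt_of_mul_lt_mul_left h1 (by positivity)).le
    have e1 := abs_le.1 d1
    have e2 := abs_le.1 d2
    have e3 := abs_le.1 d3
    rw [abs_le]
    constructor <;> linarith [e1.1, e1.2, e2.1, e2.2, e3.1, e3.2]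

/-- The previous bound with its parameters chosen for `n = L^10` observations: functions bounded by
`L²` and `L²`-Lipschitz have uniform deviations `O(1 / L)`. -/
lemma exists_bad_set_weighted_rate (hc : 0 < c) (hc1 : c ≤ 1)
    (hν : HasExpSquareMoment ν c) {Ω : Type*} [MeasurableSpace Ω] {P : Measure Ω}
    [IsProbabilityMeasure P]
    {x : Fin n → Ω → Vec p} (hx : ∀ i, Measurable (x i)) (hind : iIndepFun x P)
    (hlaw : ∀ i, P.map (x i) = ν) {L a R : ℝ} (ha : 0 < a) (hR : 1 ≤ R) (hLn : L ^ 10 = n)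
    (hL2 : 2 ≤ L) (hpL : (p : ℝ) ≤ L ^ 2) (hpa : a * (p * Real.log n) ≤ L ^ 2)
    (hlog : 1 ≤ Real.log n) (hLc : 16 / a + 49 ≤ c * L) (hLR : 20 * R * (c ^ 2)⁻¹ ≤ L)
    {f : ℝ → ℝ} (hf : ∀ s, |f s| ≤ L ^ 2) (hfL : ∀ s t, |f s - f t| ≤ L ^ 2 * |s - t|) :
    ∃ B : Set (Fin n → Vec p),
      P.real {ω | (fun i => x i ω) ∈ B} ≤ 2 * Real.exp (-p) ∧
      ∀ z ∉ B, (∀ i, ‖z i‖ ≤ L ^ 2) → ∀ b v : Vec p, ‖b‖ ≤ R → ‖v‖ ≤ 1 →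
        |(n : ℝ)⁻¹ * ∑ i, weighted f b v (z i) - ∫ a, weighted f b v a ∂ν| ≤ 3 / L := by
  have hL0 : 0 < L := by linarith
  have hn : 0 < n := by
    have : (0 : ℝ) < n := by rw [← hLn]; positivity
    exact_mod_cast this
  have hlogL : Real.log n = 10 * Real.log L := by rw [← hLn, Real.log_pow]; norm_num
  -- a net of mesh `2⁻ᵏ ≤ L⁻¹²` makes the Lipschitz errors at most `1 / L`
  set k : ℕ := ⌈24 * Real.log L⌉₊ with hk
  have hk1 : 24 * Real.log L ≤ k := Nat.le_ceil _
  have hk2 : (k : ℝ) ≤ 4 * Real.log n := by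
    have := Nat.ceil_lt_add_one (a := 24 * Real.log L) (by linarith)
    linarith
  have hδ : (1 / 2 : ℝ) ^ k ≤ (L ^ 12)⁻¹ := by
    have h1 : (1 / 2 : ℝ) ^ k = Real.exp (-(k * Real.log 2)) := by
      rw [Real.exp_neg, Real.exp_nat_mul, Real.exp_log (by norm_num), one_div, inv_pow]
    have h2 : (L ^ 12)⁻¹ = Real.exp (-(12 * Real.log L)) := by
      rw [Real.exp_neg, show (12 * Real.log L) = ((12 : ℕ) : ℝ) * Real.log L by norm_num,
        Real.exp_nat_mul, Real.exp_log hL0]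
    rw [h1, h2]
    apply Real.exp_le_exp.2
    have h3 : 1 / 2 ≤ Real.log 2 := by linarith [Real.log_two_gt_d9]
    nlinarith [Nat.cast_nonneg (α := ℝ) k]
  obtain ⟨B, hB, hB'⟩ := exists_bad_set_weighted hn hc hc1 hν hx hind hlaw
    (M := L ^ 2) (one_le_pow₀ (by linarith)) hf hfL hR k (l := (L ^ 4)⁻¹) (by positivity)
    (by
      rw [one_div]
      apply inv_anti₀ (by norm_num)
      calc (2 : ℝ) ≤ L := hL2
        _ ≤ L ^ 4 := le_self_pow₀ (by linarith) (by norm_num)) (1 / L)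
  refine ⟨B, hB.trans ?_, fun z hz hzM b v hb hv => (hB' z hz hzM b v hb hv).trans ?_⟩
  -- the Chernoff exponent `48 L² - c L³` beats the entropy `16 L² / a` of the net
  · have e1 : (n : ℝ) * (48 * (L ^ 4)⁻¹ ^ 2 - (L ^ 4)⁻¹ * (c * (1 / L) / L ^ 2))
        = 48 * L ^ 2 - c * L ^ 3 := by
      rw [← hLn]; field_simp
    have e2 : ((5 : ℝ) ^ p) ^ k * ((5 : ℝ) ^ p) ^ k ≤ Real.exp (16 / a * L ^ 2) := by
      have h1 : ((5 : ℝ) ^ p) ^ k * ((5 : ℝ) ^ p) ^ k ≤ Real.exp (((p * k : ℕ) : ℝ) * 4) := by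
        rw [← pow_mul, ← mul_pow, Real.exp_nat_mul]
        exact pow_le_pow_left₀ (by norm_num) (by linarith [twenty_five_le_exp_four]) _
      refine h1.trans (Real.exp_le_exp.2 ?_)
      push_cast
      have h2 : (p : ℝ) * k ≤ p * (4 * Real.log n) := by gcongr
      have h3 : (p : ℝ) * Real.log n ≤ L ^ 2 / a := by rw [le_div_iff₀ ha]; linarith
      calc (p : ℝ) * k * 4 ≤ 16 * (p * Real.log n) := by linarith
        _ ≤ 16 * (L ^ 2 / a) := by gcongr
        _ = _ := by ring
    rw [e1]
    calc ((5 : ℝ) ^ p) ^ k * (((5 : ℝ) ^ p) ^ k * (2 * Real.exp (48 * L ^ 2 - c * L ^ 3)))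
        = 2 * ((((5 : ℝ) ^ p) ^ k * ((5 : ℝ) ^ p) ^ k) * Real.exp (48 * L ^ 2 - c * L ^ 3)) := by ring
      _ ≤ 2 * (Real.exp (16 / a * L ^ 2) * Real.exp (48 * L ^ 2 - c * L ^ 3)) := by gcongr
      _ = 2 * Real.exp (16 / a * L ^ 2 + (48 * L ^ 2 - c * L ^ 3)) := by rw [← Real.exp_add]
      _ ≤ 2 * Real.exp (-p) := by
          gcongr
          nlinarith [mul_le_mul_of_nonneg_right hLc (sq_nonneg L)]
  · have hR0 : 0 < R := by linarith
    have hci : 1 ≤ (c ^ 2)⁻¹ := (one_le_inv₀ (by positivity)).2 (pow_le_one₀ hc.le hc1)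
    have hL1 : 1 ≤ L := by linarith
    have g1 : 4 * R * L ^ 2 * (1 / 2) ^ k * (1 + (L ^ 2) ^ 4) ≤ 1 / L := by
      calc 4 * R * L ^ 2 * (1 / 2) ^ k * (1 + (L ^ 2) ^ 4)
          ≤ 4 * R * L ^ 2 * (L ^ 12)⁻¹ * (L ^ 8 + L ^ 8) := by
            gcongr
            · exact one_le_pow₀ hL1
            · rw [← pow_mul]
        _ = 8 * R / L ^ 2 := by field_simp; ring
        _ ≤ L / L ^ 2 := by
            gcongr
            nlinarith
        _ = 1 / L := by field_simp
    have g2 : 4 * R * L ^ 2 * (1 / 2) ^ k * (1 + 4 * (c ^ 2)⁻¹ * p ^ 2) ≤ 1 / L := by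
      have hp2 : (p : ℝ) ^ 2 ≤ L ^ 4 := by
        calc (p : ℝ) ^ 2 ≤ (L ^ 2) ^ 2 := by gcongr
          _ = L ^ 4 := by ring
      calc 4 * R * L ^ 2 * (1 / 2) ^ k * (1 + 4 * (c ^ 2)⁻¹ * p ^ 2)
          ≤ 4 * R * L ^ 2 * (L ^ 12)⁻¹ * ((c ^ 2)⁻¹ * L ^ 4 + 4 * (c ^ 2)⁻¹ * L ^ 4) := by
            gcongr
            exact one_le_mul_of_one_le_of_one_le hci (one_le_pow₀ hL1)
        _ = (20 * R * (c ^ 2)⁻¹) / L ^ 6 := by field_simp; ring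
        _ ≤ L / L ^ 6 := by gcongr
        _ = 1 / L ^ 5 := by field_simp
        _ ≤ 1 / L := by
            apply one_div_le_one_div_of_le hL0
            exact le_self_pow₀ hL1 (by norm_num)
    have : 3 / L = 1 / L + 1 / L + 1 / L := by ring
    linarith

/-- Jensen's inequality over the coordinates. -/
lemma exp_norm_sq_div_le (hp : 0 < p) (x : Vec p) :
    Real.exp (c * ‖x‖ ^ 2 / p) ≤ (p : ℝ)⁻¹ * ∑ j, Real.exp (c * x j ^ 2) := by
  have hp0 : (0 : ℝ) < p := by exact_mod_cast hp
  have h := convexOn_exp.map_sum_le (t := (Finset.univ : Finset (Fin p)))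
    (w := fun _ => (p : ℝ)⁻¹) (p := fun j => c * x j ^ 2) (fun _ _ => by positivity)
    (by simp [hp0.ne']) (fun _ _ => Set.mem_univ _)
  simp only [smul_eq_mul, ← Finset.mul_sum] at h
  refine le_trans (le_of_eq ?_) h
  congr 1
  have : ‖x‖ ^ 2 = ∑ j, x j ^ 2 := by
    rw [← real_inner_self_eq_norm_sq, inner_eq_sum]; simp only [sq]
  rw [this]; ring

lemma measureReal_lt_norm_le (hp : 0 < p) (hν : HasExpSquareMoment ν c) {M : ℝ} (hM : 0 ≤ M)
    (hc : 0 < c) : ν.real {x | M < ‖x‖} ≤ 2 * Real.exp (-(c * M ^ 2 / p)) := by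
  have hp0 : (0 : ℝ) < p := by exact_mod_cast hp
  have h0 : ∀ j : Fin p, Integrable (fun x : Vec p => Real.exp (c * x j ^ 2)) ν := fun j => by
    simpa only [inner_single_one] using hν.integrable _ (norm_single_one j)
  have h1 : ∀ j : Fin p, ∫ x : Vec p, Real.exp (c * x j ^ 2) ∂ν ≤ 2 := fun j => by
    simpa only [inner_single_one] using hν.integral_le _ (norm_single_one j)
  have hi : Integrable (fun x : Vec p => (p : ℝ)⁻¹ * ∑ j, Real.exp (c * x j ^ 2)) ν :=
    (integrable_finsetSum _ fun j _ => h0 j).const_mul _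
  have hI : ∫ x : Vec p, (p : ℝ)⁻¹ * ∑ j, Real.exp (c * x j ^ 2) ∂ν ≤ 2 := by
    rw [integral_const_mul, integral_finsetSum _ fun j _ => h0 j, inv_mul_le_iff₀ hp0]
    refine (Finset.sum_le_sum fun j _ => h1 j).trans ?_
    simp
  have hmk := mul_meas_ge_le_integral_of_nonneg (μ := ν)
    (f := fun x : Vec p => (p : ℝ)⁻¹ * ∑ j, Real.exp (c * x j ^ 2))
    (ae_of_all _ fun x => by positivity) hi (Real.exp (c * M ^ 2 / p))
  have hsub : {x : Vec p | M < ‖x‖} ⊆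
      {x | Real.exp (c * M ^ 2 / p) ≤ (p : ℝ)⁻¹ * ∑ j, Real.exp (c * x j ^ 2)} := by
    intro x hx
    refine le_trans (Real.exp_le_exp.2 ?_) (exp_norm_sq_div_le hp x)
    have : M ≤ ‖x‖ := le_of_lt hx
    gcongr
  refine (measureReal_mono hsub).trans ?_
  rw [Real.exp_neg, ← div_eq_mul_inv, le_div_iff₀ (Real.exp_pos _)]
  linarith

lemma measureReal_exists_lt_norm_le (hp : 0 < p) (hc : 0 < c)
    (hν : HasExpSquareMoment ν c) {Ω : Type*} [MeasurableSpace Ω] {P : Measure Ω}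
    [IsProbabilityMeasure P]
    {x : Fin n → Ω → Vec p} (hx : ∀ i, Measurable (x i))
    (hlaw : ∀ i, P.map (x i) = ν) {L a : ℝ} (ha : 0 < a)
    (hL0 : 0 < L) (hpL : (p : ℝ) ≤ L ^ 2) (hpa : a * (p * Real.log n) ≤ L ^ 2)
    (hlog : 2 ≤ c * a * Real.log n) (hLa : 2 ≤ c * a * L ^ 2) (hn : 0 < n) :
    P.real {ω | ∃ i, L ^ 2 < ‖x i ω‖} ≤ 2 * Real.exp (-p) := by
  have hp0 : (0 : ℝ) < p := by exact_mod_cast hp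
  have hn0 : (0 : ℝ) < n := by exact_mod_cast hn
  have hset : {ω | ∃ i, L ^ 2 < ‖x i ω‖} = ⋃ i, {ω | L ^ 2 < ‖x i ω‖} := by ext; simp
  have hlogn : 0 ≤ Real.log n := by
    by_contra h
    have := mul_pos hc ha
    nlinarith [not_le.1 h]
  rw [hset]
  calc P.real (⋃ i, {ω | L ^ 2 < ‖x i ω‖}) ≤ ∑ i, P.real {ω | L ^ 2 < ‖x i ω‖} :=
        measureReal_iUnion_fintype_le _
    _ ≤ ∑ _i : Fin n, 2 * Real.exp (-(c * (L ^ 2) ^ 2 / p)) := by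
        refine Finset.sum_le_sum fun i _ => ?_
        have h := measureReal_lt_norm_le hp hν (M := L ^ 2) (by positivity) hc
        rw [← hlaw i, map_measureReal_apply (hx i)
          (measurableSet_lt measurable_const measurable_norm)] at h
        exact h
    _ = n * (2 * Real.exp (-(c * (L ^ 2) ^ 2 / p))) := by simp
    _ = 2 * Real.exp (Real.log n + -(c * (L ^ 2) ^ 2 / p)) := by
        rw [Real.exp_add, Real.exp_log hn0]; ring
    _ ≤ 2 * Real.exp (-p) := by
        gcongr
        have h1 : c * (a * Real.log n * L ^ 2) ≤ c * (L ^ 2) ^ 2 / p := by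
          rw [le_div_iff₀ hp0]
          calc c * (a * Real.log n * L ^ 2) * p = c * L ^ 2 * (a * (p * Real.log n)) := by ring
            _ ≤ c * L ^ 2 * L ^ 2 := by gcongr
            _ = _ := by ring
        nlinarith [mul_le_mul_of_nonneg_right hlog (sq_nonneg L),
          mul_le_mul_of_nonneg_right hLa hlogn]

end Uniform

/-! ### The cumulant generating function and its derivatives -/

section Derivatives

lemma hasDerivAt_iteratedDeriv {φ : ℝ → ℝ} (hφ : ContDiff ℝ 5 φ) {k : ℕ} (hk : k < 5) (s : ℝ) :
    HasDerivAt (iteratedDeriv k φ) (iteratedDeriv (k + 1) φ s) s := by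
  have h := (hφ.differentiable_iteratedDeriv k (by exact_mod_cast hk)) s
  rw [iteratedDeriv_succ]
  exact h.hasDerivAt

lemma continuous_iteratedDeriv_of_le {φ : ℝ → ℝ} (hφ : ContDiff ℝ 5 φ) {k : ℕ} (hk : k ≤ 5) :
    Continuous (iteratedDeriv k φ) :=
  hφ.continuous_iteratedDeriv k (by exact_mod_cast hk)

lemma abs_iteratedDeriv_sub_le {φ : ℝ → ℝ} (hφ : ContDiff ℝ 5 φ) {k : ℕ} (hk : k < 5) {B : ℝ}
    (hB : ∀ z, |iteratedDeriv (k + 1) φ z| ≤ B) (s t : ℝ) :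
    |iteratedDeriv k φ s - iteratedDeriv k φ t| ≤ B * |s - t| := by
  have := Convex.norm_image_sub_le_of_norm_hasDerivWithin_le (s := Set.univ) (x := t) (y := s)
    (fun z _ => (hasDerivAt_iteratedDeriv hφ hk z).hasDerivWithinAt)
    (fun z _ => by simpa using hB z) convex_univ trivial trivial
  simpa using this

lemma abs_iteratedDeriv_one_taylor_le {φ : ℝ → ℝ} (hφ : ContDiff ℝ 5 φ) {B : ℝ}
    (hB : ∀ z, |iteratedDeriv 3 φ z| ≤ B) (s t : ℝ) :
    |iteratedDeriv 1 φ s - iteratedDeriv 1 φ t - iteratedDeriv 2 φ s * (s - t)|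
      ≤ B * (s - t) ^ 2 := by
  have hB0 : 0 ≤ B := (abs_nonneg _).trans (hB 0)
  have h := Convex.norm_image_sub_le_of_norm_hasDerivWithin_le (s := Set.uIcc t s) (x := t) (y := s)
    (f := fun r => iteratedDeriv 1 φ r - iteratedDeriv 2 φ s * r)
    (f' := fun r => iteratedDeriv 2 φ r - iteratedDeriv 2 φ s) (C := B * |s - t|)
    (fun z _ => ((hasDerivAt_iteratedDeriv hφ (by norm_num) z).fun_sub (by
      simpa using (hasDerivAt_id' z).const_mul (iteratedDeriv 2 φ s))).hasDerivWithinAt)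
    (fun z hz => by
      refine (abs_iteratedDeriv_sub_le hφ (by norm_num) hB z s).trans ?_
      refine mul_le_mul_of_nonneg_left ?_ hB0
      rw [abs_sub_comm z s, abs_sub_comm s t]
      have := Set.abs_sub_le_of_uIcc_subset_uIcc (Set.uIcc_subset_uIcc hz Set.right_mem_uIcc)
      rwa [abs_sub_comm t s, abs_sub_comm s z, abs_sub_comm z s, abs_sub_comm s t] at *)
    (convex_uIcc t s) Set.left_mem_uIcc Set.right_mem_uIcc
  simp only [Real.norm_eq_abs] at h
  calc _ = |iteratedDeriv 1 φ s - iteratedDeriv 2 φ s * s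
        - (iteratedDeriv 1 φ t - iteratedDeriv 2 φ s * t)| := by congr 1; ring
    _ ≤ B * |s - t| * |s - t| := h
    _ = _ := by rw [mul_assoc, ← sq, sq_abs]

variable {p n : ℕ}

lemma hasGradientAt_negLogLik {φ : ℝ → ℝ} (hφ : ContDiff ℝ 5 φ) (x : Fin n → Vec p)
    (y : Fin n → ℝ) (b : Vec p) :
    HasGradientAt (negLogLik φ x y)
      ((n : ℝ)⁻¹ • ∑ i, (iteratedDeriv 1 φ ⟪x i, b⟫ - y i) • x i) b := by
  rw [hasGradientAt_iff_hasFDerivAt]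
  have h1 : ∀ i, HasFDerivAt (fun b : Vec p => φ ⟪x i, b⟫ - y i * ⟪x i, b⟫)
      ((iteratedDeriv 1 φ ⟪x i, b⟫) • innerSL ℝ (x i) - y i • innerSL ℝ (x i)) b := by
    intro i
    have hl : HasFDerivAt (fun b : Vec p => ⟪x i, b⟫) (innerSL ℝ (x i)) b :=
      (innerSL ℝ (x i)).hasFDerivAt
    have hd : HasDerivAt φ (iteratedDeriv 1 φ ⟪x i, b⟫) ⟪x i, b⟫ := by
      simpa using hasDerivAt_iteratedDeriv hφ (k := 0) (by norm_num) ⟪x i, b⟫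
    exact (hd.comp_hasFDerivAt b hl).sub (hl.const_mul (y i))
  have h2 := (HasFDerivAt.fun_sum (u := Finset.univ) fun i _ => h1 i).const_mul (n : ℝ)⁻¹
  refine h2.congr_fderiv ?_
  ext w
  simp [sub_smul]

lemma gradient_negLogLik {φ : ℝ → ℝ} (hφ : ContDiff ℝ 5 φ) (x : Fin n → Vec p)
    (y : Fin n → ℝ) (b : Vec p) :
    gradient (negLogLik φ x y) b
      = (n : ℝ)⁻¹ • ∑ i, (iteratedDeriv 1 φ ⟪x i, b⟫ - y i) • x i :=
  (hasGradientAt_negLogLik hφ x y b).gradient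

lemma gradient_eq_zero_of_isMinOn {f : Vec p → ℝ} {b : Vec p} (h : IsMinOn f Set.univ b) :
    gradient f b = 0 := by
  have : IsLocalMin f b := h.isLocalMin Filter.univ_mem
  rw [gradient, this.fderiv_eq_zero, map_zero]

end Derivatives

/-! ### The population Hessian and the distance to the Gaussian -/

section Discrepancy

variable {p : ℕ}

lemma classDist_nonneg (H : Set (Vec p → ℝ)) (ν γ : Measure (Vec p)) : 0 ≤ classDist H ν γ :=
  Real.sSup_nonneg (by rintro _ ⟨h, -, rfl⟩; exact abs_nonneg _)

lemma le_classDist {H : Set (Vec p → ℝ)} {ν γ : Measure (Vec p)} {C : ℝ}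
    (hν : ∀ h ∈ H, |∫ x, h x ∂ν| ≤ C) (hγ : ∀ h ∈ H, |∫ x, h x ∂γ| ≤ C) {h : Vec p → ℝ}
    (hh : h ∈ H) : |∫ x, h x ∂ν - ∫ x, h x ∂γ| ≤ classDist H ν γ := by
  refine le_csSup ⟨C + C, ?_⟩ ⟨h, hh, rfl⟩
  rintro _ ⟨h, hh, rfl⟩
  exact (abs_sub _ _).trans (add_le_add (hν h hh) (hγ h hh))

lemma gaussDiscrepancy_nonneg (φ : ℝ → ℝ) (R : ℝ) (ν : Measure (Vec p))
    (Sig : Matrix (Fin p) (Fin p) ℝ) : 0 ≤ gaussDiscrepancy φ R ν Sig := by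
  have h0 : 0 ≤ specNorm Sig := norm_nonneg _
  have h1 := classDist_nonneg (classH1 p φ R) ν (multivariateGaussian 0 Sig)
  have h2 := classDist_nonneg (classH2 p φ R) ν (multivariateGaussian 0 Sig)
  have h3 := classDist_nonneg (classH3 p φ R) ν (multivariateGaussian 0 Sig)
  unfold gaussDiscrepancy
  positivity

lemma abs_integral_le_of_abs_le {α : Type*} [MeasurableSpace α] {μ : Measure α}
    [IsProbabilityMeasure μ] {f : α → ℝ} {B : ℝ} (hB : ∀ x, |f x| ≤ B) : |∫ x, f x ∂μ| ≤ B := by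
  have h := norm_integral_le_of_norm_le_const (μ := μ) (f := f) (C := B) (ae_of_all _ hB)
  simpa using h

lemma abs_integral_mul_le {α : Type*} [MeasurableSpace α] {μ : Measure α} {g f : α → ℝ}
    (hg : Integrable g μ) (hg0 : ∀ x, 0 ≤ g x) {B : ℝ} (hB : ∀ x, |f x| ≤ B) {C : ℝ}
    (hB0 : 0 ≤ B) (hC : ∫ x, g x ∂μ ≤ C) : |∫ x, g x * f x ∂μ| ≤ C * B := by
  rw [← Real.norm_eq_abs]
  refine (norm_integral_le_of_norm_le (f := fun x => g x * f x) (hg.mul_const B)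
    (ae_of_all _ fun x => ?_)).trans ?_
  · rw [norm_mul, Real.norm_of_nonneg (hg0 x)]
    exact mul_le_mul_of_nonneg_left (hB x) (hg0 x)
  · rw [integral_mul_const]
    exact mul_le_mul_of_nonneg_right hC hB0

lemma abs_inner_act_self_le (A : Matrix (Fin p) (Fin p) ℝ) {v : Vec p} (hv : ‖v‖ = 1) :
    |⟪act A v, v⟫| ≤ specNorm A := by
  refine (abs_real_inner_le_norm _ _).trans ?_
  have := norm_act_le A v
  rw [hv, mul_one] at *
  exact this

/-- The population Hessian `E[φ''(⟨x, b⟩) x xᵀ]` differs from its Gaussian expression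
`μ₂ Σ + μ₄ Σ b bᵀ Σ` by at most `𝔇`: for `z ∼ N(0, Σ)` the two agree by Stein's identity, and the
three classes of test functions pay for replacing `z` by `x`. -/
lemma abs_integral_sub_le_gaussDiscrepancy {φ : ℝ → ℝ} (hφ : ContDiff ℝ 5 φ) {B₂ B₃ B₄ : ℝ}
    (h₂ : ∀ z, |iteratedDeriv 2 φ z| ≤ B₂) (h₃ : ∀ z, |iteratedDeriv 3 φ z| ≤ B₃)
    (h₄ : ∀ z, |iteratedDeriv 4 φ z| ≤ B₄) {ν : Measure (Vec p)} [IsProbabilityMeasure ν] {c : ℝ}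
    (hc : 0 < c) (hν : HasExpSquareMoment ν c) {Sig : Matrix (Fin p) (Fin p) ℝ}
    (hPSD : Sig.PosSemidef) (hpos : ∀ b : Vec p, b = 0 ∨ 0 < ⟪b, act Sig b⟫)
    (hS : ∀ i j, ∫ x : Vec p, x i * x j ∂ν = Sig i j) {R : ℝ} {b v : Vec p}
    (hb : ‖b‖ ≤ R) (hv : ‖v‖ = 1) :
    |∫ x, ⟪v, x⟫ ^ 2 * iteratedDeriv 2 φ ⟪x, b⟫ ∂ν
      - (popMean φ ν 2 b * ⟪act Sig v, v⟫ + popMean φ ν 4 b * ⟪act Sig b, v⟫ ^ 2)|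
      ≤ gaussDiscrepancy φ R ν Sig := by
  set γ := multivariateGaussian 0 Sig with hγ
  have hB2 : 0 ≤ B₂ := (abs_nonneg _).trans (h₂ 0)
  have d1 : |∫ x, iteratedDeriv 2 φ ⟪x, b⟫ ∂ν - ∫ x, iteratedDeriv 2 φ ⟪x, b⟫ ∂γ|
      ≤ classDist (classH1 p φ R) ν γ := by
    refine le_classDist (C := B₂) ?_ ?_ ⟨b, hb, rfl⟩
    · rintro _ ⟨b, -, rfl⟩; exact abs_integral_le_of_abs_le fun x => h₂ _
    · rintro _ ⟨b, -, rfl⟩; exact abs_integral_le_of_abs_le fun x => h₂ _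
  have d2 : |∫ x, iteratedDeriv 4 φ ⟪x, b⟫ ∂ν - ∫ x, iteratedDeriv 4 φ ⟪x, b⟫ ∂γ|
      ≤ classDist (classH2 p φ R) ν γ := by
    refine le_classDist (C := B₄) ?_ ?_ ⟨b, hb, rfl⟩
    · rintro _ ⟨b, -, rfl⟩; exact abs_integral_le_of_abs_le fun x => h₄ _
    · rintro _ ⟨b, -, rfl⟩; exact abs_integral_le_of_abs_le fun x => h₄ _
  have d3 : |∫ x, ⟪v, x⟫ ^ 2 * iteratedDeriv 2 φ ⟪x, b⟫ ∂ν
      - ∫ x, ⟪v, x⟫ ^ 2 * iteratedDeriv 2 φ ⟪x, b⟫ ∂γ| ≤ classDist (classH3 p φ R) ν γ := by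
    refine le_classDist (C := specNorm Sig * B₂) ?_ ?_ ⟨b, v, hb, hv, rfl⟩
    · rintro _ ⟨b, v, -, hv, rfl⟩
      refine abs_integral_mul_le ?_ (fun x => sq_nonneg _) (fun x => h₂ _) hB2 ?_
      · simpa only [real_inner_comm] using hν.integrable_sq hc hv.le
      · have h := hν.integral_inner_mul_inner hc hS v v
        simp only [← sq] at h
        simp only [real_inner_comm _ v]
        rw [h]
        exact (le_abs_self _).trans (abs_inner_act_self_le Sig hv)
    · rintro _ ⟨b, v, -, hv, rfl⟩
      refine abs_integral_mul_le (memLp_inner_multivariateGaussian Sig v).integrable_sq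
        (fun x => sq_nonneg _) (fun x => h₂ _) hB2 ?_
      have h := integral_inner_mul_inner_multivariateGaussian hPSD v v
      simp only [← sq] at h
      rw [h, real_inner_comm]
      exact (le_abs_self _).trans (abs_inner_act_self_le Sig hv)
  have stein := integral_sq_inner_mul_multivariateGaussian hPSD
    (hasDerivAt_iteratedDeriv hφ (k := 2) (by norm_num))
    (hasDerivAt_iteratedDeriv hφ (k := 3) (by norm_num))
    (continuous_iteratedDeriv_of_le hφ (k := 4) (by norm_num)).measurable h₂ h₃ h₄ v b (hpos b)
  rw [← hγ] at stein
  have s1 : |⟪act Sig v, v⟫| ≤ specNorm Sig := abs_inner_act_self_le Sig hv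
  have s2 : ⟪act Sig b, v⟫ ^ 2 ≤ specNorm Sig ^ 2 * R ^ 2 := by
    rw [← mul_pow]
    have h0 : 0 ≤ specNorm Sig := norm_nonneg _
    have : |⟪act Sig b, v⟫| ≤ specNorm Sig * R := by
      refine (abs_real_inner_le_norm _ _).trans ?_
      rw [hv, mul_one]
      exact (norm_act_le Sig b).trans (by gcongr)
    exact sq_le_sq' (by linarith [(abs_le.1 this).1]) (abs_le.1 this).2
  have e1 : ⟪v, act Sig v⟫ = ⟪act Sig v, v⟫ := real_inner_comm _ _
  have e2 : ⟪v, act Sig b⟫ = ⟪act Sig b, v⟫ := real_inner_comm _ _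
  rw [e1, e2] at stein
  -- the expression vanishes when `ν` is replaced by the Gaussian law
  have key : ∫ x, ⟪v, x⟫ ^ 2 * iteratedDeriv 2 φ ⟪x, b⟫ ∂ν
      - (popMean φ ν 2 b * ⟪act Sig v, v⟫ + popMean φ ν 4 b * ⟪act Sig b, v⟫ ^ 2)
      = (∫ x, ⟪v, x⟫ ^ 2 * iteratedDeriv 2 φ ⟪x, b⟫ ∂ν
        - ∫ x, ⟪v, x⟫ ^ 2 * iteratedDeriv 2 φ ⟪x, b⟫ ∂γ)
      - ⟪act Sig v, v⟫ * (∫ x, iteratedDeriv 2 φ ⟪x, b⟫ ∂ν - ∫ x, iteratedDeriv 2 φ ⟪x, b⟫ ∂γ)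
      - ⟪act Sig b, v⟫ ^ 2
        * (∫ x, iteratedDeriv 4 φ ⟪x, b⟫ ∂ν - ∫ x, iteratedDeriv 4 φ ⟪x, b⟫ ∂γ) := by
    rw [stein, popMean, popMean]; ring
  rw [key]
  have t1 : |⟪act Sig v, v⟫ * (∫ x, iteratedDeriv 2 φ ⟪x, b⟫ ∂ν
      - ∫ x, iteratedDeriv 2 φ ⟪x, b⟫ ∂γ)| ≤ specNorm Sig * classDist (classH1 p φ R) ν γ := by
    rw [abs_mul]
    exact mul_le_mul s1 d1 (abs_nonneg _) (norm_nonneg _)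
  have t2 : |⟪act Sig b, v⟫ ^ 2 * (∫ x, iteratedDeriv 4 φ ⟪x, b⟫ ∂ν
      - ∫ x, iteratedDeriv 4 φ ⟪x, b⟫ ∂γ)|
      ≤ specNorm Sig ^ 2 * R ^ 2 * classDist (classH2 p φ R) ν γ := by
    rw [abs_mul, abs_of_nonneg (sq_nonneg _)]
    exact mul_le_mul s2 d2 (abs_nonneg _) (by positivity)
  unfold gaussDiscrepancy
  have a1 := abs_le.1 d3
  have a2 := abs_le.1 t1
  have a3 := abs_le.1 t2
  rw [abs_le]
  constructor <;> linarith [a1.1, a1.2, a2.1, a2.2, a3.1, a3.2]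

end Discrepancy

/-! ### One Newton step -/

section Newton

variable {p n : ℕ}

/-- The Sherman–Morrison identity: the scaling matrix inverts `m₂ Z + m₄ Z b (Z b)ᵀ`. -/
lemma act_shermanMorrison {Z : Matrix (Fin p) (Fin p) ℝ} (hZ : Z.IsHermitian)
    (hinv : ∀ w, act Z⁻¹ (act Z w) = w) {m₂ m₄ : ℝ} {b : Vec p} (h2 : m₂ ≠ 0)
    (hden : m₂ + m₄ * ⟪act Z b, b⟫ ≠ 0) (w : Vec p) :
    act (m₂⁻¹ • (Z⁻¹ - (m₄ / (m₂ + m₄ * ⟪act Z b, b⟫)) • outer b))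
      (m₂ • act Z w + (m₄ * ⟪act Z b, w⟫) • act Z b) = w := by
  have e1 : ∀ u : Vec p, ⟪b, act Z u⟫ = ⟪act Z b, u⟫ := fun u => (inner_act_comm hZ b u).symm
  simp only [act_smul_left, act_sub_left, act_add_right, act_smul_right, act_outer, hinv, e1,
    smul_sub, smul_smul]
  set g := ⟪act Z b, b⟫
  set h := ⟪act Z b, w⟫
  have e2 : m₂ * m₂⁻¹ = 1 := mul_inv_cancel₀ h2
  rw [e2, one_smul, ← sub_smul, sub_add, ← sub_smul, sub_eq_self]
  convert zero_smul ℝ b using 2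
  field_simp
  ring

lemma norm_act_shermanMorrison_le {Z : Matrix (Fin p) (Fin p) ℝ} {c : ℝ}
    (hZ : ∀ w, ‖act Z⁻¹ w‖ ≤ c * ‖w‖) {m₂ m₄ a m ξ B R : ℝ} (hm : 0 < m) (hξ : 0 < ξ)
    (h2 : m ≤ m₂) (h4 : |m₄| ≤ B) (hden : ξ ≤ |a|) {b : Vec p} (hb : ‖b‖ ≤ R)
    (w : Vec p) :
    ‖act (m₂⁻¹ • (Z⁻¹ - (m₄ / a) • outer b)) w‖ ≤ m⁻¹ * (c + B / ξ * R ^ 2) * ‖w‖ := by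
  have hB : 0 ≤ B := (abs_nonneg _).trans h4
  have hm2 : 0 < m₂ := hm.trans_le h2
  rw [act_smul_left, act_sub_left, act_smul_left, act_outer, norm_smul,
    Real.norm_of_nonneg (by positivity), mul_assoc]
  have h1 : ‖(m₄ / a) • ⟪b, w⟫ • b‖ ≤ B / ξ * R ^ 2 * ‖w‖ := by
    rw [norm_smul, norm_smul, Real.norm_eq_abs, abs_div]
    have h3 : |m₄| / |a| ≤ B / ξ := div_le_div₀ hB h4 hξ hden
    have h5 : ‖⟪b, w⟫‖ * ‖b‖ ≤ (R * ‖w‖) * R := by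
      have := norm_inner_le_norm (𝕜 := ℝ) b w
      have hR : 0 ≤ R := (norm_nonneg _).trans hb
      gcongr
      exact this.trans (by gcongr)
    calc |m₄| / |a| * (‖⟪b, w⟫‖ * ‖b‖) ≤ B / ξ * ((R * ‖w‖) * R) := by gcongr
      _ = _ := by ring
  have h6 : ‖act Z⁻¹ w - (m₄ / a) • ⟪b, w⟫ • b‖ ≤ (c + B / ξ * R ^ 2) * ‖w‖ := by
    refine (norm_sub_le _ _).trans ?_
    rw [add_mul]
    exact add_le_add (hZ w) h1
  have h7 : m₂⁻¹ ≤ m⁻¹ := inv_anti₀ hm h2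
  exact mul_le_mul h7 h6 (norm_nonneg _) (by positivity)

/-- Perturbation of the matrix `μ₂ Σ + μ₄ Σ b bᵀ Σ` under changes of its three ingredients. -/
lemma norm_rankOneUpdate_sub_le {Z Sig : Matrix (Fin p) (Fin p) ℝ} {s e₁ e₂ B₂ B₄ R : ℝ}
    (hZ : ∀ w, ‖act Z w‖ ≤ s * ‖w‖) (hSig : ∀ w, ‖act Sig w‖ ≤ s * ‖w‖)
    (hd : ∀ w, ‖act Z w - act Sig w‖ ≤ e₁ * ‖w‖) {m₂ m₄ μ₂ μ₄ : ℝ}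
    (hm2 : |m₂ - μ₂| ≤ e₂) (hm4 : |m₄ - μ₄| ≤ e₂) (h2 : |μ₂| ≤ B₂) (h4 : |μ₄| ≤ B₄)
    (hs : 0 ≤ s) (he₁ : 0 ≤ e₁) {b : Vec p} (hb : ‖b‖ ≤ R) (w : Vec p) :
    ‖(m₂ • act Z w + (m₄ * ⟪act Z b, w⟫) • act Z b)
        - (μ₂ • act Sig w + (μ₄ * ⟪act Sig b, w⟫) • act Sig b)‖
      ≤ ((s + s ^ 2 * R ^ 2) * e₂ + (B₂ + 2 * s * R ^ 2 * B₄) * e₁) * ‖w‖ := by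
  have hR : 0 ≤ R := (norm_nonneg _).trans hb
  have he₂ : 0 ≤ e₂ := (abs_nonneg _).trans hm2
  have hB₄ : 0 ≤ B₄ := (abs_nonneg _).trans h4
  have hB₂ : 0 ≤ B₂ := (abs_nonneg _).trans h2
  have hZb : ‖act Z b‖ ≤ s * R := (hZ b).trans (by gcongr)
  have hSb : ‖act Sig b‖ ≤ s * R := (hSig b).trans (by gcongr)
  have hdb : ‖act Z b - act Sig b‖ ≤ e₁ * R := (hd b).trans (by gcongr)
  have e : (m₂ • act Z w + (m₄ * ⟪act Z b, w⟫) • act Z b)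
      - (μ₂ • act Sig w + (μ₄ * ⟪act Sig b, w⟫) • act Sig b)
      = (m₂ - μ₂) • act Z w + μ₂ • (act Z w - act Sig w)
        + ((m₄ - μ₄) * ⟪act Z b, w⟫) • act Z b
        + (μ₄ * ⟪act Z b - act Sig b, w⟫) • act Z b
        + (μ₄ * ⟪act Sig b, w⟫) • (act Z b - act Sig b) := by
    rw [inner_sub_left]; module
  have n1 : ‖(m₂ - μ₂) • act Z w‖ ≤ e₂ * (s * ‖w‖) := by
    rw [norm_smul]; exact mul_le_mul hm2 (hZ w) (norm_nonneg _) he₂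
  have n2 : ‖μ₂ • (act Z w - act Sig w)‖ ≤ B₂ * (e₁ * ‖w‖) := by
    rw [norm_smul]; exact mul_le_mul h2 (hd w) (norm_nonneg _) hB₂
  have n3 : ‖((m₄ - μ₄) * ⟪act Z b, w⟫) • act Z b‖ ≤ e₂ * (s * R * ‖w‖) * (s * R) := by
    rw [norm_smul, norm_mul, Real.norm_eq_abs]
    have := norm_inner_le_norm (𝕜 := ℝ) (act Z b) w
    gcongr
    exact this.trans (by gcongr)
  have n4 : ‖(μ₄ * ⟪act Z b - act Sig b, w⟫) • act Z b‖ ≤ B₄ * (e₁ * R * ‖w‖) * (s * R) := by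
    rw [norm_smul, norm_mul, Real.norm_eq_abs]
    have := norm_inner_le_norm (𝕜 := ℝ) (act Z b - act Sig b) w
    gcongr
    exact this.trans (by gcongr)
  have n5 : ‖(μ₄ * ⟪act Sig b, w⟫) • (act Z b - act Sig b)‖
      ≤ B₄ * (s * R * ‖w‖) * (e₁ * R) := by
    rw [norm_smul, norm_mul, Real.norm_eq_abs]
    have := norm_inner_le_norm (𝕜 := ℝ) (act Sig b) w
    gcongr
    exact this.trans (by gcongr)
  rw [e]
  refine (norm_add_le _ _).trans ?_
  refine (add_le_add_left ((norm_add_le _ _).trans (add_le_add_left ((norm_add_le _ _).trans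
    (add_le_add_left (norm_add_le _ _) _)) _)) _).trans ?_
  linarith

lemma abs_denominator_sub_le {Z Sig : Matrix (Fin p) (Fin p) ℝ} {s e₁ e₂ B₄ R : ℝ}
    (hZ : ∀ w, ‖act Z w‖ ≤ s * ‖w‖)
    (hd : ∀ w, ‖act Z w - act Sig w‖ ≤ e₁ * ‖w‖) {m₂ m₄ μ₂ μ₄ : ℝ}
    (hm2 : |m₂ - μ₂| ≤ e₂) (hm4 : |m₄ - μ₄| ≤ e₂) (h4 : |μ₄| ≤ B₄)
    (hs : 0 ≤ s) (he₁ : 0 ≤ e₁) {b : Vec p} (hb : ‖b‖ ≤ R) :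
    |(m₂ + m₄ * ⟪act Z b, b⟫) - (μ₂ + μ₄ * ⟪act Sig b, b⟫)|
      ≤ (1 + s * R ^ 2) * e₂ + B₄ * R ^ 2 * e₁ := by
  have hR : 0 ≤ R := (norm_nonneg _).trans hb
  have he₂ : 0 ≤ e₂ := (abs_nonneg _).trans hm2
  have hB₄ : 0 ≤ B₄ := (abs_nonneg _).trans h4
  have e : (m₂ + m₄ * ⟪act Z b, b⟫) - (μ₂ + μ₄ * ⟪act Sig b, b⟫)
      = (m₂ - μ₂) + (m₄ - μ₄) * ⟪act Z b, b⟫ + μ₄ * ⟪act Z b - act Sig b, b⟫ := by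
    rw [inner_sub_left]; ring
  have i1 : |⟪act Z b, b⟫| ≤ s * R * R :=
    (abs_real_inner_le_norm _ _).trans (mul_le_mul ((hZ b).trans (by gcongr)) hb (norm_nonneg _)
      (by positivity))
  have i2 : |⟪act Z b - act Sig b, b⟫| ≤ e₁ * R * R :=
    (abs_real_inner_le_norm _ _).trans (mul_le_mul ((hd b).trans (by gcongr)) hb (norm_nonneg _)
      (by positivity))
  have a1 : |(m₄ - μ₄) * ⟪act Z b, b⟫| ≤ e₂ * (s * R * R) := by
    rw [abs_mul]; exact mul_le_mul hm4 i1 (abs_nonneg _) he₂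
  have a2 : |μ₄ * ⟪act Z b - act Sig b, b⟫| ≤ B₄ * (e₁ * R * R) := by
    rw [abs_mul]; exact mul_le_mul h4 i2 (abs_nonneg _) hB₄
  rw [e]
  refine (abs_add_le _ _).trans ((add_le_add_left (abs_add_le _ _) _).trans ?_)
  linarith

/-- The empirical Hessian `(1/n) ∑ᵢ φ''(⟨zᵢ, b⟩) zᵢ zᵢᵀ` applied to `w`. -/
noncomputable def empHess (φ : ℝ → ℝ) (z : Fin n → Vec p) (b w : Vec p) : Vec p :=
  (n : ℝ)⁻¹ • ∑ i, (iteratedDeriv 2 φ ⟪z i, b⟫ * ⟪z i, w⟫) • z i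

lemma inner_empHess (φ : ℝ → ℝ) (z : Fin n → Vec p) (b v w : Vec p) :
    ⟪empHess φ z b v, w⟫
      = (n : ℝ)⁻¹ * ∑ i, iteratedDeriv 2 φ ⟪z i, b⟫ * (⟪z i, v⟫ * ⟪z i, w⟫) := by
  rw [empHess, real_inner_smul_left, sum_inner]
  congr 1
  exact Finset.sum_congr rfl fun i _ => by rw [real_inner_smul_left]; ring

/-- The empirical Hessian is as close to `μ₂ Σ + μ₄ Σ b bᵀ Σ` as its quadratic form is on unit
vectors. -/
lemma norm_rankOneUpdate_sub_empHess_le {φ : ℝ → ℝ} {z : Fin n → Vec p} {b : Vec p}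
    {Sig : Matrix (Fin p) (Fin p) ℝ} (hSig : Sig.IsHermitian) {μ₂ μ₄ e : ℝ} (he : 0 ≤ e)
    (h : ∀ v : Vec p, ‖v‖ = 1 →
      |(n : ℝ)⁻¹ * ∑ i, iteratedDeriv 2 φ ⟪z i, b⟫ * ⟪z i, v⟫ ^ 2
        - (μ₂ * ⟪act Sig v, v⟫ + μ₄ * ⟪act Sig b, v⟫ ^ 2)| ≤ e) (w : Vec p) :
    ‖(μ₂ • act Sig w + (μ₄ * ⟪act Sig b, w⟫) • act Sig b) - empHess φ z b w‖ ≤ e * ‖w‖ := by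
  let T : Vec p → Vec p := fun w =>
    (μ₂ • act Sig w + (μ₄ * ⟪act Sig b, w⟫) • act Sig b) - empHess φ z b w
  have hin : ∀ v w, ⟪T v, w⟫ = μ₂ * ⟪act Sig v, w⟫ + μ₄ * ⟪act Sig b, v⟫ * ⟪act Sig b, w⟫
      - (n : ℝ)⁻¹ * ∑ i, iteratedDeriv 2 φ ⟪z i, b⟫ * (⟪z i, v⟫ * ⟪z i, w⟫) := fun v w => by
    simp only [T]
    rw [inner_sub_left, inner_add_left, real_inner_smul_left, real_inner_smul_left, inner_empHess]
  have hadd : ∀ v w, T (v + w) = T v + T w := fun v w => by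
    refine ext_inner_right ℝ fun u => ?_
    rw [inner_add_left, hin, hin, hin]
    simp only [act_add_right, inner_add_left, inner_add_right, add_mul, mul_add,
      Finset.sum_add_distrib]
    ring
  have hsmul : ∀ (a : ℝ) v, T (a • v) = a • T v := fun a v => by
    refine ext_inner_right ℝ fun u => ?_
    rw [real_inner_smul_left, hin, hin]
    simp only [act_smul_right, real_inner_smul_left, inner_smul_right, mul_sub, mul_add,
      Finset.mul_sum]
    congr 1
    · ring
    · exact Finset.sum_congr rfl fun i _ => by ring
  have hsub : ∀ v w, T (v - w) = T v - T w := fun v w => by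
    have : v - w = v + (-1 : ℝ) • w := by module
    rw [this, hadd, hsmul]; module
  have hsymm : ∀ v w, ⟪T v, w⟫ = ⟪v, T w⟫ := fun v w => by
    rw [real_inner_comm (T w) v, hin, hin, inner_act_comm hSig v w, real_inner_comm (act Sig w) v]
    congr 1
    · ring
    · congr 1
      exact Finset.sum_congr rfl fun i _ => by ring
  refine norm_le_of_quadratic_le T hadd hsub hsmul hsymm he (fun v => ?_) w
  by_cases hv : v = 0
  · simp [hv]
  have hn : ‖v‖ ≠ 0 := norm_ne_zero_iff.2 hv
  have h1 : ‖‖v‖⁻¹ • v‖ = 1 := by rw [norm_smul, norm_inv, norm_norm, inv_mul_cancel₀ hn]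
  have h2 := h _ h1
  have h3 : |⟪T (‖v‖⁻¹ • v), ‖v‖⁻¹ • v⟫| ≤ e := by
    rw [hin, abs_sub_comm]
    simpa only [← sq, mul_assoc] using h2
  rw [hsmul, real_inner_smul_left, inner_smul_right, ← mul_assoc, abs_mul, ← sq,
    abs_of_nonneg (by positivity), inv_pow, inv_mul_le_iff₀ (by positivity)] at h3
  linarith

/-- The remainder of the first-order expansion of the gradient between two points is quadratic in
their distance. -/
lemma norm_gradient_sub_empHess_le {φ : ℝ → ℝ} (hφ : ContDiff ℝ 5 φ) {B₃ C₃ : ℝ}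
    (h₃ : ∀ z, |iteratedDeriv 3 φ z| ≤ B₃) {z : Fin n → Vec p} {y : Fin n → ℝ}
    (hC : ∀ u v : Vec p, ‖u‖ ≤ 1 → ‖v‖ ≤ 1 →
      (n : ℝ)⁻¹ * ∑ i, |⟪z i, u⟫| * ⟪z i, v⟫ ^ 2 ≤ C₃) (hC0 : 0 ≤ C₃) {b bs : Vec p}
    (hbs : gradient (negLogLik φ z y) bs = 0) :
    ‖gradient (negLogLik φ z y) b - empHess φ z b (b - bs)‖ ≤ B₃ * C₃ * ‖b - bs‖ ^ 2 := by
  have hB : 0 ≤ B₃ := (abs_nonneg _).trans (h₃ 0)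
  set d := b - bs with hd
  have e0 : gradient (negLogLik φ z y) b - empHess φ z b d
      = (gradient (negLogLik φ z y) b - gradient (negLogLik φ z y) bs) - empHess φ z b d := by
    rw [hbs, sub_zero]
  rw [e0]
  refine norm_le_of_forall_inner_le (by positivity) fun u hu => ?_
  have e1 : ⟪(gradient (negLogLik φ z y) b - gradient (negLogLik φ z y) bs) - empHess φ z b d, u⟫
      = (n : ℝ)⁻¹ * ∑ i, (iteratedDeriv 1 φ ⟪z i, b⟫ - iteratedDeriv 1 φ ⟪z i, bs⟫
        - iteratedDeriv 2 φ ⟪z i, b⟫ * (⟪z i, b⟫ - ⟪z i, bs⟫)) * ⟪z i, u⟫ := by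
    rw [inner_sub_left, inner_empHess, gradient_negLogLik hφ, gradient_negLogLik hφ, ← smul_sub,
      real_inner_smul_left, ← Finset.sum_sub_distrib, sum_inner, ← mul_sub,
      ← Finset.sum_sub_distrib]
    congr 1
    refine Finset.sum_congr rfl fun i _ => ?_
    rw [inner_sub_left, real_inner_smul_left, real_inner_smul_left, hd, inner_sub_right]
    ring
  rw [e1, abs_mul, abs_of_nonneg (by positivity)]
  have e2 : |∑ i, (iteratedDeriv 1 φ ⟪z i, b⟫ - iteratedDeriv 1 φ ⟪z i, bs⟫
        - iteratedDeriv 2 φ ⟪z i, b⟫ * (⟪z i, b⟫ - ⟪z i, bs⟫)) * ⟪z i, u⟫|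
      ≤ ∑ i, B₃ * (⟪z i, d⟫ ^ 2 * |⟪z i, u⟫|) := by
    refine (Finset.abs_sum_le_sum_abs _ _).trans (Finset.sum_le_sum fun i _ => ?_)
    rw [abs_mul, ← mul_assoc]
    refine mul_le_mul_of_nonneg_right ?_ (abs_nonneg _)
    rw [hd, inner_sub_right]
    exact abs_iteratedDeriv_one_taylor_le hφ h₃ _ _
  by_cases hd0 : d = 0
  · refine (mul_le_mul_of_nonneg_left e2 (by positivity)).trans ?_
    simp [hd0]
  have hn : ‖d‖ ≠ 0 := norm_ne_zero_iff.2 hd0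
  have h1 : ‖‖d‖⁻¹ • d‖ = 1 := by rw [norm_smul, norm_inv, norm_norm, inv_mul_cancel₀ hn]
  have h2 := hC u (‖d‖⁻¹ • d) hu.le h1.le
  calc _ ≤ (n : ℝ)⁻¹ * ∑ i, B₃ * (⟪z i, d⟫ ^ 2 * |⟪z i, u⟫|) := by gcongr
    _ = B₃ * ‖d‖ ^ 2 * ((n : ℝ)⁻¹ * ∑ i, |⟪z i, u⟫| * ⟪z i, ‖d‖⁻¹ • d⟫ ^ 2) := by
        have h3 : ∑ i, B₃ * (⟪z i, d⟫ ^ 2 * |⟪z i, u⟫|)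
            = B₃ * ‖d‖ ^ 2 * ∑ i, |⟪z i, u⟫| * ⟪z i, ‖d‖⁻¹ • d⟫ ^ 2 := by
          rw [Finset.mul_sum]
          refine Finset.sum_congr rfl fun i _ => ?_
          rw [inner_smul_right]
          field_simp
        rw [h3]; ring
    _ ≤ B₃ * ‖d‖ ^ 2 * C₃ := by gcongr
    _ = _ := by ring

end Newton

section Step

variable {p n : ℕ}

/-- One step of the algorithm from `b`, for data on which the sub-sampled covariance, the sample
means of `φ''` and `φ''''`, the empirical Hessian at `b` and the empirical third moments are
controlled. -/
lemma norm_newton_step_le {φ : ℝ → ℝ} (hφ : ContDiff ℝ 5 φ) {B₂ B₃ B₄ : ℝ}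
    (h₃ : ∀ z, |iteratedDeriv 3 φ z| ≤ B₃) (h₄ : ∀ z, |iteratedDeriv 4 φ z| ≤ B₄)
    (hn : 0 < n) {z : Fin n → Vec p} {y : Fin n → ℝ} {T : Finset (Fin n)} {r : ℕ} (hr : r < p)
    {σ : ℝ} (hσ : 0 < σ) {θ : Fin r → ℝ} (hθ : ∀ i, 0 ≤ θ i) {u : Fin r → Vec p}
    (hu : Orthonormal ℝ u) {R : ℝ} (hR : 0 ≤ R) {b bs : Vec p} (hb : ‖b‖ ≤ R) (hbs : ‖bs‖ ≤ R)
    (hmin : gradient (negLogLik φ z y) bs = 0) {m ξ e e₂ D C₃ μ₂ μ₄ s : ℝ} (hm : 0 < m)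
    (hξ : 0 < ξ) (hs : s = σ ^ 2 + ∑ i, θ i + 1)
    (hcov : ∀ w, ‖act (subCov z T) w - act (spikedCov σ θ u) w‖ ≤ e * ‖w‖) (he : 0 ≤ e)
    (hm2 : |sampleMean φ z 2 b - μ₂| ≤ e₂) (hm4 : |sampleMean φ z 4 b - μ₄| ≤ e₂)
    (hμ2 : |μ₂| ≤ B₂) (hμ4 : |μ₄| ≤ B₄) (hmμ : m ≤ μ₂)
    (hξμ : ξ < |μ₂ + μ₄ * ⟪act (spikedCov σ θ u) b, b⟫|) (hD : 0 ≤ D)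
    (hH : ∀ v : Vec p, ‖v‖ = 1 →
      |(n : ℝ)⁻¹ * ∑ i, iteratedDeriv 2 φ ⟪z i, b⟫ * ⟪z i, v⟫ ^ 2
        - (μ₂ * ⟪act (spikedCov σ θ u) v, v⟫ + μ₄ * ⟪act (spikedCov σ θ u) b, v⟫ ^ 2)| ≤ D)
    (hC : ∀ u v : Vec p, ‖u‖ ≤ 1 → ‖v‖ ≤ 1 →
      (n : ℝ)⁻¹ * ∑ i, |⟪z i, u⟫| * ⟪z i, v⟫ ^ 2 ≤ C₃) (hC0 : 0 ≤ C₃)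
    (he1 : 3 * e ≤ 1) (heσ : 3 * e ≤ σ ^ 2 / 2) (hem : e₂ ≤ m / 2)
    (heξ : (1 + s * R ^ 2) * e₂ + B₄ * R ^ 2 * (3 * e) ≤ ξ / 2) :
    ‖projBall R (b - act (scaling φ z (eigThreshold (subCov_isHermitian z T) r hr) b)
        (gradient (negLogLik φ z y) b)) - bs‖
      ≤ (m / 2)⁻¹ * ((σ ^ 2 / 2)⁻¹ + B₄ / (ξ / 2) * R ^ 2) *
        ((((s + s ^ 2 * R ^ 2) * e₂ + (B₂ + 2 * s * R ^ 2 * B₄) * (3 * e)) + D) * ‖b - bs‖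
          + B₃ * C₃ * ‖b - bs‖ ^ 2) := by
  set Sig := spikedCov σ θ u with hSig
  set Z := eigThreshold (subCov_isHermitian z T) r hr with hZdef
  set d := b - bs with hd
  have hB4 : 0 ≤ B₄ := (abs_nonneg _).trans (h₄ 0)
  have hθs : 0 ≤ ∑ i, θ i := Finset.sum_nonneg fun i _ => hθ i
  have hs0 : 0 ≤ s := by rw [hs]; positivity
  have hσ2 : 0 < σ ^ 2 / 2 := by positivity
  have hZA : ∀ w, ‖act Z w - act (subCov z T) w‖ ≤ 2 * e * ‖w‖ := by
    refine norm_act_eigThreshold_sub_le (subCov_isHermitian z T) hr σ hθ u he fun w => ?_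
    refine (abs_real_inner_le_norm _ _).trans ?_
    calc _ ≤ e * ‖w‖ * ‖w‖ := mul_le_mul_of_nonneg_right (hcov w) (norm_nonneg _)
      _ = _ := by ring
  have hZS : ∀ w, ‖act Z w - act Sig w‖ ≤ 3 * e * ‖w‖ := fun w => by
    have : act Z w - act Sig w
        = (act Z w - act (subCov z T) w) + (act (subCov z T) w - act Sig w) := by abel
    rw [this]
    refine (norm_add_le _ _).trans ?_
    linarith [hZA w, hcov w]
  have hSn : ∀ w, ‖act Sig w‖ ≤ s * ‖w‖ := fun w =>
    (norm_act_spikedCov_le σ hθ hu w).trans (by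
      apply mul_le_mul_of_nonneg_right _ (norm_nonneg _)
      rw [hs]; linarith)
  have hZn : ∀ w, ‖act Z w‖ ≤ s * ‖w‖ := fun w => by
    have : act Z w = act Sig w + (act Z w - act Sig w) := by abel
    rw [this]
    refine (norm_add_le _ _).trans ?_
    have h1 := norm_act_spikedCov_le σ hθ hu w
    have h2 := (hZS w).trans (mul_le_mul_of_nonneg_right he1 (norm_nonneg _))
    rw [hs, add_mul]
    exact add_le_add h1 h2
  have hZlow : ∀ w : Vec p, σ ^ 2 / 2 * ‖w‖ ^ 2 ≤ ⟪act Z w, w⟫ := fun w => by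
    have h1 := le_quadratic_spikedCov σ hθ u w
    have h2 : |⟪act Z w - act Sig w, w⟫| ≤ σ ^ 2 / 2 * ‖w‖ ^ 2 := by
      refine (abs_real_inner_le_norm _ _).trans ?_
      calc _ ≤ σ ^ 2 / 2 * ‖w‖ * ‖w‖ := by
            refine mul_le_mul_of_nonneg_right ((hZS w).trans ?_) (norm_nonneg _)
            exact mul_le_mul_of_nonneg_right heσ (norm_nonneg _)
        _ = _ := by ring
    rw [inner_sub_left] at h2
    linarith [(abs_le.1 h2).1]
  obtain ⟨hinv, hinvn⟩ := norm_act_inv_le hσ2 hZlow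
  set m₂ := sampleMean φ z 2 b with hm₂
  set m₄ := sampleMean φ z 4 b with hm₄
  have hm2low : m / 2 ≤ m₂ := by linarith [(abs_le.1 hm2).1]
  have hm4B : |m₄| ≤ B₄ := by
    have hn0 : (0 : ℝ) < n := by exact_mod_cast hn
    rw [hm₄, sampleMean, abs_mul, abs_of_pos (by positivity), inv_mul_le_iff₀ hn0]
    refine (Finset.abs_sum_le_sum_abs _ _).trans ((Finset.sum_le_sum fun i _ => h₄ _).trans ?_)
    simp
  have hden : ξ / 2 ≤ |m₂ + m₄ * ⟪act Z b, b⟫| := by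
    have h1 := abs_denominator_sub_le hZn hZS hm2 hm4 hμ4 hs0 (by positivity) hb
    have h2 := abs_sub_abs_le_abs_sub (μ₂ + μ₄ * ⟪act Sig b, b⟫) (m₂ + m₄ * ⟪act Z b, b⟫)
    rw [abs_sub_comm] at h1
    linarith
  have hQ : scaling φ z Z b
      = m₂⁻¹ • (Z⁻¹ - (m₄ / (m₂ + m₄ * ⟪act Z b, b⟫)) • outer b) := rfl
  have hQn : ∀ w, ‖act (scaling φ z Z b) w‖
      ≤ (m / 2)⁻¹ * ((σ ^ 2 / 2)⁻¹ + B₄ / (ξ / 2) * R ^ 2) * ‖w‖ := fun w => by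
    rw [hQ]
    exact norm_act_shermanMorrison_le hinvn (by positivity) (by positivity) hm2low hm4B hden hb w
  have hQinv := act_shermanMorrison (eigThreshold_isHermitian (subCov_isHermitian z T) r hr) hinv
    (b := b) (m₂ := m₂) (m₄ := m₄) (by linarith)
    (by
      intro h0
      rw [← hZdef] at h0
      rw [h0, abs_zero] at hden
      linarith) d
  rw [← hZdef, ← hQ] at hQinv
  set g := gradient (negLogLik φ z y) b with hg
  set Md := m₂ • act Z d + (m₄ * ⟪act Z b, d⟫) • act Z b with hMd
  set Pd := μ₂ • act Sig d + (μ₄ * ⟪act Sig b, d⟫) • act Sig b with hPd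
  have n1 : ‖Md - Pd‖ ≤ ((s + s ^ 2 * R ^ 2) * e₂ + (B₂ + 2 * s * R ^ 2 * B₄) * (3 * e)) * ‖d‖ :=
    norm_rankOneUpdate_sub_le hZn hSn hZS hm2 hm4 hμ2 hμ4 hs0 (by positivity) hb d
  have n2 : ‖Pd - empHess φ z b d‖ ≤ D * ‖d‖ :=
    norm_rankOneUpdate_sub_empHess_le (spikedCov_isHermitian σ θ u) hD hH d
  have n3 : ‖g - empHess φ z b d‖ ≤ B₃ * C₃ * ‖d‖ ^ 2 :=
    norm_gradient_sub_empHess_le hφ h₃ hC hC0 hmin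
  -- The step maps the error `d` to `d - Q ∇ℓ(b) = Q (M̂ d - ∇ℓ(b))`, as `Q` inverts `M̂`.
  have hstep : b - act (scaling φ z Z b) g - bs = act (scaling φ z Z b) (Md - g) := by
    rw [act_sub_right, hQinv, hd]; abel
  refine (norm_projBall_sub_le hR _ hbs).trans ?_
  rw [hstep]
  refine (hQn _).trans ?_
  have hκ : 0 ≤ (m / 2)⁻¹ * ((σ ^ 2 / 2)⁻¹ + B₄ / (ξ / 2) * R ^ 2) := by positivity
  refine mul_le_mul_of_nonneg_left ?_ hκ
  have hsplit : Md - g = (Md - Pd) + (Pd - empHess φ z b d) - (g - empHess φ z b d) := by abel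
  rw [hsplit]
  refine (norm_sub_le _ _).trans ((add_le_add (norm_add_le _ _) le_rfl).trans ?_)
  rw [add_mul]
  linarith

end Step

/-! ### The event of well-behaved data -/

section GoodEvent

variable {p n : ℕ}

/-- With probability at least `1 - 10 e⁻ᵖ` the sub-sampled covariance, the sample means of
`φ''` and `φ''''`, the empirical Hessian and the empirical third moments are close to their
population values, uniformly over the ball of radius `R`. -/
lemma exists_good_event {φ : ℝ → ℝ} (hφ : ContDiff ℝ 5 φ) {L a R c : ℝ} (hp : 0 < p)
    (h₂ : ∀ z, |iteratedDeriv 2 φ z| ≤ L ^ 2) (h₃ : ∀ z, |iteratedDeriv 3 φ z| ≤ L ^ 2)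
    (h₄ : ∀ z, |iteratedDeriv 4 φ z| ≤ L ^ 2) (h₅ : ∀ z, |iteratedDeriv 5 φ z| ≤ L ^ 2)
    {ν : Measure (Vec p)} [IsProbabilityMeasure ν] (hc : 0 < c) (hc1 : c ≤ 1)
    (hν : HasExpSquareMoment ν c) {Sig : Matrix (Fin p) (Fin p) ℝ}
    (hS : ∀ i j, ∫ x : Vec p, x i * x j ∂ν = Sig i j)
    {Ω : Type*} [MeasurableSpace Ω] {P : Measure Ω} [IsProbabilityMeasure P]
    {x : Fin n → Ω → Vec p} (hx : ∀ i, Measurable (x i)) (hind : iIndepFun x P)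
    (hlaw : ∀ i, P.map (x i) = ν) (ha : 0 < a) (hR : 1 ≤ R) (hLn : L ^ 10 = n)
    (hL2 : 2 ≤ L) (hpL : (p : ℝ) ≤ L ^ 2) (hpa : a * (p * Real.log n) ≤ L ^ 2)
    (hlog : 1 ≤ Real.log n) (hLc : 16 / a + 49 ≤ c * L) (hLR : 20 * R * (c ^ 2)⁻¹ ≤ L)
    (hlog2 : 2 ≤ c * a * Real.log n) (hLa : 2 ≤ c * a * L ^ 2)
    {T : Ω → Finset (Fin n)} {s : ℕ} (hsn : s ≤ n) (hps : 4 * p ≤ s)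
    (hTm : ∀ A, MeasurableSet {ω | T ω = A})
    (hT : ∀ A : Finset (Fin n), A.card = s → P {ω | T ω = A} = ((n.choose s : ℕ) : ℝ≥0∞)⁻¹)
    (hindT : Indep (MeasurableSpace.comap T ⊤)
      (MeasurableSpace.comap (fun ω i => x i ω) inferInstance) P) :
    ∃ Bad : Set Ω, P.real Bad ≤ 10 * Real.exp (-p) ∧ ∀ ω ∉ Bad,
      (∀ w, ‖act (subCov (fun i => x i ω) (T ω)) w - act Sig w‖
        ≤ 84 * c⁻¹ * Real.sqrt (p / s) * ‖w‖) ∧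
      (∀ b : Vec p, ‖b‖ ≤ R → |sampleMean φ (fun i => x i ω) 2 b - popMean φ ν 2 b| ≤ 3 / L) ∧
      (∀ b : Vec p, ‖b‖ ≤ R → |sampleMean φ (fun i => x i ω) 4 b - popMean φ ν 4 b| ≤ 3 / L) ∧
      (∀ b v : Vec p, ‖b‖ ≤ R → ‖v‖ ≤ 1 →
        |(n : ℝ)⁻¹ * ∑ i, iteratedDeriv 2 φ ⟪x i ω, b⟫ * ⟪x i ω, v⟫ ^ 2
          - ∫ x, ⟪v, x⟫ ^ 2 * iteratedDeriv 2 φ ⟪x, b⟫ ∂ν| ≤ 6 / L) ∧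
      (∀ u v : Vec p, ‖u‖ ≤ 1 → ‖v‖ ≤ 1 →
        (n : ℝ)⁻¹ * ∑ i, |⟪x i ω, u⟫| * ⟪x i ω, v⟫ ^ 2 ≤ 3 + 2 * c⁻¹ + 2 * (c ^ 2)⁻¹) := by
  have hL0 : 0 < L := by linarith
  have hLsq : 1 ≤ L ^ 2 := one_le_pow₀ (by linarith)
  have hn0 : (0 : ℝ) < n := by rw [← hLn]; positivity
  have hn : 0 < n := by exact_mod_cast hn0
  -- the covariance of the random sub-sample
  have hcov := fun (A : Finset (Fin n)) (hA : A.card = s) =>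
    exists_bad_set_subCov hc hν hS hx hind hlaw A (by omega) (by omega)
  choose! C hCm hCP hC using hcov
  have hPC : P.real {ω | (T ω).card ≠ s ∨ (fun i => x i ω) ∈ C (T ω)} ≤ 2 * Real.exp (-p) := by
    have := measure_mem_random_set_le hsn hTm hT hindT C hCm
      (ε := ENNReal.ofReal (2 * Real.exp (-p))) fun A hA => by
        rw [← ofReal_measureReal (measure_ne_top P _)]
        exact ENNReal.ofReal_le_ofReal (hCP A hA)
    exact ENNReal.toReal_le_of_le_ofReal (by positivity) this
  -- The three empirical processes; in the third one `|s|` is truncated at `L²`, which changes nothing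
  -- for covariates of norm at most `L²`.
  have hunif := fun {f : ℝ → ℝ} (hf : ∀ s, |f s| ≤ L ^ 2)
      (hfL : ∀ s t, |f s - f t| ≤ L ^ 2 * |s - t|) =>
    exists_bad_set_weighted_rate hc hc1 hν hx hind hlaw ha hR hLn hL2 hpL hpa hlog hLc hLR hf hfL
  obtain ⟨A2, hA2, hA2'⟩ := hunif h₂ (abs_iteratedDeriv_sub_le hφ (by norm_num) h₃)
  obtain ⟨A4, hA4, hA4'⟩ := hunif h₄ (abs_iteratedDeriv_sub_le hφ (by norm_num) h₅)
  obtain ⟨A3, hA3, hA3'⟩ := hunif (f := fun s => min |s| (L ^ 2))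
    (fun s => by
      rw [abs_of_nonneg (le_min (abs_nonneg _) (by positivity))]
      exact min_le_right _ _)
    (fun s t => by
      have h1 : |min |s| (L ^ 2) - min |t| (L ^ 2)| ≤ |(|s| - |t|)| :=
        (abs_min_sub_min_le_max |s| (L ^ 2) |t| (L ^ 2)).trans (max_le le_rfl (by simp))
      exact h1.trans ((abs_abs_sub_abs_le_abs_sub s t).trans
        (le_mul_of_one_le_left (abs_nonneg _) hLsq)))
  have hmax := measureReal_exists_lt_norm_le hp hc hν hx hlaw ha hL0 hpL hpa hlog2 hLa hn
  set b1 := {ω | (T ω).card ≠ s ∨ (fun i => x i ω) ∈ C (T ω)}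
  set b2 := {ω | (fun i => x i ω) ∈ A2}
  set b3 := {ω | (fun i => x i ω) ∈ A3}
  set b4 := {ω | (fun i => x i ω) ∈ A4}
  set b5 := {ω | ∃ i, L ^ 2 < ‖x i ω‖}
  refine ⟨b1 ∪ b2 ∪ b3 ∪ b4 ∪ b5, ?_, ?_⟩
  · have u1 := measureReal_union_le (μ := P) (b1 ∪ b2 ∪ b3 ∪ b4) b5
    have u2 := measureReal_union_le (μ := P) (b1 ∪ b2 ∪ b3) b4
    have u3 := measureReal_union_le (μ := P) (b1 ∪ b2) b3
    have u4 := measureReal_union_le (μ := P) b1 b2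
    linarith
  · intro ω hω
    simp only [Set.mem_union, not_or] at hω
    obtain ⟨⟨⟨⟨g1, g2⟩, g3⟩, g4⟩, g5⟩ := hω
    have g1' : (T ω).card = s ∧ (fun i => x i ω) ∉ C (T ω) := by
      simpa [b1, not_or] using g1
    have g5' : ∀ i, ‖x i ω‖ ≤ L ^ 2 := fun i => not_lt.1 fun h => g5 ⟨i, h⟩
    have w2 := hA2' _ g2 g5'
    have w3 := hA3' _ g3 g5'
    have w4 := hA4' _ g4 g5'
    have c2 := continuous_iteratedDeriv_of_le hφ (k := 2) (by norm_num)
    refine ⟨?_, fun b hb => ?_, fun b hb => ?_, fun b v hb hv => ?_, fun u v hu hv => ?_⟩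
    · have := hC _ g1'.1 _ g1'.2
      rwa [g1'.1] at this
    · simpa [weighted, sampleMean, popMean] using w2 b 0 hb (by simp)
    · simpa [weighted, sampleMean, popMean] using w4 b 0 hb (by simp)
    · have h1 := abs_le.1 (w2 b v hb hv)
      have h0 := abs_le.1 (w2 b 0 hb (by simp))
      have i1 := hν.integrable_weighted hc c2 h₂ b hv
      have i0 := hν.integrable_weighted hc c2 h₂ b (v := 0) (by simp)
      have e1 : (n : ℝ)⁻¹ * ∑ i, iteratedDeriv 2 φ ⟪x i ω, b⟫ * ⟪x i ω, v⟫ ^ 2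
          = (n : ℝ)⁻¹ * ∑ i, weighted (iteratedDeriv 2 φ) b v (x i ω)
            - (n : ℝ)⁻¹ * ∑ i, weighted (iteratedDeriv 2 φ) b 0 (x i ω) := by
        rw [← mul_sub, ← Finset.sum_sub_distrib]
        congr 1
        exact Finset.sum_congr rfl fun i _ => by simp [weighted]; ring
      have e2 : ∫ x, ⟪v, x⟫ ^ 2 * iteratedDeriv 2 φ ⟪x, b⟫ ∂ν
          = ∫ x, weighted (iteratedDeriv 2 φ) b v x ∂ν
            - ∫ x, weighted (iteratedDeriv 2 φ) b 0 x ∂ν := by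
        rw [← integral_sub i1 i0]
        refine integral_congr_ae (ae_of_all _ fun x => ?_)
        simp only [weighted, inner_zero_right, real_inner_comm x v]
        ring
      have e3 : 6 / L = 3 / L + 3 / L := by ring
      rw [e1, e2, e3, abs_le]
      constructor <;> linarith [h1.1, h1.2, h0.1, h0.2]
    · have h1 := (abs_le.1 (w3 u v (hu.trans hR) hv)).2
      have e1 : ∑ i, |⟪x i ω, u⟫| * ⟪x i ω, v⟫ ^ 2
          ≤ ∑ i, weighted (fun s => min |s| (L ^ 2)) u v (x i ω) := by
        refine Finset.sum_le_sum fun i _ => ?_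
        have h2 : |⟪x i ω, u⟫| ≤ L ^ 2 :=
          (abs_real_inner_le_norm _ _).trans (by nlinarith [g5' i, norm_nonneg (x i ω)])
        simp only [weighted]
        rw [min_eq_left h2]
        nlinarith [abs_nonneg ⟪x i ω, u⟫]
      have j1 := hν.integrable_sq hc hu
      have j2 := hν.integrable_pow_four hc hv
      have k1 := hν.integral_sq_le hc hu
      have k2 := hν.integral_pow_four_le hc hv
      have hle : ∀ x : Vec p, weighted (fun s => min |s| (L ^ 2)) u v x
          ≤ (1 / 2 + ⟪x, u⟫ ^ 2) + 1 / 2 * ⟪x, v⟫ ^ 4 := fun x => by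
        simp only [weighted]
        have h3 : min |⟪x, u⟫| (L ^ 2) * (1 + ⟪x, v⟫ ^ 2) ≤ |⟪x, u⟫| * (1 + ⟪x, v⟫ ^ 2) :=
          mul_le_mul_of_nonneg_right (min_le_left _ _) (by positivity)
        have h4 : ⟪x, u⟫ ^ 2 = |⟪x, u⟫| ^ 2 := (sq_abs _).symm
        rw [h4]
        nlinarith [sq_nonneg (|⟪x, u⟫| - 1), sq_nonneg (|⟪x, u⟫| - ⟪x, v⟫ ^ 2)]
      have jj : Integrable (fun x : Vec p => 1 / 2 + ⟪x, u⟫ ^ 2) ν := (integrable_const _).add j1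
      have e2 : ∫ x, weighted (fun s => min |s| (L ^ 2)) u v x ∂ν
          ≤ 1 / 2 + 2 * c⁻¹ + 1 / 2 * (2 * (2 * (c ^ 2)⁻¹)) := by
        calc _ ≤ ∫ x, ((1 / 2 + ⟪x, u⟫ ^ 2) + 1 / 2 * ⟪x, v⟫ ^ 4) ∂ν := by
              refine integral_mono (hν.integrable_weighted hc (by fun_prop) (M := L ^ 2)
                (fun s => ?_) u hv) (jj.add (j2.const_mul _)) hle
              rw [abs_of_nonneg (le_min (abs_nonneg _) (by positivity))]
              exact min_le_right _ _
          _ = 1 / 2 + ∫ x, ⟪x, u⟫ ^ 2 ∂ν + 1 / 2 * ∫ x, ⟪x, v⟫ ^ 4 ∂ν := by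
              rw [integral_add jj (j2.const_mul _), integral_add (integrable_const _) j1,
                integral_const_mul]
              simp
          _ ≤ _ := by linarith
      have e3 : 3 / L ≤ 3 / 2 := div_le_div_of_nonneg_left (by norm_num) (by norm_num) hL2
      have e4 := mul_le_mul_of_nonneg_left e1 (by positivity : (0 : ℝ) ≤ (n : ℝ)⁻¹)
      linarith

end GoodEvent

/-! ### From the high-probability bound to expectations -/

section Expectation

/-- A measurable generalized inverse of a continuous increasing function. -/
lemma exists_le_of_continuous_monotone {F : ℝ≥0∞ → ℝ≥0∞} (hF : Continuous F) (hmono : Monotone F)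
    (htop : F ⊤ = ⊤) : ∃ ψ : ℝ≥0∞ → ℝ≥0∞, Measurable ψ ∧ (∀ t, t ≤ F (ψ t)) ∧
      ∀ s t, t ≤ F s → ψ t ≤ s := by
  refine ⟨fun t => sInf {s | t ≤ F s}, ?_, fun t => ?_, fun s t h => sInf_le h⟩
  · exact Monotone.measurable fun t t' h => sInf_le_sInf fun s hs => h.trans hs
  · rw [Monotone.map_sInf_of_continuousAt hF.continuousAt hmono htop]
    refine le_sInf ?_
    rintro _ ⟨s, hs, rfl⟩
    exact hs

/-- A bound `d' ≤ F(d)` with `F` quadratic that holds up to an error supported on an event of small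
probability passes to the integrals. No measurability of `d` and `d'` is needed: both can be
replaced by measurable minorants with the same integral, because `F` is continuous and increasing. -/
lemma lintegral_le_of_le_quadratic {Ω : Type*} [MeasurableSpace Ω] {P : Measure Ω}
    {d d' : Ω → ℝ≥0∞} {A : Set Ω} (hA : MeasurableSet A) {a b C : ℝ≥0∞} (ha : a ≠ ⊤) (hb : b ≠ ⊤)
    (hb0 : b ≠ 0) (h : ∀ ω, d' ω ≤ a * d ω + b * d ω ^ 2 + A.indicator (fun _ => C) ω) :
    ∫⁻ ω, d' ω ∂P ≤ a * ∫⁻ ω, d ω ∂P + b * ∫⁻ ω, d ω ^ 2 ∂P + C * P A := by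
  set F : ℝ≥0∞ → ℝ≥0∞ := fun s => a * s + b * s ^ 2 with hF
  have hFm : Monotone F := fun s t hst => by simp only [hF]; gcongr
  have hFc : Continuous F := by
    refine (ENNReal.continuous_const_mul ha).add ?_
    exact (ENNReal.continuous_const_mul hb).comp (ENNReal.continuous_pow 2)
  have hFt : F ⊤ = ⊤ := by
    simp only [hF]
    rw [ENNReal.top_pow two_ne_zero, ENNReal.mul_top hb0, add_top]
  obtain ⟨ψ, hψm, hψ1, hψ2⟩ := exists_le_of_continuous_monotone hFc hFm hFt
  obtain ⟨g, hgm, hgle, hgI⟩ := exists_measurable_le_lintegral_eq P d'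
  obtain ⟨k, hkm, hkle, hkI⟩ := exists_measurable_le_lintegral_eq P d
  set ind : Ω → ℝ≥0∞ := A.indicator fun _ => C with hind
  have hindm : Measurable ind := measurable_const.indicator hA
  set e : Ω → ℝ≥0∞ := fun ω => max (ψ (g ω - ind ω)) (k ω) with he
  have hem : Measurable e := (hψm.comp (hgm.sub hindm)).max hkm
  have hed : ∀ ω, e ω ≤ d ω := fun ω => max_le (hψ2 _ _ (by
    rw [tsub_le_iff_right]
    exact (hgle ω).trans (h ω))) (hkle ω)
  have hge : ∀ ω, g ω ≤ a * e ω + b * e ω ^ 2 + ind ω := fun ω => by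
    rw [← tsub_le_iff_right]
    exact (hψ1 _).trans (hFm (le_max_left _ _))
  rw [hgI]
  calc ∫⁻ ω, g ω ∂P ≤ ∫⁻ ω, (a * e ω + b * e ω ^ 2 + ind ω) ∂P := lintegral_mono hge
    _ = a * ∫⁻ ω, e ω ∂P + b * ∫⁻ ω, e ω ^ 2 ∂P + C * P A := by
        rw [lintegral_add_right _ hindm, lintegral_add_right _ (by fun_prop),
          lintegral_const_mul _ hem, lintegral_const_mul _ (by fun_prop), hind,
          lintegral_indicator_const hA]
    _ ≤ _ := by
        gcongr with ω ω
        · exact hed ω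
        · exact hed ω

end Expectation

section Passage

variable {Ω : Type*} [MeasurableSpace Ω] {P : Measure Ω}

/-- A lower bound for a conditional probability. Neither set has to be measurable: only
`P (T ∩ E) ≤ P.restrict E T` is used, which always holds. -/
lemma one_sub_div_le_cond_real [IsProbabilityMeasure P] {E T : Set Ω} {q η : ℝ} (hq : 0 < q)
    (hE : q ≤ P.real E) (hη : 0 ≤ η) (h : P.real (E \ T) ≤ η) :
    1 - η / q ≤ (ProbabilityTheory.cond P E).real T := by
  have hE0 : 0 < P.real E := hq.trans_le hE
  have h1 : (ProbabilityTheory.cond P E).real T = (P.real E)⁻¹ * (P.restrict E).real T := by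
    simp [ProbabilityTheory.cond, measureReal_def]
  have h2 : P.real (T ∩ E) ≤ (P.restrict E).real T :=
    ENNReal.toReal_mono (measure_ne_top _ _) (Measure.le_restrict_apply _ _)
  have h3 : P.real E ≤ P.real (T ∩ E) + P.real (E \ T) := by
    refine (measureReal_mono ?_).trans (measureReal_union_le _ _)
    intro ω hω
    by_cases hT : ω ∈ T
    · exact Or.inl ⟨hT, hω⟩
    · exact Or.inr ⟨hω, hT⟩
  have h4 : η / P.real E ≤ η / q := div_le_div_of_nonneg_left hη hq hE
  have h5 : 1 - η / P.real E = (P.real E)⁻¹ * (P.real E - η) := by field_simp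
  rw [h1]
  calc 1 - η / q ≤ (P.real E)⁻¹ * (P.real E - η) := by linarith
    _ ≤ _ := by gcongr; linarith

/-- From a one-step bound outside a set of probability at most `η²` to a bound in expectation.
For `η < 1/2` the increment `2R` on the exceptional set is absorbed into `0.1 ∫ d`; for `η ≥ 1/2`
the mean of `d` exceeds `10R`, and the quadratic term alone dominates `∫ d + 2R` by Jensen's
inequality. -/
lemma lintegral_le_of_step [IsProbabilityMeasure P] {d d' : Ω → ℝ≥0∞} {N : Set Ω}
    {R τ₁ τ₂ η ε : ℝ} (hR : 0 < R) (hτ₁ : 0 ≤ τ₁) (hτ : 1 ≤ R * τ₂)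
    (h1 : ∀ ω ∉ N, d' ω ≤ ENNReal.ofReal τ₁ * d ω + ENNReal.ofReal τ₂ * d ω ^ 2)
    (h2 : ∀ ω, d' ω ≤ d ω + ENNReal.ofReal (2 * R)) (hη : 0 ≤ η) (hN : P.real N ≤ η ^ 2)
    (hε : 20 * R * η ≤ ε) (hd : ENNReal.ofReal ε < ∫⁻ ω, d ω ∂P) :
    ∫⁻ ω, d' ω ∂P ≤ ENNReal.ofReal (τ₁ + 0.1) * ∫⁻ ω, d ω ∂P
      + ENNReal.ofReal τ₂ * ∫⁻ ω, d ω ^ 2 ∂P := by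
  have hτ0 : 0 < τ₂ := pos_of_mul_pos_right (one_pos.trans_le hτ) hR.le
  rcases lt_or_ge η (1 / 2) with hη2 | hη2
  · have key := lintegral_le_of_le_quadratic (P := P) (d := d) (d' := d')
      (measurableSet_toMeasurable P N) (a := ENNReal.ofReal τ₁) (b := ENNReal.ofReal τ₂)
      (C := ENNReal.ofReal (2 * R + 1 / (4 * τ₂))) ENNReal.ofReal_ne_top ENNReal.ofReal_ne_top
      (by simpa using hτ0) (by
        intro ω
        by_cases hω : ω ∈ toMeasurable P N
        · rw [Set.indicator_of_mem hω]
          refine (h2 ω).trans ?_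
          have h3 : d ω + ENNReal.ofReal (2 * R)
              ≤ ENNReal.ofReal τ₂ * d ω ^ 2 + ENNReal.ofReal (2 * R + 1 / (4 * τ₂)) := by
            rcases eq_or_ne (d ω) ⊤ with ht | ht
            · rw [ht]; simp [hτ0]
            · obtain ⟨s, hs⟩ : ∃ s : NNReal, d ω = s := ⟨_, (ENNReal.coe_toNNReal ht).symm⟩
              rw [hs, ← ENNReal.ofReal_coe_nnreal, ← ENNReal.ofReal_pow s.coe_nonneg,
                ← ENNReal.ofReal_mul hτ0.le, ← ENNReal.ofReal_add s.coe_nonneg (by positivity),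
                ← ENNReal.ofReal_add (by positivity) (by positivity)]
              apply ENNReal.ofReal_le_ofReal
              have h4 : τ₂ * (s : ℝ) ^ 2 + (2 * R + 1 / (4 * τ₂)) - (s + 2 * R)
                  = τ₂ * (s - 1 / (2 * τ₂)) ^ 2 := by field_simp; ring
              have h5 : 0 ≤ τ₂ * ((s : ℝ) - 1 / (2 * τ₂)) ^ 2 := by positivity
              linarith
          refine h3.trans ?_
          gcongr
          exact le_add_self
        · rw [Set.indicator_of_notMem hω, add_zero]
          exact h1 ω fun h => hω (subset_toMeasurable P N h))
    refine key.trans ?_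
    have h4 : ENNReal.ofReal (2 * R + 1 / (4 * τ₂)) * P (toMeasurable P N)
        ≤ ENNReal.ofReal 0.1 * ∫⁻ ω, d ω ∂P := by
      rw [measure_toMeasurable, ← ofReal_measureReal,
        ← ENNReal.ofReal_mul (by positivity)]
      have h6 : 1 / (4 * τ₂) ≤ R := by
        rw [div_le_iff₀ (by positivity)]; linarith
      calc ENNReal.ofReal ((2 * R + 1 / (4 * τ₂)) * P.real N)
          ≤ ENNReal.ofReal (0.1 * ε) := by
            apply ENNReal.ofReal_le_ofReal
            calc (2 * R + 1 / (4 * τ₂)) * P.real N ≤ (4 * R) * η ^ 2 := by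
                  gcongr; linarith
              _ ≤ 0.1 * (20 * R * η) := by nlinarith [mul_nonneg hR.le hη]
              _ ≤ 0.1 * ε := by gcongr
        _ = ENNReal.ofReal 0.1 * ENNReal.ofReal ε := ENNReal.ofReal_mul (by norm_num)
        _ ≤ _ := by gcongr
    rw [ENNReal.ofReal_add hτ₁ (by norm_num), add_mul]
    calc _ ≤ ENNReal.ofReal τ₁ * ∫⁻ ω, d ω ∂P + ENNReal.ofReal τ₂ * ∫⁻ ω, d ω ^ 2 ∂P
          + ENNReal.ofReal 0.1 * ∫⁻ ω, d ω ∂P := by gcongr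
      _ = _ := by ring
  · set D := ∫⁻ ω, d ω ∂P with hD
    have hD1 : ENNReal.ofReal (10 * R) ≤ D :=
      (ENNReal.ofReal_le_ofReal (by nlinarith)).trans hd.le
    have hJ : ENNReal.ofReal (10 * R * τ₂) * D ≤ ENNReal.ofReal τ₂ * ∫⁻ ω, d ω ^ 2 ∂P := by
      -- the tangent to the square at `10R`, integrated: a form of Jensen's inequality
      have h3 : ∫⁻ ω, ENNReal.ofReal (20 * R * τ₂) * d ω ∂P
          ≤ ∫⁻ ω, (ENNReal.ofReal τ₂ * d ω ^ 2 + ENNReal.ofReal (100 * R ^ 2 * τ₂)) ∂P := by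
        refine lintegral_mono fun ω => ?_
        rcases eq_or_ne (d ω) ⊤ with ht | ht
        · rw [ht]; simp [hτ0]
        · obtain ⟨s, hs⟩ : ∃ s : NNReal, d ω = s := ⟨_, (ENNReal.coe_toNNReal ht).symm⟩
          simp only [hs]
          rw [← ENNReal.ofReal_coe_nnreal, ← ENNReal.ofReal_pow s.coe_nonneg,
            ← ENNReal.ofReal_mul hτ0.le, ← ENNReal.ofReal_mul (by positivity),
            ← ENNReal.ofReal_add (by positivity) (by positivity)]
          apply ENNReal.ofReal_le_ofReal
          have : 0 ≤ τ₂ * ((s : ℝ) - 10 * R) ^ 2 := by positivity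
          linarith
      rw [lintegral_const_mul' _ _ ENNReal.ofReal_ne_top, lintegral_add_right _ measurable_const,
        lintegral_const_mul' _ _ ENNReal.ofReal_ne_top, lintegral_const, measure_univ,
        mul_one, ← hD] at h3
      have h4 : ENNReal.ofReal (100 * R ^ 2 * τ₂) ≤ ENNReal.ofReal (10 * R * τ₂) * D := by
        rw [show 100 * R ^ 2 * τ₂ = 10 * R * τ₂ * (10 * R) by ring,
          ENNReal.ofReal_mul (by positivity)]
        gcongr
      have h5 : ENNReal.ofReal (10 * R * τ₂) * D + ENNReal.ofReal (100 * R ^ 2 * τ₂)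
          ≤ ENNReal.ofReal τ₂ * ∫⁻ ω, d ω ^ 2 ∂P + ENNReal.ofReal (100 * R ^ 2 * τ₂) := by
        refine le_trans ?_ h3
        rw [show 20 * R * τ₂ = 10 * R * τ₂ + 10 * R * τ₂ by ring,
          ENNReal.ofReal_add (by positivity) (by positivity), add_mul]
        gcongr
      exact (ENNReal.add_le_add_iff_right ENNReal.ofReal_ne_top).1 h5
    have h6 : ∫⁻ ω, d' ω ∂P ≤ D + ENNReal.ofReal (2 * R) := by
      refine (lintegral_mono h2).trans ?_
      rw [lintegral_add_right _ measurable_const, lintegral_const, measure_univ, mul_one]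
    calc ∫⁻ ω, d' ω ∂P ≤ D + ENNReal.ofReal (2 * R) := h6
      _ ≤ D + D := by
        gcongr
        exact (ENNReal.ofReal_le_ofReal (by linarith)).trans hD1
      _ = ENNReal.ofReal 2 * D := by simp [two_mul]
      _ ≤ ENNReal.ofReal (10 * R * τ₂) * D := by
        gcongr
        linarith
      _ ≤ _ := hJ.trans le_add_self

end Passage

/-! ### The choice of the constants -/

section Step

lemma eventually_le_rpow_log (M : ℝ) :
    ∀ᶠ n : ℕ in Filter.atTop, M ≤ (n : ℝ) ^ (0.1 : ℝ) ∧ M ≤ Real.log n :=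
  (((tendsto_rpow_atTop (by norm_num)).comp tendsto_natCast_atTop_atTop).eventually_ge_atTop M).and
    ((Real.tendsto_log_atTop.comp tendsto_natCast_atTop_atTop).eventually_ge_atTop M)

/-- Every error term is dominated by `√(p / min{|S|, n^0.2 / log n})`. -/
lemma inv_rpow_le_sqrt_rate {p n : ℕ} {s : ℕ} (hp : 0 < p) (hn : 0 < n) (hs : 0 < s)
    (hlog : 1 ≤ Real.log n) :
    1 / (n : ℝ) ^ (0.1 : ℝ) ≤
        Real.sqrt ((p : ℝ) / min (s : ℝ) ((n : ℝ) ^ (0.2 : ℝ) / Real.log n)) ∧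
      Real.sqrt ((p : ℝ) / s) ≤
        Real.sqrt ((p : ℝ) / min (s : ℝ) ((n : ℝ) ^ (0.2 : ℝ) / Real.log n)) := by
  have hn' : (0 : ℝ) < n := by exact_mod_cast hn
  have hs' : (0 : ℝ) < s := by exact_mod_cast hs
  have hp' : (1 : ℝ) ≤ p := by exact_mod_cast hp
  have hl : 0 < Real.log n := by linarith
  have hmin : 0 < min (s : ℝ) ((n : ℝ) ^ (0.2 : ℝ) / Real.log n) := lt_min hs' (by positivity)
  constructor
  · apply Real.le_sqrt_of_sq_le
    have h1 : ((n : ℝ) ^ (0.1 : ℝ)) ^ 2 = (n : ℝ) ^ (0.2 : ℝ) := by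
      rw [← Real.rpow_natCast, ← Real.rpow_mul hn'.le]; norm_num
    rw [div_pow, h1, one_pow]
    refine (div_le_div_of_nonneg_left zero_le_one hmin ?_).trans
      (div_le_div_of_nonneg_right hp' hmin.le)
    exact (min_le_right _ _).trans (div_le_self (by positivity) hlog)
  · apply Real.sqrt_le_sqrt
    exact div_le_div_of_nonneg_left (by positivity) hmin (min_le_left _ _)

/-- One step of the method, uniformly over the current point `b` and the minimizer `bs`: there is
an event of probability at least `1 - 10 e⁻ᵖ`, determined by the covariates and the sub-sample
alone, on which every step from a regular point contracts as claimed. -/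
lemma exists_step_bound (r : ℕ) {σ : ℝ} (hσ : 0 < σ) {θ : Fin r → ℝ} (hθ : ∀ i, 0 ≤ θ i)
    {R : ℝ} (hR : 0 < R) (B₂ B₃ B₄ B₅ : ℝ) {ξ : ℝ} (hξ : 0 < ξ) {m : ℝ} (hm : 0 < m) {a : ℝ}
    (ha : 0 < a) {c : ℝ} (hc : 0 < c) (hc1 : c ≤ 1) {s₁ κ c₃ : ℝ}
    (hs₁ : s₁ = σ ^ 2 + ∑ i, θ i + 1)
    (hκ : κ = (m / 2)⁻¹ * ((σ ^ 2 / 2)⁻¹ + |B₄| / (ξ / 2) * R ^ 2))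
    (hc₃ : c₃ = (s₁ + s₁ ^ 2 * R ^ 2) * 3 + (|B₂| + 2 * s₁ * R ^ 2 * |B₄|) * (252 * c⁻¹) + 6) :
    ∃ (C₀ : ℝ) (p₀ n₀ : ℕ), ∀ (p n s : ℕ) (hr : r < p),
      p₀ ≤ p → n₀ ≤ n → C₀ * p ≤ s → s ≤ n →
      a * p ≤ (n : ℝ) ^ (0.2 : ℝ) / Real.log n →
    0 < n ∧ ∀ (φ : ℝ → ℝ), ContDiff ℝ 5 φ →
      (∀ z, |iteratedDeriv 2 φ z| ≤ B₂) → (∀ z, |iteratedDeriv 3 φ z| ≤ B₃) →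
      (∀ z, |iteratedDeriv 4 φ z| ≤ B₄) → (∀ z, |iteratedDeriv 5 φ z| ≤ B₅) →
    ∀ (ν : Measure (Vec p)) [IsProbabilityMeasure ν] (u : Fin r → Vec p), Orthonormal ℝ u →
      HasExpSquareMoment ν c →
      (∀ i j, ∫ x, x i * x j ∂ν = spikedCov σ θ u i j) →
      (∀ b : Vec p, ‖b‖ ≤ R → m ≤ popMean φ ν 2 b) →
    ∀ {Ω : Type*} [MeasurableSpace Ω] (P : Measure Ω) [IsProbabilityMeasure P]
      (x : Fin n → Ω → Vec p) (S : Ω → Finset (Fin n)),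
      (∀ i, Measurable (x i)) → (∀ T, MeasurableSet {ω | S ω = T}) →
      iIndepFun x P → (∀ i, P.map (x i) = ν) →
      (∀ T : Finset (Fin n), T.card = s → P {ω | S ω = T} = ((n.choose s : ℕ) : ℝ≥0∞)⁻¹) →
      Indep (MeasurableSpace.comap S ⊤)
        (MeasurableSpace.comap (fun ω i => x i ω) inferInstance) P →
    ∃ Bad : Set Ω, P.real Bad ≤ 10 * Real.exp (-p) ∧ ∀ ω ∉ Bad, ∀ (y : Fin n → ℝ) (b bs : Vec p),
      ‖b‖ ≤ R → ‖bs‖ ≤ R → IsMinOn (negLogLik φ (fun i => x i ω) y) Set.univ bs →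
      ξ < |popMean φ ν 2 b + popMean φ ν 4 b * ⟪act (spikedCov σ θ u) b, b⟫| →
      ‖projBall R (b - act (scaling φ (fun i => x i ω)
          (eigThreshold (subCov_isHermitian (fun i => x i ω) (S ω)) r hr) b)
          (gradient (negLogLik φ (fun i => x i ω) y) b)) - bs‖
        ≤ tau1 φ R ν (spikedCov σ θ u) n s κ c₃ * ‖b - bs‖ + tau2 p κ 1 * ‖b - bs‖ ^ 2 := by
  set C₃ : ℝ := 3 + 2 * c⁻¹ + 2 * (c ^ 2)⁻¹ with hC₃
  have hC₃0 : 0 ≤ C₃ := by positivity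
  have hs₁0 : 0 < s₁ := by
    have := Finset.sum_nonneg fun i (_ : i ∈ Finset.univ) => hθ i
    rw [hs₁]; positivity
  have hκ0 : 0 ≤ κ := by rw [hκ]; positivity
  -- the admissible size of the covariance error `84 c⁻¹ √(p / s)`
  set X : ℝ := min (1 / 3) (min (σ ^ 2 / 6) (ξ / (12 * (|B₄| * R ^ 2 + 1)))) with hX
  have hX0 : 0 < X := by rw [hX]; positivity
  have hX1 : 3 * X ≤ 1 := by
    have : X ≤ 1 / 3 := min_le_left _ _
    linarith
  have hX2 : 3 * X ≤ σ ^ 2 / 2 := by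
    have : X ≤ σ ^ 2 / 6 := (min_le_right _ _).trans (min_le_left _ _)
    linarith
  have hX3 : |B₄| * R ^ 2 * (3 * X) ≤ ξ / 4 := by
    have h : X ≤ ξ / (12 * (|B₄| * R ^ 2 + 1)) := (min_le_right _ _).trans (min_le_right _ _)
    rw [le_div_iff₀ (by positivity)] at h
    nlinarith
  obtain ⟨p₀, hp₀⟩ := exists_nat_ge (B₃ * C₃)
  have ev := (eventually_le_rpow_log 2).and ((eventually_le_rpow_log ((16 / a + 49) / c)).and
    ((eventually_le_rpow_log (20 * max R 1 * (c ^ 2)⁻¹)).and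
    ((eventually_le_rpow_log (6 / m)).and
    ((eventually_le_rpow_log ((1 + s₁ * R ^ 2) * 12 / ξ)).and
    ((eventually_le_rpow_log (|B₂| + |B₃| + |B₄| + |B₅|)).and
    ((eventually_le_rpow_log (1 / a)).and (eventually_le_rpow_log (2 / (c * a)))))))))
  obtain ⟨n₀, hn₀⟩ := Filter.eventually_atTop.1 ev
  refine ⟨max 4 ((84 * c⁻¹ / X) ^ 2), p₀, max n₀ 1, ?_⟩
  intro p n s hr hpp hnn hCs hsn hpa
  obtain ⟨⟨hL2, hl2⟩, ⟨hLc, -⟩, ⟨hLR, -⟩, ⟨hLm, -⟩, ⟨hLξ, -⟩, ⟨hLB, -⟩, ⟨-, hla⟩, ⟨hLa, hlca⟩⟩ :=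
    hn₀ n ((le_max_left _ _).trans hnn)
  have hn : 0 < n := (le_max_right n₀ 1).trans hnn
  have hn' : (0 : ℝ) < n := by exact_mod_cast hn
  have hp : 0 < p := by omega
  have hp' : (1 : ℝ) ≤ p := by exact_mod_cast hp
  have hL2n : ((n : ℝ) ^ (0.1 : ℝ)) ^ 2 = (n : ℝ) ^ (0.2 : ℝ) := by
    rw [← Real.rpow_natCast, ← Real.rpow_mul hn'.le]; norm_num
  have hLn : ((n : ℝ) ^ (0.1 : ℝ)) ^ 10 = n := by
    rw [← Real.rpow_natCast, ← Real.rpow_mul hn'.le]; norm_num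
  have hps4 : 4 * (p : ℝ) ≤ s :=
    (mul_le_mul_of_nonneg_right (le_max_left _ _) (by positivity)).trans hCs
  have hs0 : (0 : ℝ) < s := by linarith
  have hs : 0 < s := by exact_mod_cast hs0
  obtain ⟨hr1, hr2⟩ := inv_rpow_le_sqrt_rate (p := p) hp hn hs (by linarith)
  set ρ := Real.sqrt ((p : ℝ) / min (s : ℝ) ((n : ℝ) ^ (0.2 : ℝ) / Real.log n)) with hρ
  rw [← hL2n] at hpa
  set L : ℝ := (n : ℝ) ^ (0.1 : ℝ) with hL
  have hL0 : 0 < L := by linarith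
  have hlog0 : 0 < Real.log n := by linarith
  rw [le_div_iff₀ hlog0, mul_assoc] at hpa
  have hpL : (p : ℝ) ≤ L ^ 2 := by
    rw [div_le_iff₀ ha] at hla
    have : (p : ℝ) * 1 ≤ p * (Real.log n * a) := by gcongr
    linarith
  have hLsq : L ≤ L ^ 2 := le_self_pow₀ (by linarith) two_ne_zero
  have hX4 : 84 * c⁻¹ * Real.sqrt (p / s) ≤ X := by
    have h1 : Real.sqrt (p / s) ≤ X / (84 * c⁻¹) := by
      apply Real.sqrt_le_iff.2 ⟨by positivity, ?_⟩
      have h2 : (84 * c⁻¹ / X) ^ 2 * p ≤ s :=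
        (mul_le_mul_of_nonneg_right (le_max_right _ _) (by positivity)).trans hCs
      rw [div_le_iff₀ hs0]
      calc (p : ℝ) = (X / (84 * c⁻¹)) ^ 2 * ((84 * c⁻¹ / X) ^ 2 * p) := by field_simp
        _ ≤ _ := by gcongr
    rw [le_div_iff₀ (by positivity)] at h1
    linarith
  refine ⟨hn, ?_⟩
  intro φ hφ h₂ h₃ h₄ h₅ ν _ u hu hν hcov hmμ Ω _ P _ x S hx hSm hind hlaw hSu hSi
  have hle : ∀ B, |B| ≤ |B₂| + |B₃| + |B₄| + |B₅| → B ≤ L ^ 2 := fun B hB =>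
    (le_abs_self B).trans (hB.trans (hLB.trans hLsq))
  have n2 := abs_nonneg B₂
  have n3 := abs_nonneg B₃
  have n4 := abs_nonneg B₄
  have n5 := abs_nonneg B₅
  obtain ⟨Bad, hBad, hgood⟩ := exists_good_event hφ (L := L) (a := a) (R := max R 1) (c := c) hp
    (fun z => (h₂ z).trans (hle _ (by linarith))) (fun z => (h₃ z).trans (hle _ (by linarith)))
    (fun z => (h₄ z).trans (hle _ (by linarith))) (fun z => (h₅ z).trans (hle _ (by linarith)))
    hc hc1 hν hcov hx hind hlaw ha (le_max_right _ _) hLn hL2 hpL hpa (by linarith)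
    (by rw [div_le_iff₀ hc] at hLc; linarith) hLR
    (by rw [div_le_iff₀ (by positivity)] at hlca; linarith)
    (by
      rw [div_le_iff₀ (by positivity)] at hLa
      calc (2 : ℝ) ≤ c * a * L := by linarith
        _ ≤ _ := by gcongr)
    hsn (by exact_mod_cast hps4) hSm hSu hSi
  refine ⟨Bad, hBad, fun ω hω y b bs hb hbs hmin hreg => ?_⟩
  obtain ⟨g1, g2, g3, g4, g5⟩ := hgood ω hω
  have hb' : ‖b‖ ≤ max R 1 := hb.trans (le_max_left _ _)
  have hm2 : |popMean φ ν 2 b| ≤ |B₂| :=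
    abs_integral_le_of_abs_le fun x => (h₂ _).trans (le_abs_self _)
  have hm4 : |popMean φ ν 4 b| ≤ |B₄| :=
    abs_integral_le_of_abs_le fun x => (h₄ _).trans (le_abs_self _)
  have hL3 : 3 / L ≤ m / 2 := by
    rw [div_le_iff₀ hm] at hLm
    rw [div_le_iff₀ hL0]; linarith
  have hL4 : (1 + s₁ * R ^ 2) * (3 / L) ≤ ξ / 4 := by
    rw [div_le_iff₀ hξ] at hLξ
    rw [← mul_div_assoc, div_le_iff₀ hL0]; linarith
  have hdisc := gaussDiscrepancy_nonneg φ R ν (spikedCov σ θ u)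
  have he0 : 0 ≤ 84 * c⁻¹ * Real.sqrt (p / s) := by positivity
  have step := norm_newton_step_le hφ h₃ (B₂ := |B₂|) (fun z => (h₄ z).trans (le_abs_self _)) hn
    (y := y) hr hσ hθ hu hR.le hb hbs (gradient_eq_zero_of_isMinOn hmin) (C₃ := C₃)
    (D := gaussDiscrepancy φ R ν (spikedCov σ θ u) + 6 / L) hm hξ hs₁ g1 he0 (g2 b hb') (g3 b hb')
    hm2 hm4 (hmμ b hb) hreg (by positivity)
    (fun v hv => by
      refine (abs_sub_le _ (∫ x, ⟪v, x⟫ ^ 2 * iteratedDeriv 2 φ ⟪x, b⟫ ∂ν) _).trans ?_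
      have h1 := g4 b v hb' hv.le
      have h2 := abs_integral_sub_le_gaussDiscrepancy hφ h₂ h₃ h₄ hc hν
        (spikedCov_posSemidef σ hθ u)
        (fun b => by
          rcases eq_or_ne b 0 with h | h
          · exact Or.inl h
          · right
            have h3 := le_quadratic_spikedCov σ hθ u b
            rw [real_inner_comm] at h3
            have : 0 < ‖b‖ := norm_pos_iff.2 h
            exact lt_of_lt_of_le (by positivity) h3) hcov hb hv
      linarith)
    g5 hC₃0 (by linarith) (by linarith) hL3
    (by
      have : |B₄| * R ^ 2 * (3 * (84 * c⁻¹ * Real.sqrt (p / s))) ≤ |B₄| * R ^ 2 * (3 * X) := by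
        gcongr
      linarith)
  refine step.trans ?_
  rw [← hκ, tau1, tau2, ← hρ, mul_one, mul_assoc κ _ ‖b - bs‖,
    mul_assoc κ _ (‖b - bs‖ ^ 2), ← mul_add]
  have f1 : (s₁ + s₁ ^ 2 * R ^ 2) * (3 / L)
      + (|B₂| + 2 * s₁ * R ^ 2 * |B₄|) * (3 * (84 * c⁻¹ * Real.sqrt (p / s)))
      + (gaussDiscrepancy φ R ν (spikedCov σ θ u) + 6 / L)
      ≤ gaussDiscrepancy φ R ν (spikedCov σ θ u) + c₃ * ρ := by
    have e1 : (s₁ + s₁ ^ 2 * R ^ 2) * 3 * (1 / L) ≤ (s₁ + s₁ ^ 2 * R ^ 2) * 3 * ρ := by gcongr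
    have e2 : (|B₂| + 2 * s₁ * R ^ 2 * |B₄|) * (252 * c⁻¹) * Real.sqrt (p / s)
        ≤ (|B₂| + 2 * s₁ * R ^ 2 * |B₄|) * (252 * c⁻¹) * ρ := by gcongr
    have e3 : (6 : ℝ) * (1 / L) ≤ 6 * ρ := by gcongr
    rw [hc₃]
    calc _ = (s₁ + s₁ ^ 2 * R ^ 2) * 3 * (1 / L)
          + (|B₂| + 2 * s₁ * R ^ 2 * |B₄|) * (252 * c⁻¹) * Real.sqrt (p / s) + 6 * (1 / L)
          + gaussDiscrepancy φ R ν (spikedCov σ θ u) := by ring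
      _ ≤ _ := by linarith
  have f2 : B₃ * C₃ ≤ (p : ℝ) ^ (1.5 : ℝ) :=
    calc B₃ * C₃ ≤ p₀ := hp₀
      _ ≤ p := by exact_mod_cast hpp
      _ = (p : ℝ) ^ (1 : ℝ) := (Real.rpow_one _).symm
      _ ≤ _ := Real.rpow_le_rpow_of_exponent_le hp' (by norm_num)
  gcongr

end Step

end NewtonStein

theorem mainTheorem5
    -- the parameters that the constants may depend on
    (r : ℕ) (σ : ℝ) (hσ : 0 < σ) (θ : Fin r → ℝ) (hθ : ∀ i, 0 ≤ θ i)
    (R : ℝ) (hR : 0 < R) (K B₂ B₄ : ℝ)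
    (ξ : ℝ) (hξ : 0 < ξ) (m : ℝ) (hm : 0 < m) (q : ℝ) (hq : 0 < q) :
    ∃ c₁ c₂ c₃ c₄ κ : ℝ, 0 < c₁ ∧ 0 < c₂ ∧ 0 < c₃ ∧ 0 < c₄ ∧ 0 < κ ∧
    -- `a` is the constant implied in `n^0.2 / log n ≳ p`
    ∀ (B₃ B₅ a : ℝ), 0 < a →
    -- `n`, `|S| = s` and `p` are sufficiently large
    ∃ (C₀ : ℝ) (p₀ n₀ : ℕ), ∀ (p n s : ℕ) (hr : r < p),
      p₀ ≤ p → n₀ ≤ n → C₀ * p ≤ s → s ≤ n →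
      a * p ≤ (n : ℝ) ^ (0.2 : ℝ) / Real.log n →
    -- the cumulant generating function
    ∀ (φ : ℝ → ℝ), ContDiff ℝ 5 φ →
      (∀ z, |iteratedDeriv 2 φ z| ≤ B₂) → (∀ z, |iteratedDeriv 3 φ z| ≤ B₃) →
      (∀ z, |iteratedDeriv 4 φ z| ≤ B₄) → (∀ z, |iteratedDeriv 5 φ z| ≤ B₅) →
    -- the law of the covariates
    ∀ (ν : Measure (NewtonStein.Vec p)) (u : Fin r → NewtonStein.Vec p),
      Orthonormal ℝ u →
      NewtonStein.psi2NormVec ν ≤ ENNReal.ofReal K →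
      (∫ x, x ∂ν = 0) →
      (∀ i j, ∫ x, x i * x j ∂ν = NewtonStein.spikedCov σ θ u i j) →
      (∀ b : NewtonStein.Vec p, ‖b‖ ≤ R → m ≤ NewtonStein.popMean φ ν 2 b) →
    -- the data, the random sub-sample, the starting point and the minimizer
    ∀ {Ω : Type*} [MeasurableSpace Ω] (P : Measure Ω) [IsProbabilityMeasure P]
      (x : Fin n → Ω → NewtonStein.Vec p) (y : Fin n → Ω → ℝ) (S : Ω → Finset (Fin n))
      (b₀ bstar : Ω → NewtonStein.Vec p),
      (∀ i, Measurable (x i)) → (∀ i, Measurable (y i)) →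
      (∀ T, MeasurableSet {ω | S ω = T}) → Measurable b₀ → Measurable bstar →
      iIndepFun x P → (∀ i, P.map (x i) = ν) →
      (∀ T : Finset (Fin n), T.card = s → P {ω | S ω = T} = ((n.choose s : ℕ) : ℝ≥0∞)⁻¹) →
      Indep (MeasurableSpace.comap S ⊤)
        (MeasurableSpace.comap (fun ω i => x i ω) inferInstance) P →
      (∀ᵐ ω ∂P, ‖bstar ω‖ ≤ R →
        IsMinOn (NewtonStein.negLogLik φ (fun i => x i ω) (fun i => y i ω)) Set.univ (bstar ω)) →
    -- the step from `β̂^t` to `β̂^(t+1)`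
    ∀ (t : ℕ), (1 ≤ t ∨ ∀ ω, ‖b₀ ω‖ ≤ R) →
    ∀ (Sig : Matrix (Fin p) (Fin p) ℝ) (bhat : ℕ → Ω → NewtonStein.Vec p) (E : Set Ω)
      (τ₁ τ₂ : ℝ),
      Sig = NewtonStein.spikedCov σ θ u →
      bhat = (fun k ω => NewtonStein.iterate φ r hr R (fun i => x i ω) (fun i => y i ω)
        (S ω) (b₀ ω) k) →
      E = NewtonStein.regularEvent φ ν Sig ξ R (bhat t) bstar →
      τ₁ = NewtonStein.tau1 φ R ν Sig n s κ c₃ →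
      τ₂ = NewtonStein.tau2 p κ c₄ →
      q ≤ P.real E →
    -- the bound with high probability that the constants refer to
      1 - c₁ * Real.exp (-(c₂ * p)) ≤
          (cond P E).real {ω | ‖bhat (t + 1) ω - bstar ω‖ ≤
            τ₁ * ‖bhat t ω - bstar ω‖ + τ₂ * ‖bhat t ω - bstar ω‖ ^ 2} ∧
    -- the bound in expectation
      ∀ (δ ε : ℝ), P.real Eᶜ ≤ δ →
        20 * R * Real.sqrt (c₁ * Real.exp (-(c₂ * p)) + δ) ≤ ε →
        ENNReal.ofReal ε < ∫⁻ ω, ‖bhat t ω - bstar ω‖ₑ ∂P →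
        ∫⁻ ω, ‖bhat (t + 1) ω - bstar ω‖ₑ ∂P ≤
          ENNReal.ofReal (τ₁ + 0.1) * ∫⁻ ω, ‖bhat t ω - bstar ω‖ₑ ∂P
            + ENNReal.ofReal τ₂ * ∫⁻ ω, ‖bhat t ω - bstar ω‖ₑ ^ 2 ∂P := by
  have hκ0 : 0 < (m / 2)⁻¹ * ((σ ^ 2 / 2)⁻¹ + |B₄| / (ξ / 2) * R ^ 2) := by positivity
  set c : ℝ := 1 / (12 * (|K| + 1) ^ 2) with hc
  have hc0 : 0 < c := by positivity
  have hc1 : c ≤ 1 := by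
    rw [hc, div_le_one (by positivity)]
    nlinarith [abs_nonneg K]
  have hsum := Finset.sum_nonneg fun i (_ : i ∈ Finset.univ) => hθ i
  obtain ⟨s₁, hs₁⟩ : ∃ s₁, s₁ = σ ^ 2 + ∑ i, θ i + 1 := ⟨_, rfl⟩
  have hs₁0 : 0 < s₁ := by rw [hs₁]; positivity
  obtain ⟨κ, hκ⟩ : ∃ κ, κ = (m / 2)⁻¹ * ((σ ^ 2 / 2)⁻¹ + |B₄| / (ξ / 2) * R ^ 2) := ⟨_, rfl⟩
  rw [← hκ] at hκ0
  obtain ⟨c₃, hc₃⟩ : ∃ c₃, c₃ = (s₁ + s₁ ^ 2 * R ^ 2) * 3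
    + (|B₂| + 2 * s₁ * R ^ 2 * |B₄|) * (252 * c⁻¹) + 6 := ⟨_, rfl⟩
  have hc₃0 : 0 < c₃ := by rw [hc₃]; positivity
  refine ⟨10 / q, 1, c₃, 1, κ, by positivity, one_pos, hc₃0, one_pos, hκ0, ?_⟩
  intro B₃ B₅ a ha
  obtain ⟨C₀, p₀, n₀, H⟩ := NewtonStein.exists_step_bound r hσ hθ hR B₂ B₃ B₄ B₅ hξ hm ha hc0 hc1
    hs₁ hκ hc₃
  -- the quadratic coefficient has to be at least `1 / R`
  obtain ⟨p₁, hp₁⟩ := exists_nat_ge (1 / (R * κ))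
  refine ⟨C₀, max p₀ p₁, n₀, ?_⟩
  intro p n s hr hp hn hs hsn hpa φ hφ h₂ h₃ h₄ h₅ ν u hu hK _ hcov hmμ Ω _ P _ x y S b₀ bstar
    hx _ hSm _ _ hind hlaw hSu hSi hmin t ht Sig bhat E τ₁ τ₂ hSig hbhat hE hτ₁ hτ₂ hqE
  obtain ⟨hn0, H⟩ := H p n s hr ((le_max_left _ _).trans hp) hn hs hsn hpa
  have hprob : IsProbabilityMeasure ν := by
    rw [← hlaw ⟨0, hn0⟩]
    exact Measure.isProbabilityMeasure_map (hx _).aemeasurable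
  obtain ⟨Bad, hBad, hstep⟩ := H φ hφ h₂ h₃ h₄ h₅ ν u hu
    (NewtonStein.hasExpSquareMoment_of_psi2NormVec_le hK) hcov hmμ P x S hx hSm hind hlaw hSu hSi
  subst hSig
  have hsucc : ∀ k ω, ‖bhat (k + 1) ω‖ ≤ R := fun k ω => by
    rw [hbhat]; exact NewtonStein.norm_projBall_le hR.le _
  have hball : ∀ ω, ‖bhat t ω‖ ≤ R := by
    rcases ht with ht | ht
    · obtain ⟨k, rfl⟩ : ∃ k, t = k + 1 := ⟨t - 1, by omega⟩
      exact hsucc k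
    · cases t with
      | zero => intro ω; rw [hbhat]; exact ht ω
      | succ k => exact hsucc k
  set Z : Set Ω := {ω | ¬ (‖bstar ω‖ ≤ R → IsMinOn
    (NewtonStein.negLogLik φ (fun i => x i ω) (fun i => y i ω)) Set.univ (bstar ω))} with hZ
  have hZ0 : P.real Z = 0 := by
    rw [measureReal_def, show P Z = 0 from hmin]; rfl
  have hBZ : P.real (Bad ∪ Z) ≤ 10 * Real.exp (-p) := by
    have := measureReal_union_le (μ := P) Bad Z
    linarith
  have hcontr : ∀ ω ∈ E, ω ∉ Bad ∪ Z → ‖bhat (t + 1) ω - bstar ω‖ ≤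
      τ₁ * ‖bhat t ω - bstar ω‖ + τ₂ * ‖bhat t ω - bstar ω‖ ^ 2 := by
    intro ω hω hBω
    rw [hE] at hω
    obtain ⟨h1, h2⟩ := hω
    rw [Set.mem_union, not_or] at hBω
    have h3 := hstep ω hBω.1 (fun i => y i ω) (bhat t ω) (bstar ω) (hball ω) h2
      (not_not.1 hBω.2 h2) h1
    rw [hτ₁, hτ₂]
    subst hbhat
    exact h3
  have hPE : P.real E ≤ 1 := measureReal_le_one
  have hq1 : q ≤ 1 := hqE.trans hPE
  refine ⟨?_, ?_⟩
  · have := NewtonStein.one_sub_div_le_cond_real (P := P) (E := E)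
      (T := {ω | ‖bhat (t + 1) ω - bstar ω‖ ≤
            τ₁ * ‖bhat t ω - bstar ω‖ + τ₂ * ‖bhat t ω - bstar ω‖ ^ 2}) hq hqE
      (η := 10 * Real.exp (-p)) (by positivity)
      ((measureReal_mono fun ω hω => by_contra fun h => hω.2 (hcontr ω hω.1 h)).trans hBZ)
    rw [one_mul]
    calc _ = 1 - 10 * Real.exp (-p) / q := by ring
      _ ≤ _ := this
  · intro δ ε hδ hε hd
    have hδ0 : 0 ≤ δ := measureReal_nonneg.trans hδ
    have hτ₁0 : 0 ≤ τ₁ := by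
      rw [hτ₁, NewtonStein.tau1]
      have := NewtonStein.gaussDiscrepancy_nonneg φ R ν (NewtonStein.spikedCov σ θ u)
      positivity
    have hτ₂R : 1 ≤ R * τ₂ := by
      have hp1 : (1 : ℝ) ≤ p := by exact_mod_cast (by omega : 1 ≤ p)
      have h1 : 1 / (R * κ) ≤ (p : ℝ) ^ (1.5 : ℝ) :=
        calc 1 / (R * κ) ≤ p₁ := hp₁
          _ ≤ p := by exact_mod_cast (le_max_right _ _).trans hp
          _ = (p : ℝ) ^ (1 : ℝ) := (Real.rpow_one _).symm
          _ ≤ _ := Real.rpow_le_rpow_of_exponent_le hp1 (by norm_num)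
      rw [div_le_iff₀ (by positivity)] at h1
      rw [hτ₂, NewtonStein.tau2]
      linarith
    have hτ₂0 : 0 ≤ τ₂ := by
      rw [hτ₂, NewtonStein.tau2]; positivity
    refine NewtonStein.lintegral_le_of_step (N := Eᶜ ∪ (Bad ∪ Z)) hR hτ₁0 hτ₂R ?_ ?_
      (Real.sqrt_nonneg _) ?_ hε hd
    · intro ω hω
      rw [Set.mem_union, not_or, Set.notMem_compl_iff] at hω
      rw [← ofReal_norm, ← ofReal_norm, ← ENNReal.ofReal_pow (norm_nonneg _),
        ← ENNReal.ofReal_mul hτ₁0, ← ENNReal.ofReal_mul hτ₂0,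
        ← ENNReal.ofReal_add (by positivity) (by positivity)]
      exact ENNReal.ofReal_le_ofReal (hcontr ω hω.1 hω.2)
    · intro ω
      rw [← ofReal_norm, ← ofReal_norm, ← ENNReal.ofReal_add (by positivity) (by positivity)]
      apply ENNReal.ofReal_le_ofReal
      have h1 := norm_add_le (bhat t ω - bstar ω) (bhat (t + 1) ω - bhat t ω)
      have h2 := norm_sub_le (bhat (t + 1) ω) (bhat t ω)
      have h3 := hball ω
      have h4 := hsucc t ω
      rw [show bhat t ω - bstar ω + (bhat (t + 1) ω - bhat t ω) = bhat (t + 1) ω - bstar ω by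
        abel] at h1
      linarith
    · rw [Real.sq_sqrt (by positivity), one_mul]
      have h1 := measureReal_union_le (μ := P) Eᶜ (Bad ∪ Z)
      have h2 : 10 * Real.exp (-p) ≤ 10 / q * Real.exp (-p) := by
        gcongr
        rw [le_div_iff₀ hq]; linarith
      linarith
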